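/- Let $M$ be a smooth $3$-manifold with a smooth Riemannian metric $g$ and a smooth symmetric $2$-tensor $k$. Let $R$ be the scalar curvature of $g$, and define the energy density $\mu$ and momentum density $J$ by $$16\pi\mu=R+(Tr_g k)^2-|k|_g^2,\qquad 8\pi J=div_g\big(k-(Tr_g k)g\big).$$ Let $f,\varphi,u$ be smooth functions on $M$ with $u>0$, let $Y$ be a smooth $1$-form, write $f_i=\partial_i f$, $u_i=\partial_i u$, and put $$\overline g_{ij}=g_{ij}+f_iY_j+f_jY_i+\varphi f_if_j,\qquad \overline k_{ij}=\frac1{2u}\big(\overline\nabla_iY_j+\overline\nabla_jY_i\big),\qquad u^2=\varphi+|Y|^2_{\overline g},$$ where $\overline\nabla$ is the Levi-Civita connection of $\overline g$. Let $\overline Y$ be the vector field that is $\overline g$-dual to $Y$, so that $|Y|^2_{\overline g}=Y(\overline Y)$, and let $\overline R$ be the scalar curvature of $\overline g$. **Theorem 1.** Suppose that $\eta$ is a smooth vector field and $Y^\phi$ a smooth function on $M$ such that * $\mathfrak L_\eta g=\mathfrak L_\eta k=0$ and $div_g k(\eta)=0$; * $\mathfrak L_\eta f=\mathfrak L_\eta\varphi=0$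 and $\mathfrak L_\eta Y=0$; * $\overline Y=Y^\phi\,\eta$; * $div_{\overline g}\overline k(\eta)=0$. Then $\overline g$ is a Riemannian metric, and everywhere on $M$ $$\overline R-|\overline k|_{\overline g}^2=16\pi(\mu-J(v))+|k-\pi|_g^2+2u^{-1}div_{\overline g}(uQ)+(Tr_g\pi)^2-(Tr_gk)^2+2v(Tr_g\pi-Tr_gk),$$ where $v(\cdot)$ in the last term is differentiation along $v$, and, with $g_{i\phi}=g(\partial_i,\eta)$, $Y^\phi_{,i}=\partial_iY^\phi$, $f^i=g^{ij}f_j$, $$\pi_{ij}=\frac{u\nabla_{ij}f+u_if_j+u_jf_i+\frac1{2u}\big(g_{i\phi}Y^\phi_{,j}+g_{j\phi}Y^\phi_{,i}\big)}{\sqrt{1+u^2|\nabla f|_g^2}},$$ $$v^i=\frac{uf^i}{\sqrt{1+u^2|\nabla f|_g^2}},\qquad w^i=\frac{uf^i+u^{-1}\overline Y^i}{\sqrt{1+u^2|\nabla f|_g^2}},$$ $$Q_i=\overline Y^j\overline\nabla_{ij}f-u\,\overline g^{jl}f_l\overline k_{ij}+w^j(k-\pi)_{ij}+uf_iw^lw^j(k-\pi)_{lj}\sqrt{1+u^2|\nabla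 f|_g^2}.$$ Moreover $\pi$ is the second fundamental form of the graph $\{t=f(x)\}$ in $(M\times\mathbb R,\ \overline g-2Y_idx^idt-\varphi\,dt^2)$: $\pi_{ij}=-\widetilde g(\widetilde\nabla_{X_i}X_j,N)$, where $\widetilde g$ is this metric, $\widetilde\nabla$ its Levi-Civita connection, $X_i=\partial_i+f_i\partial_t$, and $N$ is the timelike unit normal of the graph with $dt(N)>0$. Furthermore, if $Y\equiv0$ (so that $\varphi=u^2$), then the same conclusions hold, with $Y^\phi=0$ in the formula for $\pi$, for arbitrary $g,k,f,u$ as above, without any of the four listed hypotheses. -/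

import Mathlib

open scoped Manifold ContDiff Bundle

noncomputable section

/-! ### Tensor calculus in coordinates

Coordinates range over `EuclideanSpace ℝ ι`; a tensor field is given by its components, as functions
of the coordinates. All formulas are the classical coordinate expressions. -/

namespace Coord

variable {ι : Type} [Fintype ι] [DecidableEq ι]

/-- The partial derivative `∂ᵢ F`. -/
def pd (i : ι) (F : EuclideanSpace ℝ ι → ℝ) (y : EuclideanSpace ℝ ι) : ℝ :=
  fderiv ℝ F y (EuclideanSpace.single i 1)

/-- The Christoffel symbol `Γˡᵢⱼ` of the Levi-Civita connection of the (possibly indefinite)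
metric `G`. -/
def christoffel (G : EuclideanSpace ℝ ι → Matrix ι ι ℝ) (l i j : ι)
    (y : EuclideanSpace ℝ ι) : ℝ :=
  (1 / 2) * ∑ m, (G y)⁻¹ l m *
    (pd i (fun z => G z m j) y + pd j (fun z => G z m i) y - pd m (fun z => G z i j) y)

/-- The Ricci tensor `Rᵢⱼ = ∂ₗ Γˡᵢⱼ - ∂ⱼ Γˡᵢₗ + Γˡₗₘ Γᵐᵢⱼ - Γˡⱼₘ Γᵐᵢₗ`. -/
def ricci (G : EuclideanSpace ℝ ι → Matrix ι ι ℝ) (i j : ι) (y : EuclideanSpace ℝ ι) : ℝ :=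
  ∑ l, (pd l (christoffel G l i j) y - pd j (christoffel G l i l) y
    + ∑ m, (christoffel G l l m y * christoffel G m i j y
      - christoffel G l j m y * christoffel G m i l y))

/-- The trace `Gⁱʲ hᵢⱼ`. -/
def tr (G h : EuclideanSpace ℝ ι → Matrix ι ι ℝ) (y : EuclideanSpace ℝ ι) : ℝ :=
  ∑ i, ∑ j, (G y)⁻¹ i j * h y i j

/-- The scalar curvature. -/
def scal (G : EuclideanSpace ℝ ι → Matrix ι ι ℝ) (y : EuclideanSpace ℝ ι) : ℝ :=
  ∑ i, ∑ j, (G y)⁻¹ i j * ricci G i j y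

/-- The squared norm `|h|² = Gⁱᵃ Gʲᵇ hᵢⱼ hₐᵦ` of a covariant 2-tensor. -/
def normSq (G h : EuclideanSpace ℝ ι → Matrix ι ι ℝ) (y : EuclideanSpace ℝ ι) : ℝ :=
  ∑ i, ∑ j, ∑ a, ∑ b, (G y)⁻¹ i a * (G y)⁻¹ j b * h y i j * h y a b

/-- The covariant derivative `∇ᵢ αⱼ` of a 1-form. -/
def cov1 (G : EuclideanSpace ℝ ι → Matrix ι ι ℝ) (α : EuclideanSpace ℝ ι → ι → ℝ) (i j : ι)
    (y : EuclideanSpace ℝ ι) : ℝ :=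
  pd i (fun z => α z j) y - ∑ l, christoffel G l i j y * α y l

/-- The covariant derivative `∇ₗ hᵢⱼ` of a covariant 2-tensor. -/
def cov2 (G h : EuclideanSpace ℝ ι → Matrix ι ι ℝ) (l i j : ι) (y : EuclideanSpace ℝ ι) : ℝ :=
  pd l (fun z => h z i j) y
    - ∑ m, (christoffel G m l i y * h y m j + christoffel G m l j y * h y i m)

/-- The Hessian `∇ᵢⱼ F` of a function. -/
def hess (G : EuclideanSpace ℝ ι → Matrix ι ι ℝ) (F : EuclideanSpace ℝ ι → ℝ) (i j : ι)
    (y : EuclideanSpace ℝ ι) : ℝ :=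
  cov1 G (fun z a => pd a F z) i j y

/-- The divergence `Gⁱʲ ∇ᵢ αⱼ` of a 1-form. -/
def div1 (G : EuclideanSpace ℝ ι → Matrix ι ι ℝ) (α : EuclideanSpace ℝ ι → ι → ℝ)
    (y : EuclideanSpace ℝ ι) : ℝ :=
  ∑ i, ∑ j, (G y)⁻¹ i j * cov1 G α i j y

/-- The divergence `(div h)ⱼ = Gⁱˡ ∇ₗ hᵢⱼ` of a covariant 2-tensor. -/
def div2 (G h : EuclideanSpace ℝ ι → Matrix ι ι ℝ) (y : EuclideanSpace ℝ ι) (j : ι) : ℝ :=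
  ∑ i, ∑ l, (G y)⁻¹ i l * cov2 G h l i j y

/-- The Lie derivative `L_X F` of a function. -/
def lie0 (X : EuclideanSpace ℝ ι → ι → ℝ) (F : EuclideanSpace ℝ ι → ℝ)
    (y : EuclideanSpace ℝ ι) : ℝ :=
  ∑ l, X y l * pd l F y

/-- The Lie derivative `(L_X α)ᵢ` of a 1-form. -/
def lie1 (X : EuclideanSpace ℝ ι → ι → ℝ) (α : EuclideanSpace ℝ ι → ι → ℝ)
    (y : EuclideanSpace ℝ ι) (i : ι) : ℝ :=
  ∑ l, (X y l * pd l (fun z => α z i) y + α y l * pd i (fun z => X z l) y)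

/-- The Lie derivative `(L_X h)ᵢⱼ` of a covariant 2-tensor. -/
def lie2 (X : EuclideanSpace ℝ ι → ι → ℝ) (h : EuclideanSpace ℝ ι → Matrix ι ι ℝ)
    (y : EuclideanSpace ℝ ι) (i j : ι) : ℝ :=
  ∑ l, (X y l * pd l (fun z => h z i j) y
    + h y l j * pd i (fun z => X z l) y + h y i l * pd j (fun z => X z l) y)

end Coord

/-! ### The deformation in a coordinate chart -/

/-- Three-dimensional Euclidean space, the model space of charts. -/
abbrev E3 : Type := EuclideanSpace ℝ (Fin 3)

/-- The coordinate components, in one chart, of all fields that enter the deformation: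
the metric `g`, the tensor `k`, the deformed metric `gbar`, the 1-form `Y`, the vector fields
`Ybar` and `η`, and the functions `f`, `φ`, `u`, `Yφ`. -/
structure ChartData where
  g : E3 → Matrix (Fin 3) (Fin 3) ℝ
  k : E3 → Matrix (Fin 3) (Fin 3) ℝ
  gbar : E3 → Matrix (Fin 3) (Fin 3) ℝ
  Y : E3 → Fin 3 → ℝ
  Ybar : E3 → Fin 3 → ℝ
  η : E3 → Fin 3 → ℝ
  f : E3 → ℝ
  φ : E3 → ℝ
  u : E3 → ℝ
  Yφ : E3 → ℝ

namespace ChartData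

open Coord

variable (L : ChartData)

/-- `fᵢ = ∂ᵢ f`. -/
def df (y : E3) (i : Fin 3) : ℝ := pd i L.f y

/-- `k̄ᵢⱼ = (∇̄ᵢ Yⱼ + ∇̄ⱼ Yᵢ) / (2u)`. -/
def kbar (y : E3) : Matrix (Fin 3) (Fin 3) ℝ := Matrix.of fun i j =>
  1 / (2 * L.u y) * (cov1 L.gbar L.Y i j y + cov1 L.gbar L.Y j i y)

/-- The energy density: `16π μ = R + (Tr k)² - |k|²`. -/
def μ (y : E3) : ℝ :=
  1 / (16 * Real.pi) * (scal L.g y + tr L.g L.k y ^ 2 - normSq L.g L.k y)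

/-- The momentum density: `8π J = div (k - (Tr k) g)`. -/
def J (y : E3) (j : Fin 3) : ℝ :=
  1 / (8 * Real.pi) * div2 L.g (fun z => L.k z - tr L.g L.k z • L.g z) y j

/-- `fⁱ = gⁱʲ fⱼ`, the gradient of `f` with respect to `g`. -/
def gradf (y : E3) (i : Fin 3) : ℝ := ∑ j, (L.g y)⁻¹ i j * L.df y j

/-- `√(1 + u² |∇f|²)`, with the norm and gradient of `g`. -/
def root (y : E3) : ℝ := Real.sqrt (1 + L.u y ^ 2 * ∑ i, L.gradf y i * L.df y i)

/-- `g_{iφ} = g(∂ᵢ, η)`. -/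
def gη (y : E3) (i : Fin 3) : ℝ := ∑ j, L.g y i j * L.η y j

/-- The tensor `π`. -/
def sff (y : E3) : Matrix (Fin 3) (Fin 3) ℝ := Matrix.of fun i j =>
  (L.u y * hess L.g L.f i j y + pd i L.u y * L.df y j + pd j L.u y * L.df y i
    + 1 / (2 * L.u y) * (L.gη y i * pd j L.Yφ y + L.gη y j * pd i L.Yφ y)) / L.root y

/-- The vector field `v`. -/
def v (y : E3) (i : Fin 3) : ℝ := L.u y * L.gradf y i / L.root y

/-- The vector field `w`. -/
def w (y : E3) (i : Fin 3) : ℝ :=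
  (L.u y * L.gradf y i + (L.u y)⁻¹ * L.Ybar y i) / L.root y

/-- The 1-form `Q`. -/
def Q (y : E3) (i : Fin 3) : ℝ :=
  ∑ j, L.Ybar y j * hess L.gbar L.f i j y
    - L.u y * ∑ j, ∑ l, (L.gbar y)⁻¹ j l * L.df y l * L.kbar y i j
    + ∑ j, L.w y j * (L.k y - L.sff y) i j
    + L.u y * L.df y i * (∑ l, ∑ j, L.w y l * L.w y j * (L.k y - L.sff y) l j) * L.root y

/-- The scalar curvature formula at the point with coordinates `y`. In the last term the vector
field `v` acts as a derivation on the function `Tr π - Tr k`. -/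
def ScalarCurvatureFormula (y : E3) : Prop :=
  scal L.gbar y - normSq L.gbar L.kbar y =
    16 * Real.pi * (L.μ y - ∑ i, L.J y i * L.v y i)
    + normSq L.g (fun z => L.k z - L.sff z) y
    + 2 * (L.u y)⁻¹ * div1 L.gbar (fun z i => L.u z * L.Q z i) y
    + tr L.g L.sff y ^ 2 - tr L.g L.k y ^ 2
    + 2 * ∑ i, L.v y i * pd i (fun z => tr L.g L.sff z - tr L.g L.k z) y

/-! The Lorentzian setting: the graph `t = f(x)` in the stationary spacetime with metric
`ḡ - 2 Yᵢ dxⁱ dt - φ dt²`. Spacetime indices are `Fin 3 ⊕ Unit`, the last one being `t`. -/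

/-- The space coordinates of a spacetime point. -/
def space (z : EuclideanSpace ℝ (Fin 3 ⊕ Unit)) : E3 := WithLp.toLp 2 fun i => z (Sum.inl i)

/-- The spacetime metric. -/
def stMetric (z : EuclideanSpace ℝ (Fin 3 ⊕ Unit)) : Matrix (Fin 3 ⊕ Unit) (Fin 3 ⊕ Unit) ℝ :=
  Matrix.fromBlocks (L.gbar (space z)) (Matrix.of fun i _ => -L.Y (space z) i)
    (Matrix.of fun _ j => -L.Y (space z) j) (Matrix.of fun _ _ => -L.φ (space z))

/-- The point `(y, f(y))` of the graph. -/
def graphPt (y : E3) : EuclideanSpace ℝ (Fin 3 ⊕ Unit) :=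
  WithLp.toLp 2 (Sum.elim (fun i => y i) fun _ => L.f y)

/-- The tangent vector `Xᵢ = ∂ᵢ + fᵢ ∂ₜ` of the graph. -/
def graphTangent (i : Fin 3) (y : E3) : Fin 3 ⊕ Unit → ℝ :=
  Sum.elim (Pi.single i 1) fun _ => L.df y i

/-- The spacetime inner product at the point of the graph above `y`. -/
def stInner (y : E3) (A B : Fin 3 ⊕ Unit → ℝ) : ℝ :=
  ∑ a, ∑ b, L.stMetric (L.graphPt y) a b * A a * B b

/-- `N` is the future directed timelike unit normal of the graph at the point above `y`; future
directed means `dt(N) > 0`. -/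
structure IsUnitNormal (y : E3) (N : Fin 3 ⊕ Unit → ℝ) : Prop where
  unit : L.stInner y N N = -1
  normal : ∀ i, L.stInner y N (L.graphTangent i y) = 0
  future : 0 < N (Sum.inr ())

/-- The components of `∇̃_{Xᵢ} Xⱼ` along the graph. -/
def stCov (i j : Fin 3) (y : E3) (a : Fin 3 ⊕ Unit) : ℝ :=
  pd i (fun z => L.graphTangent j z a) y
    + ∑ b, ∑ c, christoffel L.stMetric a b c (L.graphPt y)
      * L.graphTangent i y b * L.graphTangent j y c

/-- `π` is the second fundamental form `-g̃(∇̃_{Xᵢ} Xⱼ, N)` of the graph, at the point above `y`. -/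
def IsGraphSecondFundamentalForm (y : E3) : Prop :=
  (∃! N, L.IsUnitNormal y N) ∧
    ∀ N, L.IsUnitNormal y N → ∀ i j, L.sff y i j = -L.stInner y (L.stCov i j y) N

end ChartData

/-! ### Initial data sets and their deformations on a manifold -/

section Manifold

/-- An initial data set `(M, g, k)`: a smooth Riemannian metric and a smooth symmetric covariant
2-tensor on a 3-manifold. -/
structure InitialDataSet (M : Type*) [TopologicalSpace M] [ChartedSpace E3 M]
    [IsManifold (𝓡 3) ∞ M] where
  g : Bundle.ContMDiffRiemannianMetric (𝓡 3) ∞ E3 (fun x : M => TangentSpace (𝓡 3) x)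
  k : ∀ x : M, TangentSpace (𝓡 3) x →L[ℝ] TangentSpace (𝓡 3) x →L[ℝ] ℝ
  k_symm : ∀ (x : M) (X Z : TangentSpace (𝓡 3) x), k x X Z = k x Z X
  k_smooth : ContMDiff (𝓡 3) ((𝓡 3).prod 𝓘(ℝ, E3 →L[ℝ] E3 →L[ℝ] ℝ)) ∞
    (fun x => Bundle.TotalSpace.mk' (E3 →L[ℝ] E3 →L[ℝ] ℝ) x (k x))

/-- An initial data set with functions `f`, `φ` and a 1-form `Y`, all smooth. -/
structure GraphData (M : Type*) [TopologicalSpace M] [ChartedSpace E3 M]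
    [IsManifold (𝓡 3) ∞ M] extends InitialDataSet M where
  f : M → ℝ
  f_smooth : ContMDiff (𝓡 3) 𝓘(ℝ, ℝ) ∞ f
  φ : M → ℝ
  φ_smooth : ContMDiff (𝓡 3) 𝓘(ℝ, ℝ) ∞ φ
  Y : ∀ x : M, TangentSpace (𝓡 3) x →L[ℝ] ℝ
  Y_smooth : ContMDiff (𝓡 3) ((𝓡 3).prod 𝓘(ℝ, E3 →L[ℝ] ℝ)) ∞
    (fun x => Bundle.TotalSpace.mk' (E3 →L[ℝ] ℝ) x (Y x))

variable {M : Type*} [TopologicalSpace M] [ChartedSpace E3 M] [IsManifold (𝓡 3) ∞ M]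

/-- The differential of `f`. -/
def GraphData.df (D : GraphData M) (x : M) (X : TangentSpace (𝓡 3) x) : ℝ :=
  (mfderiv (𝓡 3) 𝓘(ℝ, ℝ) D.f x X : ℝ)

/-- The symmetric 2-tensor `ḡᵢⱼ = gᵢⱼ + fᵢ Yⱼ + fⱼ Yᵢ + φ fᵢ fⱼ`. -/
def GraphData.gbar (D : GraphData M) (x : M) (X Z : TangentSpace (𝓡 3) x) : ℝ :=
  D.g.inner x X Z + D.df x X * D.Y x Z + D.df x Z * D.Y x X + D.φ x * D.df x X * D.df x Z

/-- All the objects of the deformation: in addition the lapse `u > 0`, and the vector field `Ybar`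
that is dual to the 1-form `Y` with respect to `ḡ`, so that `|Y|²_ḡ = Y(Ybar)` and
`u² = φ + |Y|²_ḡ`. -/
structure Deformation (M : Type*) [TopologicalSpace M] [ChartedSpace E3 M]
    [IsManifold (𝓡 3) ∞ M] extends GraphData M where
  u : M → ℝ
  u_smooth : ContMDiff (𝓡 3) 𝓘(ℝ, ℝ) ∞ u
  u_pos : ∀ x, 0 < u x
  Ybar : ∀ x : M, TangentSpace (𝓡 3) x
  Ybar_dual : ∀ (x : M) (X : TangentSpace (𝓡 3) x), Y x X = toGraphData.gbar x (Ybar x) X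
  u_sq : ∀ x, u x ^ 2 = φ x + Y x (Ybar x)

/-- The coordinate vector field `∂ᵢ` of the chart `e`, at the point with coordinates `y`. -/
def coordVec (e : OpenPartialHomeomorph M E3) (i : Fin 3) (y : E3) :
    TangentSpace (𝓡 3) (e.symm y) :=
  mfderiv (𝓡 3) (𝓡 3) e.symm y (EuclideanSpace.single i (1 : ℝ) : E3)

/-- The components of a vector field in the chart `e`. -/
def vecComp (e : OpenPartialHomeomorph M E3) (X : ∀ x : M, TangentSpace (𝓡 3) x) (y : E3)
    (i : Fin 3) : ℝ :=
  let X' : E3 := mfderiv (𝓡 3) (𝓡 3) e (e.symm y) (X (e.symm y))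
  X' i

/-- The components of a covariant 2-tensor field in the chart `e`. -/
def tensorComp (e : OpenPartialHomeomorph M E3)
    (h : ∀ x : M, TangentSpace (𝓡 3) x → TangentSpace (𝓡 3) x → ℝ) (y : E3) :
    Matrix (Fin 3) (Fin 3) ℝ :=
  Matrix.of fun i j => h (e.symm y) (coordVec e i y) (coordVec e j y)

/-- The components of all fields in the chart `e`. -/
def Deformation.inChart (D : Deformation M) (η : ∀ x : M, TangentSpace (𝓡 3) x) (Yφ : M → ℝ)
    (e : OpenPartialHomeomorph M E3) : ChartData where
  g := tensorComp e fun x X Z => D.g.inner x X Z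
  k := tensorComp e fun x X Z => D.k x X Z
  gbar := tensorComp e D.gbar
  Y := fun y i => D.Y (e.symm y) (coordVec e i y)
  Ybar := vecComp e D.Ybar
  η := vecComp e η
  f := fun y => D.f (e.symm y)
  φ := fun y => D.φ (e.symm y)
  u := fun y => D.u (e.symm y)
  Yφ := fun y => Yφ (e.symm y)

/-- The property `P` of the components holds in every smooth chart, at every point of it. -/
def Deformation.InCharts (D : Deformation M) (η : ∀ x : M, TangentSpace (𝓡 3) x) (Yφ : M → ℝ)
    (P : ChartData → E3 → Prop) : Prop :=
  ∀ e ∈ IsManifold.maximalAtlas (𝓡 3) ∞ M, ∀ y ∈ e.target, P (D.inChart η Yφ e) y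

/-- The hypotheses of the axially symmetric case: `η` is a smooth vector field with
`L_η g = L_η k = 0` and `div_g k(η) = 0`; `L_η f = L_η φ = 0`, `L_η Y = 0`; the shift has only an
`η`-component, `Ybar = Yφ η`; and `div_ḡ k̄(η) = 0`. -/
structure Deformation.IsAxisymmetric (D : Deformation M) (η : ∀ x : M, TangentSpace (𝓡 3) x)
    (Yφ : M → ℝ) : Prop where
  η_smooth : ContMDiff (𝓡 3) (𝓡 3).tangent ∞ (fun x => (⟨x, η x⟩ : TangentBundle (𝓡 3) M))
  Yφ_smooth : ContMDiff (𝓡 3) 𝓘(ℝ, ℝ) ∞ Yφ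
  lie_g : D.InCharts η Yφ fun L y => ∀ i j, Coord.lie2 L.η L.g y i j = 0
  lie_k : D.InCharts η Yφ fun L y => ∀ i j, Coord.lie2 L.η L.k y i j = 0
  div_k : D.InCharts η Yφ fun L y => ∑ j, Coord.div2 L.g L.k y j * L.η y j = 0
  lie_f : D.InCharts η Yφ fun L y => Coord.lie0 L.η L.f y = 0
  lie_φ : D.InCharts η Yφ fun L y => Coord.lie0 L.η L.φ y = 0
  lie_Y : D.InCharts η Yφ fun L y => ∀ i, Coord.lie1 L.η L.Y y i = 0
  shift : ∀ x, D.Ybar x = Yφ x • η x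
  div_kbar : D.InCharts η Yφ fun L y => ∑ j, Coord.div2 L.gbar L.kbar y j * L.η y j = 0

/-- The conclusion: `ḡ` is positive definite (so that its curvature makes sense), and in every
chart the scalar curvature formula holds, with `π` the second fundamental form of the graph in the
Lorentzian setting. -/
structure Deformation.Conclusion (D : Deformation M) (η : ∀ x : M, TangentSpace (𝓡 3) x)
    (Yφ : M → ℝ) : Prop where
  gbar_pos : ∀ (x : M) (X : TangentSpace (𝓡 3) x), X ≠ 0 → 0 < D.gbar x X X
  formula : D.InCharts η Yφ ChartData.ScalarCurvatureFormula
  sff_eq : D.InCharts η Yφ ChartData.IsGraphSecondFundamentalForm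

end Manifold

end

/-!
Write `Ȳ = Yφ η`. Since `df(η) = 0`, the duality `Y = ḡ(Ȳ, ·)` and `φ = u² - |Ȳ|²` give

  `ḡ = Aᵗ (g + u² df²) A`,  `A = 1 + Yφ η ⊗ df`,

so that `ḡ(X, X) = g(X + df(X) Ȳ, X + df(X) Ȳ) + u² df(X)²`, which is positive
(`Deformation.gbar_self`). The scalar curvature is computed in the two steps of this factorization.

* For `g + u² df²`, the case of a static spacetime, `Static.scal_graph`: the difference of the two
  Levi-Civita connections is `π₀ ⊗ v` up to a multiple of `df²`, where `π₀` is `π` without its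
  `Yφ`-term. The Ricci term `Ric(v, v)` that appears is a divergence plus squares, by the Bochner
  formula, and `∇v` is `π₀` up to terms of lower order.
* For the shear by `A` of a metric with Killing field `η`, `Shear.scal_shear`: the difference tensor
  of the connections has no trace, because `A` preserves volume, and the remaining quadratic terms
  are evaluated after transport by `A`. The antisymmetry of `∇η` and the invariance of `f` and
  `Yφ` under `η` reduce them to the inner products of `df` and `dYφ`, and `df(∇_{∇Yφ} η)`.

The result is `R` plus terms in `π`, with a divergence of `π₀(v)` instead of `u Q`. That the
difference is accounted for by `Q` is `Axisym.divg_Q`. For a symmetric invariant tensor `h`, the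
form `h(w) + u df h(w, w) r` is `ḡ`-dual to `h(w)` up to an invariant multiple of `η`
(`Axisym.app_bar_lin`), and such a multiple is divergence free; the divergence of `h(β)`,
`β = u r w`, is `(div h)(β) + u r ⟨h, π⟩`, because `2 u r π = L_β g` (`Axisym.covV_shift_symm`). For
`h = k` this produces the terms `J(v)` and `⟨k, π⟩`, as `div k(η) = 0`. The other two terms of `Q`
are `ḡ`-dual to an explicit vector field (`Axisym.app_bar_Q`), which corrects `π(w)` to `π₀(v)` up
to a multiple of a vector field that `div_ḡ k̄(η) = 0` makes divergence free (`Axisym.divg_grad_b`);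
the derivative of the coefficient yields `|k̄|²`. Altogether this is `Axisym.scal_bar`.

The equation `2 u r π = L_β g` also identifies `π` as the second fundamental form: the future unit
normal of the graph is `N = (∂ₜ + βⁱ Xᵢ) / (u r)`, and `∂ₜ` is a Killing field of the spacetime
(`Lift.isGraphSecondFundamentalForm`).

These computations are polynomial identities in the components of the fields and their derivatives,
with `1 / u` and `1 / r` adjoined, `r = √(1 + u² |∇f|²)`. They are therefore carried out in a
commutative `ℝ`-algebra with three commuting derivations, and applied to the ring of germs of
smooth functions at a point of a chart, `smoothGerms`. There `Yφ` and `u` are invariant under `η`,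
which the hypotheses do not state: `|η|² η(Yφ) = 0` follows from the invariance of `Y`, and
`η(Yφ)` vanishes where `η` does (`AxisymAt.nonempty_lift`).

If `Y = 0`, then `Ȳ = 0` and the hypotheses hold for `η = 0`.
-/

noncomputable section

open Filter Topology

/-! ### Tensor calculus over a ring with commuting derivations -/

namespace DerivCalc

variable {A : Type*} [CommRing A] [Algebra ℝ A] (D : Fin 3 → Derivation ℝ A A)

/-- The Ricci tensor of a connection with symbols `Γ`. -/
def ric (Γ : Fin 3 → Fin 3 → Fin 3 → A) (i j : Fin 3) : A :=
  ∑ l, (D l (Γ l i j) - D j (Γ l i l) + ∑ m, (Γ l l m * Γ m i j - Γ l j m * Γ m i l))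

/-- The divergence of a vector field. -/
def divg (Γ : Fin 3 → Fin 3 → Fin 3 → A) (X : Fin 3 → A) : A :=
  ∑ l, (D l (X l) + ∑ m, Γ m m l * X l)

/-- The covariant derivative `∇ᵢ Xˡ` of a vector field. -/
def covV (Γ : Fin 3 → Fin 3 → Fin 3 → A) (X : Fin 3 → A) (i l : Fin 3) : A :=
  D i (X l) + ∑ m, Γ l i m * X m

/-- The covariant derivative `∇ᵢ αⱼ` of a 1-form. -/
def cov1 (Γ : Fin 3 → Fin 3 → Fin 3 → A) (α : Fin 3 → A) (i j : Fin 3) : A :=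
  D i (α j) - ∑ l, Γ l i j * α l

/-- The covariant derivative `∇ₗ hᵢⱼ` of a covariant 2-tensor. -/
def cov2 (Γ : Fin 3 → Fin 3 → Fin 3 → A) (h : Fin 3 → Fin 3 → A) (l i j : Fin 3) : A :=
  D l (h i j) - ∑ m, (Γ m l i * h m j + Γ m l j * h i m)

/-- The Hessian of a function. -/
def hess (Γ : Fin 3 → Fin 3 → Fin 3 → A) (f : A) (i j : Fin 3) : A :=
  cov1 D Γ (fun a => D a f) i j

/-- The contraction of an inverse metric with a covariant 2-tensor. -/
def tr (gi h : Fin 3 → Fin 3 → A) : A := ∑ i, ∑ j, gi i j * h i j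

/-- The squared norm of a covariant 2-tensor. -/
def normSq (gi h : Fin 3 → Fin 3 → A) : A :=
  ∑ i, ∑ j, ∑ a, ∑ b, gi i a * gi j b * h i j * h a b

/-- The contraction of a matrix with a vector in the second slot: raising or lowering an index,
or inserting a vector into a 2-tensor. -/
def app (h : Fin 3 → Fin 3 → A) (X : Fin 3 → A) (i : Fin 3) : A := ∑ j, h i j * X j

/-- The pairing of a covector and a vector; with `α = D · F` it is the derivative along `X`. -/
def pair (α X : Fin 3 → A) : A := ∑ i, α i * X i

/-- The value `h(X, Z)`. -/
def bil (h : Fin 3 → Fin 3 → A) (X Z : Fin 3 → A) : A := ∑ i, ∑ j, h i j * X i * Z j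

/-- The divergence of a 1-form. -/
def div1 (gi : Fin 3 → Fin 3 → A) (Γ : Fin 3 → Fin 3 → Fin 3 → A) (α : Fin 3 → A) : A :=
  ∑ i, ∑ j, gi i j * cov1 D Γ α i j

/-- The divergence `gⁱˡ ∇ₗ hᵢⱼ` of a covariant 2-tensor. -/
def div2 (gi : Fin 3 → Fin 3 → A) (Γ : Fin 3 → Fin 3 → Fin 3 → A) (h : Fin 3 → Fin 3 → A)
    (j : Fin 3) : A :=
  ∑ i, ∑ l, gi i l * cov2 D Γ h l i j

/-- `Γ` are the Christoffel symbols of the metric `g` with inverse `gi`: the connection is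
symmetric and metric. -/
structure LeviCivita (g gi : Fin 3 → Fin 3 → A) (Γ : Fin 3 → Fin 3 → Fin 3 → A) : Prop where
  symm : ∀ i j, g i j = g j i
  inv_symm : ∀ i j, gi i j = gi j i
  inv : ∀ i j, ∑ l, gi i l * g l j = if i = j then 1 else 0
  torsion : ∀ l i j, Γ l i j = Γ l j i
  compat : ∀ i j k, D i (g j k) = ∑ l, (Γ l i j * g l k + Γ l i k * g j l)

variable {D}

theorem two_mul_cancel {x z : A} (h : 2 * x = 2 * z) : x = z := by
  have h2 : algebraMap ℝ A (1 / 2) * 2 = 1 := by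
    rw [← map_ofNat (algebraMap ℝ A) 2, ← map_mul]; norm_num
  linear_combination algebraMap ℝ A (1 / 2) * h + (z - x) * h2

/-- The contraction of the Ricci tensor of `Γ + C` with the inverse metric `hi` of `Γ + C`, in terms
of the Ricci tensor of `Γ`: the derivatives of the difference tensor `C` form a divergence. -/
theorem scal_add (Γ C : Fin 3 → Fin 3 → Fin 3 → A) (hi : Fin 3 → Fin 3 → A)
  (hΓ : ∀ l i j, Γ l i j = Γ l j i) (hC : ∀ l i j, C l i j = C l j i)
  (hh : ∀ i j, hi i j = hi j i)
  (hD : ∀ l i j, D l (hi i j)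
    = -∑ m, ((Γ i l m + C i l m) * hi m j + (Γ j l m + C j l m) * hi i m)) :
  tr hi (ric D (fun l i j => Γ l i j + C l i j))
   = tr hi (ric D Γ)
    + divg D Γ (fun l => tr hi (C l) - app hi (fun j => ∑ m, C m m j) l)
    + tr hi (fun i j => ∑ l, ∑ m, C l i m * C m j l - (∑ m, C m m i) * (∑ m, C m m j)) := by
  have e1 : ∀ l, Γ l 1 0 = Γ l 0 1 := fun l => hΓ l 1 0
  have e2 : ∀ l, Γ l 2 0 = Γ l 0 2 := fun l => hΓ l 2 0
  have e3 : ∀ l, Γ l 2 1 = Γ l 1 2 := fun l => hΓ l 2 1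
  have c1 : ∀ l, C l 1 0 = C l 0 1 := fun l => hC l 1 0
  have c2 : ∀ l, C l 2 0 = C l 0 2 := fun l => hC l 2 0
  have c3 : ∀ l, C l 2 1 = C l 1 2 := fun l => hC l 2 1
  have h1 : hi 1 0 = hi 0 1 := hh _ _
  have h2 : hi 2 0 = hi 0 2 := hh _ _
  have h3 : hi 2 1 = hi 1 2 := hh _ _
  simp only [tr, app, ric, divg, Fin.sum_univ_three, map_add, map_sub, Derivation.leibniz,
    smul_eq_mul, e1, e2, e3, c1, c2, c3, h1, h2, h3, hD]
  ring

/-- The Bochner formula: `Ric(X, X) = div(∇_X X - (div X) X) + (div X)² - tr (∇X)²`. -/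
theorem bochner (Γ : Fin 3 → Fin 3 → Fin 3 → A) (hΓ : ∀ l i j, Γ l i j = Γ l j i)
    (hc : ∀ i j a, D i (D j a) = D j (D i a)) (X : Fin 3 → A) :
    bil (ric D Γ) X X
      = divg D Γ (fun l => app (fun l i => covV D Γ X i l) X l - divg D Γ X * X l)
        + divg D Γ X * divg D Γ X - ∑ i, ∑ l, covV D Γ X i l * covV D Γ X l i := by
  have e1 : ∀ l, Γ l 1 0 = Γ l 0 1 := fun l => hΓ l 1 0
  have e2 : ∀ l, Γ l 2 0 = Γ l 0 2 := fun l => hΓ l 2 0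
  have e3 : ∀ l, Γ l 2 1 = Γ l 1 2 := fun l => hΓ l 2 1
  have d1 := hc 1 0
  have d2 := hc 2 0
  have d3 := hc 2 1
  simp only [bil, app, ric, divg, covV, Fin.sum_univ_three, map_add, map_sub, Derivation.leibniz,
    smul_eq_mul, e1, e2, e3, d1, d2, d3]
  ring

theorem divg_smul (Γ : Fin 3 → Fin 3 → Fin 3 → A) (s : A) (X : Fin 3 → A) :
    divg D Γ (fun l => s * X l) = s * divg D Γ X + pair (fun i => D i s) X := by
  simp only [divg, pair, Fin.sum_univ_three, Derivation.leibniz, smul_eq_mul]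
  ring

theorem divg_add (Γ : Fin 3 → Fin 3 → Fin 3 → A) (X Z : Fin 3 → A) :
    divg D Γ (fun l => X l + Z l) = divg D Γ X + divg D Γ Z := by
  simp only [divg, Fin.sum_univ_three, map_add]
  ring

theorem divg_sub (Γ : Fin 3 → Fin 3 → Fin 3 → A) (X Z : Fin 3 → A) :
    divg D Γ (fun l => X l - Z l) = divg D Γ X - divg D Γ Z := by
  simp only [divg, Fin.sum_univ_three, map_sub]
  ring

/-- Adding a tensor `C` to the connection changes the divergence by the trace of `C`. -/
theorem divg_add_symbols (Γ C : Fin 3 → Fin 3 → Fin 3 → A) (X : Fin 3 → A) :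
    divg D (fun l i j => Γ l i j + C l i j) X
      = divg D Γ X + pair (fun i => ∑ l, C l l i) X := by
  simp only [divg, pair, Fin.sum_univ_three]
  ring

namespace LeviCivita

variable {g gi : Fin 3 → Fin 3 → A} {Γ : Fin 3 → Fin 3 → Fin 3 → A} (L : LeviCivita D g gi Γ)
include L

theorem inv' (i j : Fin 3) : ∑ l, g i l * gi l j = if i = j then 1 else 0 := by
  have := L.inv j i
  rw [show (if i = j then (1:A) else 0) = if j = i then 1 else 0 by simp [eq_comm], ← this]
  exact Finset.sum_congr rfl fun l _ => by rw [L.symm i l, L.inv_symm l j, mul_comm]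

theorem app_app (α : Fin 3 → A) (i : Fin 3) : app gi (app g α) i = α i := by
  have h := L.inv i
  have : app gi (app g α) i = ∑ j, (∑ l, gi i l * g l j) * α j := by
    simp only [app, Fin.sum_univ_three]; ring
  rw [this]; simp [h]

theorem app_app' (α : Fin 3 → A) (i : Fin 3) : app g (app gi α) i = α i := by
  have h := L.inv' i
  have : app g (app gi α) i = ∑ j, (∑ l, g i l * gi l j) * α j := by
    simp only [app, Fin.sum_univ_three]; ring
  rw [this]; simp [h]

/-- A covector equation may be checked after raising the index. -/
theorem ext_app {X Z : Fin 3 → A} (h : ∀ i, app g X i = app g Z i) (i : Fin 3) : X i = Z i := by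
  rw [← L.app_app X i, ← L.app_app Z i]
  simp only [app] at h ⊢
  simp only [h]

/-- The inverse metric is parallel. -/
theorem deriv_inv (l i j : Fin 3) :
    D l (gi i j) = -∑ m, (Γ i l m * gi m j + Γ j l m * gi i m) := by
  have key : ∀ k, ∑ p, (D l (gi i p) + ∑ m, (Γ i l m * gi m p + Γ p l m * gi i m)) * g p k
      = 0 := by
    intro k
    have h := congrArg (D l) (L.inv i k)
    have h0 : D l (if i = k then (1 : A) else 0) = 0 := by split_ifs <;> simp
    rw [h0] at h
    have h1 : ∑ m, Γ i l m * (∑ p, gi m p * g p k) = Γ i l k := by simp [L.inv]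
    have h2 : ∑ m, (∑ p, gi i p * g p m) * Γ m l k = Γ i l k := by simp [L.inv]
    simp only [Fin.sum_univ_three, map_add, Derivation.leibniz, smul_eq_mul, L.compat] at h h1 h2 ⊢
    linear_combination h + h1 - h2
  have h2 : ∑ k, (∑ p, (D l (gi i p) + ∑ m, (Γ i l m * gi m p + Γ p l m * gi i m)) * g p k)
      * gi k j = D l (gi i j) + ∑ m, (Γ i l m * gi m j + Γ j l m * gi i m) := by
    have : ∀ T : Fin 3 → A, ∑ k, (∑ p, T p * g p k) * gi k j
        = ∑ p, T p * ∑ k, g p k * gi k j := by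
      intro T; simp only [Fin.sum_univ_three]; ring
    rw [this]; simp [L.inv']
  simp only [key, zero_mul, Finset.sum_const_zero] at h2
  linear_combination -h2

/-- The trace of the Christoffel symbols is `½ gⁱʲ ∂ gᵢⱼ`. -/
theorem two_trace (i : Fin 3) : 2 * ∑ l, Γ l l i = tr gi (fun a b => D i (g a b)) := by
  have h : ∑ a, ∑ b, (∑ l, gi a l * g l b) * Γ b i a = ∑ l, Γ l i l := by simp [L.inv]
  have e : ∑ l, Γ l l i = ∑ l, Γ l i l := Finset.sum_congr rfl fun l _ => L.torsion _ _ _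
  have s1 := L.symm 1 0
  have s2 := L.symm 2 0
  have s3 := L.symm 2 1
  have t1 := L.inv_symm 1 0
  have t2 := L.inv_symm 2 0
  have t3 := L.inv_symm 2 1
  rw [e, ← h]
  simp only [tr, L.compat, Fin.sum_univ_three, s1, s2, s3, t1, t2, t3]
  ring

theorem ric_symm (hc : ∀ i j a, D i (D j a) = D j (D i a)) (i j : Fin 3) :
    ric D Γ i j = ric D Γ j i := by
  have s1 := L.symm 1 0
  have s2 := L.symm 2 0
  have s3 := L.symm 2 1
  have t1 := L.inv_symm 1 0
  have t2 := L.inv_symm 2 0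
  have t3 := L.inv_symm 2 1
  have hT : ∀ a b, D a (∑ l, Γ l l b) = D b (∑ l, Γ l l a) := by
    intro a b
    have hS : ∀ a b, ∑ p, ∑ q, D a (gi p q) * D b (g p q)
        = -2 * (∑ p, ∑ m, Γ p a m * Γ m b p
          + ∑ p, ∑ m, ∑ l, ∑ q, Γ p a m * Γ l b q * gi m q * g p l) := by
      intro a b
      have h1 : ∑ p, ∑ m, ∑ l, Γ p a m * Γ l b p * (∑ q, gi m q * g q l)
          = ∑ p, ∑ m, Γ p a m * Γ m b p := by simp [L.inv]
      simp only [Fin.sum_univ_three, L.compat, L.deriv_inv, s1, s2, s3, t1, t2, t3] at h1 ⊢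
      linear_combination -2 * h1
    have hS2 : ∀ a b, 2 * D a (∑ l, Γ l l b)
        = ∑ p, ∑ q, D a (gi p q) * D b (g p q) + ∑ p, ∑ q, gi p q * D a (D b (g p q)) := by
      intro a b
      have : ∀ x : A, 2 * D a x = D a (2 * x) := fun x => by simp [two_mul]
      rw [this, L.two_trace]
      simp only [tr, Fin.sum_univ_three, map_add, Derivation.leibniz, smul_eq_mul]
      ring
    have h2 : 2 * D a (∑ l, Γ l l b) = 2 * D b (∑ l, Γ l l a) := by
      rw [hS2, hS2, hS, hS]
      simp only [hc a b, Fin.sum_univ_three, s1, s2, s3, t1, t2, t3]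
      ring
    exact two_mul_cancel h2
  have e : ∀ a, ∑ l, Γ l a l = ∑ l, Γ l l a := fun a =>
    Finset.sum_congr rfl fun l _ => L.torsion _ _ _
  have hT' : ∀ a b, ∑ l, D a (Γ l b l) = D a (∑ l, Γ l l b) := fun a b => by
    rw [← map_sum, e]
  simp only [ric, Finset.sum_add_distrib, Finset.sum_sub_distrib, hT', hT j i]
  have t : ∀ l, Γ l j i = Γ l i j := fun l => L.torsion _ _ _
  simp only [t, Fin.sum_univ_three]
  ring

end LeviCivita
end DerivCalc

namespace DerivCalc

variable {A : Type*} [CommRing A] [Algebra ℝ A] {D : Fin 3 → Derivation ℝ A A}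

/-! ### Change of metric, and the graph metric `g + u² df²` -/

namespace LeviCivita

variable {g gi : Fin 3 → Fin 3 → A} {Γ : Fin 3 → Fin 3 → Fin 3 → A}

/-- The Levi-Civita connection of a second metric `h` is `Γ + C` as soon as the symmetric tensor
`C` accounts for the covariant derivative of `h`. -/
theorem add (L : LeviCivita D g gi Γ) {h hi : Fin 3 → Fin 3 → A}
    {C : Fin 3 → Fin 3 → Fin 3 → A} (symm : ∀ i j, h i j = h j i)
    (inv_symm : ∀ i j, hi i j = hi j i)
    (inv : ∀ i j, ∑ l, hi i l * h l j = if i = j then 1 else 0)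
    (hC : ∀ l i j, C l i j = C l j i)
    (hh : ∀ i j k, cov2 D Γ h i j k = ∑ l, (C l i j * h l k + C l i k * h j l)) :
    LeviCivita D h hi (fun l i j => Γ l i j + C l i j) where
  symm := symm
  inv_symm := inv_symm
  inv := inv
  torsion l i j := by rw [L.torsion l i j, hC]
  compat i j k := by
    have := hh i j k
    simp only [cov2, Fin.sum_univ_three] at this ⊢
    linear_combination this

theorem unique (L : LeviCivita D g gi Γ) {Γ' : Fin 3 → Fin 3 → Fin 3 → A}
    (L' : LeviCivita D g gi Γ') (l i j : Fin 3) : Γ l i j = Γ' l i j := by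
  set T : Fin 3 → Fin 3 → Fin 3 → A := fun k i j => ∑ l, g k l * (Γ l i j - Γ' l i j) with hT
  have t : ∀ k i j, T k i j = T k j i := fun k i j => by
    simp only [hT, L.torsion _ i j, L'.torsion _ i j]
  have a : ∀ i j k, T k i j + T j i k = 0 := fun i j k => by
    have h1 := L.compat i j k
    have h2 := L'.compat i j k
    simp only [hT, Fin.sum_univ_three, L.symm _ k] at h1 h2 ⊢
    linear_combination h2 - h1
  have z : ∀ k i j, T k i j = 0 := fun k i j => by
    apply two_mul_cancel
    linear_combination a i j k + a j i k - a k i j + t k i j - t j i k - t i j k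
  have := L.ext_app (X := fun l => Γ l i j - Γ' l i j) (Z := 0)
    (fun k => by simpa [app, hT] using z k i j) l
  simpa [sub_eq_zero] using this

/-- Raising the index identifies the divergence of a 1-form with that of a vector field. -/
theorem div1_eq (L : LeviCivita D g gi Γ) (α : Fin 3 → A) :
    div1 D gi Γ α = divg D Γ (app gi α) := by
  have t1 := L.inv_symm 1 0
  have t2 := L.inv_symm 2 0
  have t3 := L.inv_symm 2 1
  have e1 := fun l => L.torsion l 1 0
  have e2 := fun l => L.torsion l 2 0
  have e3 := fun l => L.torsion l 2 1
  simp only [div1, divg, app, cov1, Fin.sum_univ_three, map_add, Derivation.leibniz, smul_eq_mul,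
    L.deriv_inv, t1, t2, t3, e1, e2, e3]
  ring

/-- Lowering an index commutes with covariant differentiation. -/
theorem cov1_app (L : LeviCivita D g gi Γ) (X : Fin 3 → A) (i j : Fin 3) :
    cov1 D Γ (app g X) i j = app g (covV D Γ X i) j := by
  have t1 := L.symm 1 0
  have t2 := L.symm 2 0
  have t3 := L.symm 2 1
  simp only [cov1, app, covV, Fin.sum_univ_three, map_add, Derivation.leibniz, smul_eq_mul,
    L.compat]
  fin_cases j <;> simp only [Fin.zero_eta, Fin.mk_one, Fin.reduceFinMk, t1, t2, t3] <;> ring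

/-- Raising an index commutes with covariant differentiation. -/
theorem covV_app (L : LeviCivita D g gi Γ) (α : Fin 3 → A) (i l : Fin 3) :
    covV D Γ (app gi α) i l = app gi (cov1 D Γ α i) l := by
  refine L.ext_app (fun j => ?_) l
  rw [← L.cov1_app, L.app_app', show app g (app gi α) = α from funext (L.app_app' α)]

end LeviCivita

theorem hess_symm {Γ : Fin 3 → Fin 3 → Fin 3 → A} (hΓ : ∀ l i j, Γ l i j = Γ l j i)
    (hc : ∀ i j a, D i (D j a) = D j (D i a)) (f : A) (i j : Fin 3) :
    hess D Γ f i j = hess D Γ f j i := by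
  simp only [hess, cov1, hc i j, hΓ _ i j]

omit [Algebra ℝ A] in
/-- The quadratic term of `scal_add` for the difference tensor of the static case. -/
theorem static_quadratic (hi p : Fin 3 → Fin 3 → A) (hh : ∀ i j, hi i j = hi j i)
    (hp : ∀ i j, p i j = p j i) (v U f : Fin 3 → A) :
    tr hi (fun i j => ∑ l, ∑ m, (p i m * v l - U l * f i * f m) * (p j l * v m - U m * f j * f l)
      - (∑ m, (p m i * v m - U m * f m * f i)) * (∑ m, (p m j * v m - U m * f m * f j)))
      = 2 * (pair f U * bil p v (app hi f) - pair f v * bil p U (app hi f)) := by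
  have t1 := hh 1 0
  have t2 := hh 2 0
  have t3 := hh 2 1
  have e1 := hp 1 0
  have e2 := hp 2 0
  have e3 := hp 2 1
  simp only [tr, pair, bil, app, Fin.sum_univ_three, t1, t2, t3, e1, e2, e3]
  ring

variable (D) in
/-- A function `f` and a lapse `u` with inverse `ui`, on a space with metric `g`; the function `r`,
with inverse `ρ`, is `√(1 + u² |∇f|²)`. -/
structure Static (g gi : Fin 3 → Fin 3 → A) (Γ : Fin 3 → Fin 3 → Fin 3 → A)
    (f u ui r ρ : A) : Prop where
  lc : LeviCivita D g gi Γ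
  comm : ∀ i j a, D i (D j a) = D j (D i a)
  u_inv : u * ui = 1
  r_inv : r * ρ = 1
  r_sq : r * r = 1 + u * u * pair (fun i => D i f) (app gi fun i => D i f)

variable (D) in
/-- The second fundamental form `(u ∇ᵢⱼf + uᵢ fⱼ + uⱼ fᵢ) / r` of the graph of `f` in the static
case. -/
def sff0 (Γ : Fin 3 → Fin 3 → Fin 3 → A) (f u ρ : A) (i j : Fin 3) : A :=
  ρ * (u * hess D Γ f i j + D i u * D j f + D j u * D i f)

variable (D) in
/-- The difference of the Levi-Civita connections of `g + u² df²` and `g`. -/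
def staticC (gi : Fin 3 → Fin 3 → A) (Γ : Fin 3 → Fin 3 → Fin 3 → A) (f u ρ : A)
    (l i j : Fin 3) : A :=
  sff0 D Γ f u ρ i j * (u * ρ * app gi (fun a => D a f) l)
    - (u * app gi (fun a => D a u) l
      - u * u * u * ρ * ρ * pair (fun a => D a u) (app gi fun a => D a f)
        * app gi (fun a => D a f) l) * D i f * D j f

namespace Static

variable {g gi : Fin 3 → Fin 3 → A} {Γ : Fin 3 → Fin 3 → Fin 3 → A} {f u ui r ρ : A}
  (S : Static D g gi Γ f u ui r ρ)
include S

theorem sff0_symm (i j : Fin 3) : sff0 D Γ f u ρ i j = sff0 D Γ f u ρ j i := by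
  rw [sff0, sff0, hess_symm S.lc.torsion S.comm]; ring

theorem rho_sq : ρ * ρ + u * u * ρ * ρ * pair (fun i => D i f) (app gi fun i => D i f) = 1 := by
  linear_combination -ρ * ρ * S.r_sq + (r * ρ + 1) * S.r_inv

/-- The Levi-Civita connection of `g + u² df²`. -/
theorem leviCivita_graph : LeviCivita D (fun i j => g i j + u * u * D i f * D j f)
    (fun i j => gi i j - u * ρ * app gi (fun a => D a f) i * (u * ρ * app gi (fun a => D a f) j))
    (fun l i j => Γ l i j + staticC D gi Γ f u ρ l i j) := by
  set F := app gi fun a => D a f with hF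
  set G := app gi fun a => D a u with hG
  set n := pair (fun i => D i f) F with hn
  set s := pair (fun i => D i u) F with hs
  have hgF : ∀ i, app g F i = D i f := S.lc.app_app' _
  have hgG : ∀ i, app g G i = D i u := S.lc.app_app' _
  have hR := S.rho_sq
  rw [← hF, ← hn] at hR
  refine S.lc.add (fun i j => ?_) (fun i j => ?_) (fun i j => ?_) (fun l i j => ?_)
    (fun i j k => ?_)
  · rw [S.lc.symm i j]; ring
  · rw [S.lc.inv_symm i j]; ring
  · rw [← S.lc.inv i j]
    have h1 : ∑ l, gi i l * (u * u * D l f * D j f) = u * u * F i * D j f := by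
      simp only [hF, app, Fin.sum_univ_three]; ring
    have h2 := hgF j
    have h3 := hn
    simp only [app, pair, Fin.sum_univ_three, S.lc.symm j] at h1 h2 h3 ⊢
    linear_combination h1 - u * ρ * F i * u * ρ * h2
      + (u * u * u * u * F i * ρ * ρ * D j f) * h3 - u * u * F i * D j f * hR
  · simp only [staticC, S.sff0_symm i j]; ring
  · have h2 := hgF
    have h3 := hgG
    have hC : ∀ i j k, ∑ l, staticC D gi Γ f u ρ l i j * (g l k + u * u * D l f * D k f)
        = u * (u * hess D Γ f i j + D i u * D j f + D j u * D i f) * D k f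
          - u * D k u * D i f * D j f := by
      intro i j k
      have hns : pair (fun i => D i f) G = s := by
        have t1 := S.lc.inv_symm 1 0
        have t2 := S.lc.inv_symm 2 0
        have t3 := S.lc.inv_symm 2 1
        simp only [hs, hF, hG, pair, app, Fin.sum_univ_three, t1, t2, t3]; ring
      have h2 := hgF k
      have h3 := hgG k
      have e : ∀ l, staticC D gi Γ f u ρ l i j = sff0 D Γ f u ρ i j * (u * ρ * F l)
        - (u * G l - u * u * u * ρ * ρ * s * F l) * D i f * D j f := fun l => rfl
      have e2 : ∑ l, staticC D gi Γ f u ρ l i j * (g l k + u * u * D l f * D k f)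
        = sff0 D Γ f u ρ i j * (u * ρ * (app g F k + u * u * n * D k f))
        - (u * (app g G k + u * u * pair (fun i => D i f) G * D k f)
          - u * u * u * ρ * ρ * s * (app g F k + u * u * n * D k f)) * D i f * D j f := by
        simp only [e, hn, app, pair, Fin.sum_univ_three, S.lc.symm k]; ring
      rw [e2, h2, h3, hns, sff0]
      linear_combination (u * D k f * (u * hess D Γ f i j + D i u * D j f + D j u * D i f)
        + u * u * u * s * D k f * D i f * D j f) * hR
    have e3 := hC i j k
    have e4 := hC i k j
    have e5 : ∑ l, (staticC D gi Γ f u ρ l i j * (g l k + u * u * D l f * D k f)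
        + staticC D gi Γ f u ρ l i k * (g j l + u * u * D j f * D l f))
        = ∑ l, staticC D gi Γ f u ρ l i j * (g l k + u * u * D l f * D k f)
        + ∑ l, staticC D gi Γ f u ρ l i k * (g l j + u * u * D l f * D j f) := by
      rw [← Finset.sum_add_distrib]
      refine Finset.sum_congr rfl fun l _ => ?_
      rw [S.lc.symm j l]; ring
    have c1 := S.lc.compat i j k
    rw [e5, e3, e4]
    simp only [cov2, hess, cov1, Fin.sum_univ_three, map_add, Derivation.leibniz, smul_eq_mul]
      at c1 ⊢
    linear_combination c1

end Static

/-! ### The scalar curvature of the graph metric -/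

theorem LeviCivita.pair_app_comm {g gi : Fin 3 → Fin 3 → A} {Γ : Fin 3 → Fin 3 → Fin 3 → A}
    (L : LeviCivita D g gi Γ) (α β : Fin 3 → A) :
    pair α (app gi β) = pair β (app gi α) := by
  have t1 := L.inv_symm 1 0
  have t2 := L.inv_symm 2 0
  have t3 := L.inv_symm 2 1
  simp only [pair, app, Fin.sum_univ_three, t1, t2, t3]; ring

/-- The derivative of `α(X)`, through covariant derivatives. -/
theorem deriv_pair (Γ : Fin 3 → Fin 3 → Fin 3 → A) (α X : Fin 3 → A) (i : Fin 3) :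
    D i (pair α X) = pair (cov1 D Γ α i) X + pair α (covV D Γ X i) := by
  simp only [pair, cov1, covV, Fin.sum_univ_three, map_add, Derivation.leibniz, smul_eq_mul]
  ring

namespace Static

variable {g gi : Fin 3 → Fin 3 → A} {Γ : Fin 3 → Fin 3 → Fin 3 → A} {f u ui r ρ : A}
  (S : Static D g gi Γ f u ui r ρ)
include S

theorem staticC_trace_eq (i : Fin 3) : ∑ l, staticC D gi Γ f u ρ l l i
    = u * ρ * app (sff0 D Γ f u ρ) (app gi fun a => D a f) i
      - u * ρ * ρ * pair (fun a => D a u) (app gi fun a => D a f) * D i f := by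
  have hR := S.rho_sq
  have hns := S.lc.pair_app_comm (fun a => D a f) (fun a => D a u)
  set F := app gi fun a => D a f with hF
  set G := app gi fun a => D a u with hG
  set n := pair (fun i => D i f) F with hn
  set s := pair (fun i => D i u) F with hs
  have : ∑ l, staticC D gi Γ f u ρ l l i = u * ρ * app (sff0 D Γ f u ρ) F i
      - (u * pair (fun i => D i f) G - u * u * u * ρ * ρ * s * n) * D i f := by
    have t := S.sff0_symm
    have e : ∀ l, staticC D gi Γ f u ρ l l i = sff0 D Γ f u ρ i l * (u * ρ * F l)
        - (u * G l - u * u * u * ρ * ρ * s * F l) * D l f * D i f := fun l => by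
      rw [t i l]; rfl
    simp only [e, app, hn, pair, Fin.sum_univ_three]; ring
  rw [this, hns]
  linear_combination (u * s * D i f) * hR

/-- The logarithmic derivative of `r` is the trace of the difference tensor: `r` is the density of
the volume of `g + u² df²` with respect to that of `g`. -/
theorem deriv_r (i : Fin 3) : D i r = r * ∑ l, staticC D gi Γ f u ρ l l i := by
  have hR := S.rho_sq
  have h1 := congrArg (D i) S.r_sq
  rw [S.staticC_trace_eq i]
  have hH : app (sff0 D Γ f u ρ) (app gi fun a => D a f) i
      = ρ * (u * pair (hess D Γ f i) (app gi fun a => D a f)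
        + D i u * pair (fun i => D i f) (app gi fun a => D a f)
        + D i f * pair (fun i => D i u) (app gi fun a => D a f)) := by
    simp only [app, sff0, pair, Fin.sum_univ_three]; ring
  rw [hH]
  have hn : D i (pair (fun i => D i f) (app gi fun a => D a f))
      = 2 * pair (hess D Γ f i) (app gi fun a => D a f) := by
    rw [deriv_pair Γ, show covV D Γ (app gi fun a => D a f) i
      = app gi (cov1 D Γ (fun a => D a f) i) from funext (S.lc.covV_app _ i),
      S.lc.pair_app_comm (fun i => D i f)]
    simp only [two_mul]
    rfl
  simp only [map_add, Derivation.leibniz, smul_eq_mul, hn, Derivation.map_one_eq_zero] at h1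
  apply two_mul_cancel
  set P := pair (hess D Γ f i) (app gi fun a => D a f)
  set n := pair (fun i => D i f) (app gi fun a => D a f)
  linear_combination ρ * h1 +
    (-2 * D i r - 2 * ρ * (u * u * P + u * D i u * n)) * S.r_inv

theorem deriv_rho (i : Fin 3) : D i ρ = -ρ * ∑ l, staticC D gi Γ f u ρ l l i := by
  have h := congrArg (D i) S.r_inv
  simp only [Derivation.leibniz, smul_eq_mul, Derivation.map_one_eq_zero, S.deriv_r] at h
  linear_combination ρ * h - (D i ρ + ρ * ∑ l, staticC D gi Γ f u ρ l l i) * S.r_inv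

/-- The covariant derivative of `v = (u / r) ∇f` is the second fundamental form, up to an
antisymmetric term and the logarithmic derivative of the lapse `u r`. -/
theorem covV_v (i l : Fin 3) : covV D Γ (fun l => u * ρ * app gi (fun a => D a f) l) i l
    = app gi (sff0 D Γ f u ρ i) l
      + ρ * (D i u * app gi (fun a => D a f) l - D i f * app gi (fun a => D a u) l)
      - (ui * D i u + ∑ l, staticC D gi Γ f u ρ l l i) * (u * ρ * app gi (fun a => D a f) l) := by
  have h : covV D Γ (fun l => u * ρ * app gi (fun a => D a f) l) i l
     = (ρ * D i u + u * D i ρ) * app gi (fun a => D a f) l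
       + u * ρ * covV D Γ (app gi fun a => D a f) i l := by
    simp only [covV, Fin.sum_univ_three, Derivation.leibniz, smul_eq_mul]; ring
  have h2 : app gi (sff0 D Γ f u ρ i) l = ρ * (u * app gi (cov1 D Γ (fun a => D a f) i) l
      + D i u * app gi (fun a => D a f) l + D i f * app gi (fun a => D a u) l) := by
    simp only [sff0, hess, app, Fin.sum_univ_three]; ring
  rw [h, S.lc.covV_app, h2, S.deriv_rho]
  linear_combination ρ * D i u * app gi (fun a => D a f) l * S.u_inv

omit S [Algebra ℝ A] in
/-- Trace of the square of the endomorphism `p + ρ (du ⊗ F - df ⊗ G) - b ⊗ v`, for symmetric `p`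
and with `F` and `G` dual to `df` and `du`. -/
theorem trace_sq (hi : ∀ i j, gi i j = gi j i) (p : Fin 3 → Fin 3 → A)
    (hp : ∀ i j, p i j = p j i) (c d b v : Fin 3 → A) (ρ : A) :
    ∑ i, ∑ l, (app gi (p i) l + ρ * (d i * app gi c l - c i * app gi d l) - b i * v l)
      * (app gi (p l) i + ρ * (d l * app gi c i - c l * app gi d i) - b l * v i)
    = normSq gi p + 2 * ρ * ρ * (pair d (app gi c) * pair d (app gi c)
        - pair c (app gi c) * pair d (app gi d)) + pair b v * pair b v
      - 2 * bil p (app gi b) v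
      - 2 * ρ * (pair b (app gi c) * pair d v - pair b (app gi d) * pair c v) := by
  have t1 := hi 1 0
  have t2 := hi 2 0
  have t3 := hi 2 1
  have e1 := hp 1 0
  have e2 := hp 2 0
  have e3 := hp 2 1
  simp only [normSq, pair, bil, app, Fin.sum_univ_three, t1, t2, t3, e1, e2, e3]
  ring

omit S in
theorem divg_eq_covV (Γ : Fin 3 → Fin 3 → Fin 3 → A) (hΓ : ∀ l i j, Γ l i j = Γ l j i)
    (X : Fin 3 → A) : divg D Γ X = ∑ l, covV D Γ X l l := by
  have e1 := fun l => hΓ l 1 0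
  have e2 := fun l => hΓ l 2 0
  have e3 := fun l => hΓ l 2 1
  simp only [divg, covV, Fin.sum_univ_three, e1, e2, e3]
  ring

/-- The scalar curvature of `g + u² df²`. In `scal_add`, the contraction of `Ric` with the
inverse metric `g⁻¹ - v ⊗ v`, `v = (u / r) ∇f`, contains `Ric(v, v)`, which the Bochner formula and
`covV_v` express through `π₀`. -/
theorem scal_graph :
    tr (fun i j => gi i j - u * ρ * app gi (fun a => D a f) i * (u * ρ * app gi (fun a => D a f) j))
      (ric D (fun l i j => Γ l i j + staticC D gi Γ f u ρ l i j))
    = tr gi (ric D Γ) + normSq gi (sff0 D Γ f u ρ)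
      + tr gi (sff0 D Γ f u ρ) * tr gi (sff0 D Γ f u ρ)
      + 2 * pair (fun i => D i (tr gi (sff0 D Γ f u ρ)))
          (fun l => u * ρ * app gi (fun a => D a f) l)
      - 2 * ui * ρ * divg D Γ (fun l => u * r * app gi (app (sff0 D Γ f u ρ)
          (fun l => u * ρ * app gi (fun a => D a f) l)) l) := by
  have hR := S.rho_sq
  have hnd := S.lc.pair_app_comm (fun a => D a f) (fun a => D a u)
  have h1 := scal_add Γ (staticC D gi Γ f u ρ) _ S.lc.torsion
    (fun l i j => by simp only [staticC, S.sff0_symm i j]; ring) S.leviCivita_graph.inv_symm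
    S.leviCivita_graph.deriv_inv
  have h3 := bochner Γ S.lc.torsion S.comm (fun l => u * ρ * app gi (fun a => D a f) l)
  have hq := static_quadratic (fun i j => gi i j - u * ρ * app gi (fun a => D a f) i
      * (u * ρ * app gi (fun a => D a f) j)) (sff0 D Γ f u ρ)
    S.leviCivita_graph.inv_symm S.sff0_symm (fun l => u * ρ * app gi (fun a => D a f) l)
    (fun l => u * app gi (fun a => D a u) l
      - u * u * u * ρ * ρ * pair (fun a => D a u) (app gi fun a => D a f)
        * app gi (fun a => D a f) l) (fun a => D a f)
  have ht := trace_sq S.lc.inv_symm (sff0 D Γ f u ρ) S.sff0_symm (fun a => D a f) (fun a => D a u)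
    (fun i => ui * D i u + ∑ l, staticC D gi Γ f u ρ l l i)
    (fun l => u * ρ * app gi (fun a => D a f) l) ρ
  have hC : ∀ l i j, staticC D gi Γ f u ρ l i j
    = sff0 D Γ f u ρ i j * (u * ρ * app gi (fun a => D a f) l)
    - (u * app gi (fun a => D a u) l
      - u * u * u * ρ * ρ * pair (fun a => D a u) (app gi fun a => D a f)
        * app gi (fun a => D a f) l) * D i f * D j f := fun l i j => rfl
  have hcov := S.covV_v
  have htr := S.staticC_trace_eq
  have hr := S.deriv_r
  have hpi := S.sff0_symm
  set p := sff0 D Γ f u ρ with hp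
  set C := staticC D gi Γ f u ρ with hCdef
  set F := app gi fun a => D a f with hF
  set G := app gi fun a => D a u with hG
  set n := pair (fun i => D i f) F with hn
  set s := pair (fun i => D i u) F with hs
  set q := pair (fun i => D i u) G with hqd
  set v := fun l => u * ρ * F l with hv
  set U := fun l => u * G l - u * u * u * ρ * ρ * s * F l with hU
  set b : Fin 3 → A := fun i => ui * D i u + ∑ l, C l l i with hb
  set t := tr gi p with ht0
  have hF' : ∀ i, F i = app gi (fun a => D a f) i := fun i => rfl
  have hG' : ∀ i, G i = app gi (fun a => D a u) i := fun i => rfl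
  have hv' : ∀ i, v i = u * ρ * F i := fun i => rfl
  have hb' : ∀ i, b i = ui * D i u + (u * ρ * app p F i - u * ρ * ρ * s * D i f) := fun i => by
    rw [← htr i]
  clear_value b U v q s n G F C p
  -- contractions of the covector `b` with the gradients
  have hbF : pair b F = ui * s + (u * ρ * bil p F F - u * ρ * ρ * s * n) := by
    simp only [hn, hs, pair, bil, app, hb', Fin.sum_univ_three]; ring
  have hbG : pair b G = ui * q + (u * ρ * bil p F G - u * ρ * ρ * s * s) := by
    have h : pair b G = ui * q + (u * ρ * bil p F G
        - u * ρ * ρ * s * pair (fun a => D a f) G) := by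
      simp only [hqd, pair, bil, app, hb', Fin.sum_univ_three, hpi _ 0, hpi 2 1]; ring
    rw [h, hnd]
  have hbv : pair b v = u * ρ * pair b F := by
    simp only [pair, hv', Fin.sum_univ_three]; ring
  have hfv : pair (fun a => D a f) v = u * ρ * n := by
    simp only [hn, pair, hv', Fin.sum_univ_three]; ring
  have huv : pair (fun a => D a u) v = u * ρ * s := by
    simp only [hs, pair, hv', Fin.sum_univ_three]; ring
  have hU' : ∀ l, U l = u * G l - u * u * u * ρ * ρ * s * F l := fun l => by rw [hU]
  have hfU : pair (fun a => D a f) U = u * ρ * ρ * s := by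
    have h : pair (fun a => D a f) U = u * pair (fun a => D a f) G
        - u * u * u * ρ * ρ * s * n := by
      simp only [hn, pair, hU', Fin.sum_univ_three]; ring
    rw [h, hnd]; linear_combination -u * s * hR
  have happ : ∀ (α : Fin 3 → A) (l : Fin 3),
      app (fun i j => gi i j - u * ρ * F i * (u * ρ * F j)) α l
      = app gi α l - v l * pair α v := fun α l => by
    simp only [app, pair, hv', Fin.sum_univ_three]; ring
  have hfb : app (fun i j => gi i j - u * ρ * F i * (u * ρ * F j)) (fun a => D a f)
      = fun l => ρ * ρ * F l := funext fun l => by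
    rw [happ, hfv, ← hF', hv']; linear_combination -F l * hR
  have htrh : ∀ h : Fin 3 → Fin 3 → A, tr (fun i j => gi i j - u * ρ * F i * (u * ρ * F j)) h
      = tr gi h - bil h v v := fun h => by
    simp only [tr, bil, hv', Fin.sum_univ_three]; ring
  -- the vector fields whose divergences enter through `scal_add` and `bochner`
  have hW : (fun l => tr (fun i j => gi i j - u * ρ * F i * (u * ρ * F j)) (C l)
      - app (fun i j => gi i j - u * ρ * F i * (u * ρ * F j)) (fun j => ∑ m, C m m j) l)
      = fun l => (t * v l - app gi (app p v) l) + u * ρ * ρ * (s * F l - n * G l) := by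
    funext l
    have h1 : tr gi (C l) = t * v l - U l * n := by
      have e : n = ∑ i, ∑ j, gi i j * (D i f * D j f) := by
        simp only [hn, pair, hF', app, Fin.sum_univ_three]; ring
      rw [e, ht0]
      simp only [tr, hC, hv', hU', Fin.sum_univ_three]; ring
    have h2 : bil (C l) v v = bil p v v * v l - U l * pair (fun a => D a f) v
        * pair (fun a => D a f) v := by
      simp only [bil, hC, ← hv', ← hU', pair, Fin.sum_univ_three]; ring
    have h3 : (fun j => ∑ m, C m m j) = fun j => app p v j - u * ρ * ρ * s * D j f := by
      funext j; rw [htr]; simp only [app, hv', Fin.sum_univ_three]; ring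
    have h4 : app gi (fun j => app p v j - u * ρ * ρ * s * D j f) l
        = app gi (app p v) l - u * ρ * ρ * s * F l := by
      rw [hF']; simp only [app, Fin.sum_univ_three]; ring
    have h5 : pair (fun j => app p v j - u * ρ * ρ * s * D j f) v
        = bil p v v - u * ρ * ρ * s * pair (fun a => D a f) v := by
      simp only [app, pair, bil, Fin.sum_univ_three]; ring
    rw [htrh, h1, h2, h3, happ, h4, h5, hfv, hU', hv']
    linear_combination (u * n * G l - u * u * u * ρ * ρ * n * s * F l) * hR
  have hdv : divg D Γ v = t - pair b v := by
    have h : ∑ l, covV D Γ v l l = t + ρ * (s - pair (fun a => D a f) G) - pair b v := by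
      simp only [hcov, ht0, hs, ← hv']
      simp only [hb, tr, app, pair, Fin.sum_univ_three]; ring
    rw [divg_eq_covV Γ S.lc.torsion, h, hnd]; ring
  have hZ : (fun l => app (fun l i => covV D Γ v i l) v l - divg D Γ v * v l)
      = fun l => u * ρ * ρ * (s * F l - n * G l) - (t * v l - app gi (app p v) l) := by
    funext l
    have h : app (fun l i => covV D Γ v i l) v l = app gi (app p v) l
        + ρ * (pair (fun a => D a u) v * F l - pair (fun a => D a f) v * G l)
        - pair b v * v l := by
      simp only [app, hcov, ← hv']
      simp only [hb, pair, Fin.sum_univ_three, hpi _ 0, hpi 2 1]; ring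
    rw [h, hdv, huv, hfv]; ring
  have hur : pair (fun i => D i (u * r)) (app gi (app p v)) = u * r * bil p (app gi b) v := by
    have h : ∀ i, D i (u * r) = u * r * b i := fun i => by
      simp only [Derivation.leibniz, smul_eq_mul, hr, hb]
      linear_combination -r * D i u * S.u_inv
    simp only [h, pair, bil, app, Fin.sum_univ_three, S.lc.inv_symm _ 0, S.lc.inv_symm 2 1]
    ring
  have hq' : tr (fun i j => gi i j - u * ρ * F i * (u * ρ * F j)) (fun i j =>
      ∑ l, ∑ m, C l i m * C m j l - (∑ m, C m m i) * ∑ m, C m m j)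
      = 2 * u * u * ρ * ρ * ρ * (s * bil p F F - n * bil p F G) := by
    have e1 : bil p v (fun l => ρ * ρ * F l) = u * ρ * ρ * ρ * bil p F F := by
      simp only [bil, hv', Fin.sum_univ_three]; ring
    have e2 : bil p U (fun l => ρ * ρ * F l)
        = ρ * ρ * (u * bil p F G - u * u * u * ρ * ρ * s * bil p F F) := by
      simp only [bil, hU', Fin.sum_univ_three, hpi _ 0, hpi 2 1]; ring
    rw [hfb, e1, e2, hfU, hfv] at hq
    simp only [hC]
    rw [hq]
    linear_combination 2 * u * u * ρ * ρ * ρ * s * bil p F F * hR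
  simp only [← hcov] at ht
  have h3' : bil (ric D Γ) v v = divg D Γ (fun l => app (fun l i => covV D Γ v i l) v l
      - divg D Γ v * v l) + divg D Γ v * divg D Γ v
      - ∑ i, ∑ l, covV D Γ v i l * covV D Γ v l i := by
    simp only [hv'] at h3 ⊢; exact h3
  rw [hZ, ht, hdv, divg_sub, divg_sub, divg_smul Γ t v, hdv, hbF, hbG, huv, hfv] at h3'
  rw [h1, hW, hq', htrh (ric D Γ), h3', divg_add, divg_sub, divg_smul Γ t v,
    divg_smul Γ (u * r), hur,
    hdv]
  linear_combination (-2 * ρ * ρ * (s * s - n * q)) * S.u_inv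
    + 2 * (divg D Γ (app gi (app p v)) + bil p (app gi b) v)
      * (u * ui * S.r_inv + S.u_inv)

end Static

/-! ### Killing fields and the shear of a metric -/

variable (D) in
/-- The Lie derivative of `g` along `η` vanishes. Here `g` may be any covariant 2-tensor. -/
def Killing (g : Fin 3 → Fin 3 → A) (η : Fin 3 → A) : Prop :=
  ∀ i j, ∑ l, (η l * D l (g i j) + g l j * D i (η l) + g i l * D j (η l)) = 0

/-- The divergence of `∇_X Z`. -/
theorem divg_cov (Γ : Fin 3 → Fin 3 → Fin 3 → A) (hΓ : ∀ l i j, Γ l i j = Γ l j i)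
    (hc : ∀ i j a, D i (D j a) = D j (D i a)) (X Z : Fin 3 → A) :
    divg D Γ (fun l => app (fun l i => covV D Γ Z i l) X l)
      = ∑ i, ∑ l, covV D Γ X i l * covV D Γ Z l i + pair (fun i => D i (divg D Γ Z)) X
        + bil (ric D Γ) Z X := by
  have e1 : ∀ l, Γ l 1 0 = Γ l 0 1 := fun l => hΓ l 1 0
  have e2 : ∀ l, Γ l 2 0 = Γ l 0 2 := fun l => hΓ l 2 0
  have e3 : ∀ l, Γ l 2 1 = Γ l 1 2 := fun l => hΓ l 2 1
  have d1 := hc 1 0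
  have d2 := hc 2 0
  have d3 := hc 2 1
  simp only [bil, app, pair, ric, divg, covV, Fin.sum_univ_three, map_add,
    Derivation.leibniz, smul_eq_mul, e1, e2, e3, d1, d2, d3]
  ring

omit [Algebra ℝ A] in
theorem tr_conj (gi P Q : Fin 3 → Fin 3 → A)
    (hPQ : ∀ i j, ∑ l, P i l * Q l j = if i = j then 1 else 0) (T : Fin 3 → Fin 3 → A) :
    tr (fun i j => ∑ a, ∑ c, Q i a * Q j c * gi a c) (fun i j => ∑ q, ∑ t, T q t * P q i * P t j)
      = tr gi T := by
  have e3 : ∑ i, ∑ j, (∑ a, ∑ c, Q i a * Q j c * gi a c) * ∑ q, ∑ t, T q t * P q i * P t j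
      = ∑ q, ∑ t, T q t * ∑ a, (∑ i, P q i * Q i a) * ∑ c, (∑ j, P t j * Q j c) * gi a c := by
    simp only [Fin.sum_univ_three]; ring
  simp only [tr]
  rw [e3]
  simp only [hPQ, ite_mul, one_mul, zero_mul, Finset.sum_ite_eq, Finset.mem_univ, if_true]
  exact Finset.sum_congr rfl fun i _ => Finset.sum_congr rfl fun j _ => mul_comm _ _

omit [Algebra ℝ A] in
/-- The quadratic term of `scal_add` is invariant under a change of frame. -/
theorem quadratic_conj (gi P Q : Fin 3 → Fin 3 → A)
    (hPQ : ∀ i j, ∑ l, P i l * Q l j = if i = j then 1 else 0)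
    (B : Fin 3 → Fin 3 → Fin 3 → A) :
    tr (fun i j => ∑ a, ∑ c, Q i a * Q j c * gi a c) (fun i j => ∑ l, ∑ m,
        (∑ p, Q l p * ∑ q, ∑ s, B p q s * P q i * P s m)
          * (∑ p, Q m p * ∑ q, ∑ s, B p q s * P q j * P s l))
      = tr gi (fun i j => ∑ l, ∑ m, B l i m * B m j l) := by
  set T : Fin 3 → Fin 3 → A := fun q t => ∑ l, ∑ m, B l q m * B m t l with hT
  have h1 : ∀ i j, (∑ l, ∑ m, (∑ p, Q l p * ∑ q, ∑ s, B p q s * P q i * P s m)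
      * (∑ p, Q m p * ∑ q, ∑ s, B p q s * P q j * P s l))
      = ∑ q, ∑ t, T q t * P q i * P t j := by
    intro i j
    have key : ∀ M N : Matrix (Fin 3) (Fin 3) A,
        (Matrix.of Q * M * Matrix.of P * (Matrix.of Q * N * Matrix.of P)).trace
          = (M * N).trace := by
      intro M N
      have hm : Matrix.of P * Matrix.of Q = 1 := by
        ext a c; simpa [Matrix.mul_apply, Matrix.one_apply] using hPQ a c
      have e : Matrix.of Q * M * Matrix.of P * (Matrix.of Q * N * Matrix.of P)
          = Matrix.of Q * (M * N * Matrix.of P) := by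
        calc _ = Matrix.of Q * M * (Matrix.of P * Matrix.of Q) * N * Matrix.of P := by
              simp only [Matrix.mul_assoc]
          _ = _ := by rw [hm]; simp only [Matrix.mul_assoc, Matrix.mul_one]
      rw [e, Matrix.trace_mul_comm, Matrix.mul_assoc, hm, Matrix.mul_one]
    have := key (Matrix.of fun p s => ∑ q, B p q s * P q i)
      (Matrix.of fun p s => ∑ q, B p q s * P q j)
    simp only [Matrix.trace, Matrix.diag, Matrix.mul_apply, Matrix.of_apply] at this
    have e2 : ∀ i l m, (∑ p, Q l p * ∑ q, ∑ s, B p q s * P q i * P s m)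
        = ∑ s, (∑ p, Q l p * ∑ q, B p q s * P q i) * P s m := by
      intro i l m; simp only [Fin.sum_univ_three]; ring
    simp only [e2]
    rw [this]
    simp only [hT, Fin.sum_univ_three]; ring
  simp only [h1]
  exact tr_conj gi P Q hPQ T

section Killing

variable {g gi : Fin 3 → Fin 3 → A} {Γ : Fin 3 → Fin 3 → Fin 3 → A} {η : Fin 3 → A}
  (L : LeviCivita D g gi Γ) (K : Killing D g η)
include L K

theorem Killing.antisymm (i j : Fin 3) :
    app g (covV D Γ η i) j = -app g (covV D Γ η j) i := by
  have h := K i j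
  have e := L.symm
  simp only [app, covV, Fin.sum_univ_three, L.compat, L.torsion _ i 0, L.torsion _ i 1,
    L.torsion _ i 2, L.torsion _ j 0, L.torsion _ j 1, L.torsion _ j 2] at h ⊢
  rw [e j 0, e j 1, e j 2]
  linear_combination h

/-- `∇_η η = -½ ∇|η|²` for a Killing field `η`. -/
theorem Killing.deriv_normSq (i : Fin 3) : D i (pair (app g η) η)
    = -2 * app g (app (fun l j => covV D Γ η j l) η) i := by
  have h : ∀ j, app g (covV D Γ η i) j = -app g (covV D Γ η j) i := K.antisymm L i
  rw [deriv_pair Γ, show cov1 D Γ (app g η) i = app g (covV D Γ η i) from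
    funext (L.cov1_app η i)]
  have h1 : pair (app g η) (covV D Γ η i) = pair (app g (covV D Γ η i)) η := by
    simp only [pair, app, Fin.sum_univ_three, L.symm 1 0, L.symm 2 0, L.symm 2 1]; ring
  have h2 : app g (app (fun l j => covV D Γ η j l) η) i
      = ∑ j, app g (covV D Γ η j) i * η j := by
    simp only [app, Fin.sum_univ_three]; ring
  rw [h1, h2]
  simp only [pair, h, Fin.sum_univ_three]; ring

theorem Killing.divg_eq_zero : divg D Γ η = 0 := by
  have h : ∀ i l, covV D Γ η i l = ∑ j, gi l j * app g (covV D Γ η i) j := fun i l =>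
    (L.app_app (covV D Γ η i) l).symm
  have ha : ∀ i, app g (covV D Γ η i) i = 0 := fun i => two_mul_cancel (by
    linear_combination K.antisymm L i i)
  have h1 := K.antisymm L 1 0
  have h2 := K.antisymm L 2 0
  have h3 := K.antisymm L 2 1
  have e : divg D Γ η = ∑ l, covV D Γ η l l := by
    simp only [divg, covV, Fin.sum_univ_three, L.torsion _ 1 0, L.torsion _ 2 0, L.torsion _ 2 1]
    ring
  rw [e]
  simp only [h, Fin.sum_univ_three, ha, h1, h2, h3, L.inv_symm 1 0, L.inv_symm 2 0,
    L.inv_symm 2 1]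
  ring

omit L K in
/-- If `η` annihilates `f`, then `Hess f (η, ·) = -df (∇ η)`. -/
theorem hess_app_of_invariant {f : A} (hf : pair (fun i => D i f) η = 0) (i : Fin 3) :
    app (hess D Γ f) η i = -pair (fun a => D a f) (covV D Γ η i) := by
  have h := deriv_pair (D := D) Γ (fun a => D a f) η i
  rw [hf, map_zero] at h
  have e : app (hess D Γ f) η i = pair (cov1 D Γ (fun a => D a f) i) η := by
    simp only [app, pair, hess]
  rw [e]
  linear_combination -h

/-- If `η` annihilates `f`, then it commutes with `∇ f`. -/
theorem Killing.commute_grad (hc : ∀ i j a, D i (D j a) = D j (D i a)) {f : A}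
    (hf : pair (fun i => D i f) η = 0) (l : Fin 3) :
    app (fun l i => covV D Γ (app gi fun a => D a f) i l) η l
      = app (fun l i => covV D Γ η i l) (app gi fun a => D a f) l := by
  refine L.ext_app (fun j => ?_) l
  have h := hess_app_of_invariant (Γ := Γ) hf j
  have e1 : app g (app (fun l i => covV D Γ (app gi fun a => D a f) i l) η) j
      = ∑ i, app g (covV D Γ (app gi fun a => D a f) i) j * η i := by
    simp only [app, Fin.sum_univ_three]; ring
  have e2 : app g (app (fun l i => covV D Γ η i l) (app gi fun a => D a f)) j
      = ∑ i, app g (covV D Γ η i) j * app gi (fun a => D a f) i := by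
    simp only [app, Fin.sum_univ_three]; ring
  rw [e1, e2]
  have h1 : ∀ i, app g (covV D Γ (app gi fun a => D a f) i) j = hess D Γ f j i := fun i => by
    rw [← L.cov1_app, show app g (app gi fun a => D a f) = fun a => D a f from
      funext (L.app_app' _), ← hess, hess_symm L.torsion hc]
  have h2 : ∀ i, app g (covV D Γ η i) j = -app g (covV D Γ η j) i := fun i => K.antisymm L i j
  have h3 : pair (fun a => D a f) (covV D Γ η j)
      = ∑ i, app g (covV D Γ η j) i * app gi (fun a => D a f) i := by
    have e := L.app_app' (fun a => D a f)
    have e3 : pair (app g (app gi fun a => D a f)) (covV D Γ η j)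
        = ∑ i, app g (covV D Γ η j) i * app gi (fun a => D a f) i := by
      generalize app gi (fun a => D a f) = F
      simp only [app, pair, Fin.sum_univ_three, L.symm 1 0, L.symm 2 0, L.symm 2 1]; ring
    rw [← e3, show app g (app gi fun a => D a f) = fun a => D a f from funext e]
  simp only [h1, h2, neg_mul, Finset.sum_neg_distrib, ← h3]
  exact h

theorem Killing.laplacian_invariant (hc : ∀ i j a, D i (D j a) = D j (D i a)) {f : A}
    (hf : pair (fun i => D i f) η = 0) :
    pair (fun i => D i (divg D Γ (app gi fun a => D a f))) η = 0 := by
  have h1 := divg_cov Γ L.torsion hc η (app gi fun a => D a f)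
  have h2 := divg_cov Γ L.torsion hc (app gi fun a => D a f) η
  rw [funext (K.commute_grad L hc hf), h2, K.divg_eq_zero L] at h1
  simp only [map_zero] at h1
  have h3 : bil (ric D Γ) η (app gi fun a => D a f) = bil (ric D Γ) (app gi fun a => D a f) η := by
    have e := L.ric_symm hc
    simp only [bil, Fin.sum_univ_three, e 1 0, e 2 0, e 2 1]; ring
  have h4 : ∀ X Z : Fin 3 → A, ∑ i, ∑ l, covV D Γ X i l * covV D Γ Z l i
      = ∑ i, ∑ l, covV D Γ Z i l * covV D Γ X l i := fun X Z => by
    rw [Finset.sum_comm]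
    exact Finset.sum_congr rfl fun i _ => Finset.sum_congr rfl fun j _ => mul_comm _ _
  rw [h3, h4] at h1
  simp only [pair, zero_mul, Finset.sum_const_zero] at h1 ⊢
  linear_combination -h1

end Killing

variable (D) in
/-- A Killing field `η` and two `η`-invariant functions `f` and `b`. The shift is `2 b η`; with `b`
in place of `2 b` the factors `1/2` of the calculus cancel. -/
structure Shear (g gi : Fin 3 → Fin 3 → A) (Γ : Fin 3 → Fin 3 → Fin 3 → A) (η : Fin 3 → A)
    (f b : A) : Prop where
  lc : LeviCivita D g gi Γ
  comm : ∀ i j a, D i (D j a) = D j (D i a)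
  killing : Killing D g η
  f_inv : pair (fun i => D i f) η = 0
  b_inv : pair (fun i => D i b) η = 0

variable (D) in
/-- The pullback of `g` by the endomorphism `1 + 2 b η ⊗ df` of the tangent bundle. The endomorphism
has inverse `1 - 2 b η ⊗ df` since `df(η) = 0`. -/
def shearMetric (g : Fin 3 → Fin 3 → A) (η : Fin 3 → A) (f b : A) (i j : Fin 3) : A :=
  g i j + 2 * b * (D i f * app g η j + D j f * app g η i)
    + 4 * b * b * pair (app g η) η * D i f * D j f

variable (D) in
/-- The inverse of `shearMetric`. -/
def shearInv (gi : Fin 3 → Fin 3 → A) (η : Fin 3 → A) (f b : A) (i j : Fin 3) : A :=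
  gi i j - 2 * b * (η i * app gi (fun a => D a f) j + app gi (fun a => D a f) i * η j)
    + 4 * b * b * pair (fun a => D a f) (app gi fun a => D a f) * η i * η j

variable (D) in
/-- The difference of the Levi-Civita connections of `shearMetric` and `g`, with values transported
by `1 + 2 b η ⊗ df`. -/
def shearB (g gi : Fin 3 → Fin 3 → A) (Γ : Fin 3 → Fin 3 → Fin 3 → A) (η : Fin 3 → A) (f b : A)
    (l i j : Fin 3) : A :=
  (2 * b * hess D Γ f i j + D j f * D i b + D i f * D j b) * η l
    + (D i b * (app g η j + 2 * b * pair (app g η) η * D j f)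
      + D j b * (app g η i + 2 * b * pair (app g η) η * D i f)) * app gi (fun a => D a f) l
    - (D i f * (app g η j + 2 * b * pair (app g η) η * D j f)
      + D j f * (app g η i + 2 * b * pair (app g η) η * D i f)) * app gi (fun a => D a b) l
    + 2 * b * (D j f * covV D Γ η i l + D i f * covV D Γ η j l)
    + 4 * b * b * D i f * D j f * app (fun l j => covV D Γ η j l) η l

variable (D) in
/-- The difference of the Levi-Civita connections of `shearMetric` and `g`. -/
def shearC (g gi : Fin 3 → Fin 3 → A) (Γ : Fin 3 → Fin 3 → Fin 3 → A) (η : Fin 3 → A) (f b : A)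
    (l i j : Fin 3) : A :=
  shearB D g gi Γ η f b l i j
    - 2 * b * pair (fun a => D a f) (fun l => shearB D g gi Γ η f b l i j) * η l

theorem LeviCivita.pair_lower_comm {g gi : Fin 3 → Fin 3 → A} {Γ : Fin 3 → Fin 3 → Fin 3 → A}
    (L : LeviCivita D g gi Γ) (X Z : Fin 3 → A) :
    pair (app g X) Z = pair (app g Z) X := by
  have t1 := L.symm 1 0
  have t2 := L.symm 2 0
  have t3 := L.symm 2 1
  simp only [pair, app, Fin.sum_univ_three, t1, t2, t3]; ring

theorem LeviCivita.pair_lower_raise {g gi : Fin 3 → Fin 3 → A} {Γ : Fin 3 → Fin 3 → Fin 3 → A}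
    (L : LeviCivita D g gi Γ) (X α : Fin 3 → A) :
    pair (app g X) (app gi α) = pair α X := by
  rw [L.pair_lower_comm, show app g (app gi α) = α from funext (L.app_app' α)]

theorem Killing.pair_covV {g gi : Fin 3 → Fin 3 → A} {Γ : Fin 3 → Fin 3 → Fin 3 → A}
    {η : Fin 3 → A} (L : LeviCivita D g gi Γ) (K : Killing D g η) (i : Fin 3) :
    pair (app g η) (covV D Γ η i) = -app g (app (fun l j => covV D Γ η j l) η) i := by
  have h := K.deriv_normSq L i
  rw [deriv_pair Γ, show cov1 D Γ (app g η) i = app g (covV D Γ η i) from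
    funext (L.cov1_app η i), L.pair_lower_comm] at h
  apply two_mul_cancel
  linear_combination h

theorem Killing.pair_accel {g gi : Fin 3 → Fin 3 → A} {Γ : Fin 3 → Fin 3 → Fin 3 → A}
    {η : Fin 3 → A} (L : LeviCivita D g gi Γ) (K : Killing D g η) :
    pair (app g η) (app (fun l j => covV D Γ η j l) η) = 0 := by
  have h : pair (app g η) (app (fun l j => covV D Γ η j l) η)
      = ∑ j, η j * pair (app g η) (covV D Γ η j) := by
    simp only [pair, app, Fin.sum_univ_three]; ring
  have h2 : ∑ j, η j * pair (app g η) (covV D Γ η j)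
      = -pair (app g (app (fun l j => covV D Γ η j l) η)) η := by
    simp only [K.pair_covV L]
    simp only [pair, Fin.sum_univ_three]; ring
  have h3 := L.pair_lower_comm (app (fun l j => covV D Γ η j l) η) η
  apply two_mul_cancel
  linear_combination h + h2 - h3

namespace Shear

variable {g gi : Fin 3 → Fin 3 → A} {Γ : Fin 3 → Fin 3 → Fin 3 → A} {η : Fin 3 → A} {f b : A}
  (S : Shear D g gi Γ η f b)
include S

theorem shearB_symm (l i j : Fin 3) :
    shearB D g gi Γ η f b l i j = shearB D g gi Γ η f b l j i := by
  simp only [shearB, hess_symm S.lc.torsion S.comm f i j]; ring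

theorem shearC_symm (l i j : Fin 3) :
    shearC D g gi Γ η f b l i j = shearC D g gi Γ η f b l j i := by
  simp only [shearC, S.shearB_symm _ i j]

theorem app_shearMetric (X : Fin 3 → A) (k : Fin 3) :
    ∑ l, X l * shearMetric D g η f b l k = app g X k
      + 2 * b * (pair (fun a => D a f) X * app g η k + D k f * pair (app g η) X)
      + 4 * b * b * pair (app g η) η * pair (fun a => D a f) X * D k f := by
  have h3 : app g X k = ∑ l, X l * g l k := by simp only [app, S.lc.symm k, mul_comm]
  rw [h3]
  simp only [shearMetric]
  generalize pair (app g η) η = m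
  generalize app g η = E
  simp only [pair, Fin.sum_univ_three]
  ring

theorem app_shearMetric_self (k : Fin 3) :
    ∑ l, η l * shearMetric D g η f b l k = app g η k + 2 * b * pair (app g η) η * D k f := by
  rw [S.app_shearMetric, S.f_inv]; ring

theorem sum_mul_shearMetric (X : Fin 3 → A) (k : Fin 3) :
    ∑ l, (X l - 2 * b * pair (fun a => D a f) X * η l) * shearMetric D g η f b l k
      = app g X k + 2 * b * D k f * pair (app g η) X := by
  have e : ∑ l, (X l - 2 * b * pair (fun a => D a f) X * η l) * shearMetric D g η f b l k
      = ∑ l, X l * shearMetric D g η f b l k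
        - 2 * b * pair (fun a => D a f) X * ∑ l, η l * shearMetric D g η f b l k := by
    simp only [Finset.mul_sum, ← Finset.sum_sub_distrib]
    exact Finset.sum_congr rfl fun l _ => by ring
  rw [e, S.app_shearMetric, S.app_shearMetric_self]; ring

theorem leviCivita_shear : LeviCivita D (shearMetric D g η f b) (shearInv D gi η f b)
    (fun l i j => Γ l i j + shearC D g gi Γ η f b l i j) := by
  have L := S.lc
  have hgF : ∀ i, app g (app gi fun a => D a f) i = D i f := L.app_app' _
  have hgB : ∀ i, app g (app gi fun a => D a b) i = D i b := L.app_app' _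
  have hfη := S.f_inv
  have hbη := S.b_inv
  have hηF : pair (app g η) (app gi fun a => D a f) = 0 := by rw [L.pair_lower_raise, hfη]
  have hηB : pair (app g η) (app gi fun a => D a b) = 0 := by rw [L.pair_lower_raise, hbη]
  refine L.add (fun i j => ?_) (fun i j => ?_) (fun i j => ?_) S.shearC_symm (fun i j k => ?_)
  · simp only [shearMetric]; rw [L.symm i j]; ring
  · simp only [shearInv]; rw [L.inv_symm i j]; ring
  · have e : ∑ l, shearInv D gi η f b i l * shearMetric D g η f b l j
       = ∑ l, gi i l * shearMetric D g η f b l j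
         - 2 * b * η i * ∑ l, app gi (fun a => D a f) l * shearMetric D g η f b l j
         + (4 * b * b * pair (fun a => D a f) (app gi fun a => D a f) * η i
          - 2 * b * app gi (fun a => D a f) i) * ∑ l, η l * shearMetric D g η f b l j := by
      simp only [shearInv, Fin.sum_univ_three]; ring
    have h1 : app g (gi i) j = ∑ l, gi i l * g l j := by simp only [app, L.symm j, mul_comm]
    have h2 : ∀ α : Fin 3 → A, pair α (gi i) = app gi α i := fun α => by
      simp only [app, pair, mul_comm]
    rw [e, S.app_shearMetric, S.app_shearMetric, S.app_shearMetric_self, h1, h2, h2, hgF, hηF,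
      L.app_app, L.inv i j]
    ring
  · have hm := S.killing.deriv_normSq L i
    have hN := S.killing.pair_covV L
    have hM := S.killing.pair_accel L
    have hcov : cov2 D Γ (shearMetric D g η f b) i j k
        = 2 * D i b * (D j f * app g η k + D k f * app g η j)
        + 2 * b * (hess D Γ f i j * app g η k + D j f * cov1 D Γ (app g η) i k
          + hess D Γ f i k * app g η j + D k f * cov1 D Γ (app g η) i j)
        + (8 * b * D i b * pair (app g η) η + 4 * b * b * D i (pair (app g η) η)) * D j f * D k f
        + 4 * b * b * pair (app g η) η * (hess D Γ f i j * D k f + D j f * hess D Γ f i k) := by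
      have c := L.compat i j k
      simp only [cov2, shearMetric, hess, cov1]
      generalize pair (app g η) η = m
      generalize app g η = E
      have c4 : D i (4 : A) = 0 := Derivation.map_natCast (D i) 4
      have c2 : D i (2 : A) = 0 := Derivation.map_natCast (D i) 2
      simp only [Fin.sum_univ_three, map_add, Derivation.leibniz, smul_eq_mul, c2, c4] at c ⊢
      linear_combination c
    -- lowering the index of the difference tensor with the new metric
    have hlow : ∀ i j k, ∑ l, shearC D g gi Γ η f b l i j * shearMetric D g η f b l k
        = (2 * b * hess D Γ f i j + D j f * D i b + D i f * D j b) * app g η k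
        + (D i b * (app g η j + 2 * b * pair (app g η) η * D j f)
          + D j b * (app g η i + 2 * b * pair (app g η) η * D i f)) * D k f
        - (D i f * (app g η j + 2 * b * pair (app g η) η * D j f)
          + D j f * (app g η i + 2 * b * pair (app g η) η * D i f)) * D k b
        + 2 * b * (D j f * app g (covV D Γ η i) k + D i f * app g (covV D Γ η j) k)
        + 4 * b * b * D i f * D j f * app g (app (fun l j => covV D Γ η j l) η) k
        + 2 * b * D k f * ((2 * b * hess D Γ f i j + D j f * D i b + D i f * D j b)
            * pair (app g η) η
          - 2 * b * (D j f * app g (app (fun l j => covV D Γ η j l) η) i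
            + D i f * app g (app (fun l j => covV D Γ η j l) η) j)) := by
      intro i j k
      simp only [shearC]
      rw [S.sum_mul_shearMetric (fun l => shearB D g gi Γ η f b l i j) k]
      have e1 : app g (fun l => shearB D g gi Γ η f b l i j) k
        = (2 * b * hess D Γ f i j + D j f * D i b + D i f * D j b) * app g η k
        + (D i b * (app g η j + 2 * b * pair (app g η) η * D j f)
          + D j b * (app g η i + 2 * b * pair (app g η) η * D i f))
            * app g (app gi fun a => D a f) k
        - (D i f * (app g η j + 2 * b * pair (app g η) η * D j f)
          + D j f * (app g η i + 2 * b * pair (app g η) η * D i f))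
            * app g (app gi fun a => D a b) k
        + 2 * b * (D j f * app g (covV D Γ η i) k + D i f * app g (covV D Γ η j) k)
        + 4 * b * b * D i f * D j f * app g (app (fun l j => covV D Γ η j l) η) k := by
        simp only [shearB]
        generalize app gi (fun a => D a f) = F
        generalize app gi (fun a => D a b) = G
        generalize app (fun l j => covV D Γ η j l) η = M
        generalize pair (app g η) η = m
        generalize app g η i = Ei
        generalize app g η j = Ej
        simp only [app, Fin.sum_univ_three]; ring
      have e2 : pair (app g η) (fun l => shearB D g gi Γ η f b l i j)
        = (2 * b * hess D Γ f i j + D j f * D i b + D i f * D j b) * pair (app g η) η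
        + (D i b * (app g η j + 2 * b * pair (app g η) η * D j f)
          + D j b * (app g η i + 2 * b * pair (app g η) η * D i f))
            * pair (app g η) (app gi fun a => D a f)
        - (D i f * (app g η j + 2 * b * pair (app g η) η * D j f)
          + D j f * (app g η i + 2 * b * pair (app g η) η * D i f))
            * pair (app g η) (app gi fun a => D a b)
        + 2 * b * (D j f * pair (app g η) (covV D Γ η i) + D i f * pair (app g η) (covV D Γ η j))
        + 4 * b * b * D i f * D j f
          * pair (app g η) (app (fun l j => covV D Γ η j l) η) := by
        simp only [shearB]
        generalize app gi (fun a => D a f) = F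
        generalize app gi (fun a => D a b) = G
        generalize app (fun l j => covV D Γ η j l) η = M
        generalize app g η = E
        simp only [pair, Fin.sum_univ_three]; ring
      rw [e1, e2, hgF, hgB, hηF, hηB, hM, hN, hN]; ring
    have e5 : ∑ l, (shearC D g gi Γ η f b l i j * shearMetric D g η f b l k
        + shearC D g gi Γ η f b l i k * shearMetric D g η f b j l)
        = ∑ l, shearC D g gi Γ η f b l i j * shearMetric D g η f b l k
        + ∑ l, shearC D g gi Γ η f b l i k * shearMetric D g η f b l j := by
      rw [← Finset.sum_add_distrib]
      refine Finset.sum_congr rfl fun l _ => ?_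
      have : shearMetric D g η f b j l = shearMetric D g η f b l j := by
        simp only [shearMetric]; rw [L.symm l j]; ring
      rw [this]
    have a1 := S.killing.antisymm L j k
    have a2 := S.killing.antisymm L i j
    have a3 := S.killing.antisymm L i k
    rw [e5, hlow, hlow, hcov, hm, L.cov1_app, L.cov1_app]
    linear_combination (-2 * b * D i f) * a1

end Shear

/-! ### The scalar curvature of the shear -/

omit [Algebra ℝ A] in
/-- Expansion of the quadratic term of `scal_add` for a difference tensor that is a sum of tensors
`S ⊗ X`, with `S` symmetric, and of the symmetrization of `c f ⊗ N`. -/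
theorem quadratic_expand (gi S₁ S₂ S₃ S₄ : Fin 3 → Fin 3 → A) (X₁ X₂ X₃ X₄ f : Fin 3 → A)
    (N : Fin 3 → Fin 3 → A) (c : A)
    (hg : ∀ i j, gi i j = gi j i) (h₁ : ∀ i j, S₁ i j = S₁ j i) (h₂ : ∀ i j, S₂ i j = S₂ j i)
    (h₃ : ∀ i j, S₃ i j = S₃ j i) (h₄ : ∀ i j, S₄ i j = S₄ j i) :
    tr gi (fun i j => ∑ l, ∑ m,
      (S₁ i m * X₁ l + S₂ i m * X₂ l + S₃ i m * X₃ l + S₄ i m * X₄ l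
        + c * (f m * N i l + f i * N m l))
      * (S₁ j l * X₁ m + S₂ j l * X₂ m + S₃ j l * X₃ m + S₄ j l * X₄ m
        + c * (f l * N j m + f j * N l m)))
    = pair (app S₁ X₁) (app gi (app S₁ X₁)) + pair (app S₂ X₂) (app gi (app S₂ X₂))
      + pair (app S₃ X₃) (app gi (app S₃ X₃)) + pair (app S₄ X₄) (app gi (app S₄ X₄))
      + 2 * (pair (app S₁ X₂) (app gi (app S₂ X₁)) + pair (app S₁ X₃) (app gi (app S₃ X₁))
        + pair (app S₁ X₄) (app gi (app S₄ X₁)) + pair (app S₂ X₃) (app gi (app S₃ X₂))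
        + pair (app S₂ X₄) (app gi (app S₄ X₂)) + pair (app S₃ X₄) (app gi (app S₄ X₃)))
      + 2 * c * (bil S₁ (app gi f) (app (fun m l => N l m) X₁)
        + bil S₂ (app gi f) (app (fun m l => N l m) X₂)
        + bil S₃ (app gi f) (app (fun m l => N l m) X₃)
        + bil S₄ (app gi f) (app (fun m l => N l m) X₄)
        + pair f X₁ * ∑ m, pair (S₁ m) (app gi fun j => N j m)
        + pair f X₂ * ∑ m, pair (S₂ m) (app gi fun j => N j m)
        + pair f X₃ * ∑ m, pair (S₃ m) (app gi fun j => N j m)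
        + pair f X₄ * ∑ m, pair (S₄ m) (app gi fun j => N j m))
      + c * c * (pair f (app gi f) * ∑ i, ∑ l, N i l * N l i
        + 2 * pair (app N f) (app (fun m l => N l m) (app gi f))
        + pair (app N f) (app gi (app N f))) := by
  have t1 := hg 1 0
  have t2 := hg 2 0
  have t3 := hg 2 1
  have a1 := h₁ 1 0
  have a2 := h₁ 2 0
  have a3 := h₁ 2 1
  have b1 := h₂ 1 0
  have b2 := h₂ 2 0
  have b3 := h₂ 2 1
  have c1 := h₃ 1 0
  have c2 := h₃ 2 0
  have c3 := h₃ 2 1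
  have d1 := h₄ 1 0
  have d2 := h₄ 2 0
  have d3 := h₄ 2 1
  simp only [tr, pair, bil, app, Fin.sum_univ_three, t1, t2, t3, a1, a2, a3, b1, b2, b3, c1, c2,
    c3, d1, d2, d3]
  ring

variable (D) in
/-- The symmetric tensor that is the `η`-component of `shearT`. -/
def shearS (Γ : Fin 3 → Fin 3 → Fin 3 → A) (η : Fin 3 → A)
    (f b : A) (i j : Fin 3) : A :=
  2 * b * (hess D Γ f i j + 2 * b * (D i f * pair (fun a => D a f) (covV D Γ η j)
      + D j f * pair (fun a => D a f) (covV D Γ η i))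
    - 4 * b * b * pair (fun a => D a f) (app (fun l j => covV D Γ η j l) η) * D i f * D j f)
    + D j f * D i b + D i f * D j b

variable (D) in
/-- The difference of the Levi-Civita connections of `shearMetric` and `g`, transported in all its
slots by `1 + 2 b η ⊗ df`, which turns `shearMetric` into `g`. -/
def shearT (g gi : Fin 3 → Fin 3 → A) (Γ : Fin 3 → Fin 3 → Fin 3 → A) (η : Fin 3 → A) (f b : A)
    (l i j : Fin 3) : A :=
  shearS D Γ η f b i j * η l
    + (D i b * app g η j + D j b * app g η i) * app gi (fun a => D a f) l
    + -(D i f * app g η j + D j f * app g η i) * app gi (fun a => D a b) l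
    + -(4 * b * b * D i f * D j f) * app (fun l j => covV D Γ η j l) η l
    + 2 * b * (D j f * covV D Γ η i l + D i f * covV D Γ η j l)

omit [Algebra ℝ A] in
/-- Transport of a symmetric tensor by `1 + c η ⊗ f`. -/
theorem sum_transport (T : Fin 3 → Fin 3 → A) (hT : ∀ i j, T i j = T j i) (η f : Fin 3 → A)
    (c : A) (i j : Fin 3) :
    ∑ q, ∑ s, T q s * ((if q = i then 1 else 0) + c * η q * f i)
      * ((if s = j then 1 else 0) + c * η s * f j)
    = T i j + c * f i * app T η j + c * f j * app T η i + c * c * f i * f j * bil T η η := by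
  have t1 := hT 1 0
  have t2 := hT 2 0
  have t3 := hT 2 1
  fin_cases i <;> fin_cases j <;>
    simp [app, bil, Fin.sum_univ_three, t1, t2, t3] <;> ring

namespace Shear

variable {g gi : Fin 3 → Fin 3 → A} {Γ : Fin 3 → Fin 3 → Fin 3 → A} {η : Fin 3 → A} {f b : A}
  (S : Shear D g gi Γ η f b)
include S

theorem shearS_symm (i j : Fin 3) : shearS D Γ η f b i j = shearS D Γ η f b j i := by
  simp only [shearS, hess_symm S.lc.torsion S.comm f i j]; ring

theorem shearT_symm (l i j : Fin 3) :
    shearT D g gi Γ η f b l i j = shearT D g gi Γ η f b l j i := by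
  simp only [shearT, S.shearS_symm i j]; ring

theorem app_shearS (i : Fin 3) : app (shearS D Γ η f b) η i
    = -2 * b * pair (fun a => D a f) (covV D Γ η i)
      + 4 * b * b * pair (fun a => D a f) (app (fun l j => covV D Γ η j l) η) * D i f := by
  have h := hess_app_of_invariant (Γ := Γ) S.f_inv i
  have h2 : ∑ j, pair (fun a => D a f) (covV D Γ η j) * η j
      = pair (fun a => D a f) (app (fun l j => covV D Γ η j l) η) := by
    simp only [pair, app, Fin.sum_univ_three]; ring
  have e : app (shearS D Γ η f b) η i = 2 * b * (app (hess D Γ f) η i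
      + 2 * b * (D i f * ∑ j, pair (fun a => D a f) (covV D Γ η j) * η j
        + pair (fun a => D a f) η * pair (fun a => D a f) (covV D Γ η i))
      - 4 * b * b * pair (fun a => D a f) (app (fun l j => covV D Γ η j l) η) * D i f
        * pair (fun a => D a f) η) + pair (fun a => D a f) η * D i b
        + D i f * pair (fun a => D a b) η := by
    rw [show app (shearS D Γ η f b) η i = ∑ j, shearS D Γ η f b i j * η j from rfl]
    simp only [shearS]
    generalize pair (fun a => D a f) (app (fun l j => covV D Γ η j l) η) = κ
    obtain ⟨ν, hν⟩ : ∃ ν : Fin 3 → A, ∀ j, pair (fun a => D a f) (covV D Γ η j) = ν j :=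
      ⟨_, fun _ => rfl⟩
    simp only [hν]
    simp only [pair, app, Fin.sum_univ_three]; ring
  rw [e, h, h2, S.f_inv, S.b_inv]; ring

theorem shearB_eq_transport (l i j : Fin 3) : shearB D g gi Γ η f b l i j
    = ∑ q, ∑ s, shearT D g gi Γ η f b l q s * ((if q = i then 1 else 0) + 2 * b * η q * D i f)
      * ((if s = j then 1 else 0) + 2 * b * η s * D j f) := by
  have h1 : ∀ i, app (shearT D g gi Γ η f b l) η i
      = app (shearS D Γ η f b) η i * η l
        + pair (app g η) η * (D i b * app gi (fun a => D a f) l - D i f * app gi (fun a => D a b) l)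
        + 2 * b * D i f * app (fun l j => covV D Γ η j l) η l := by
    intro i
    have e : app (shearT D g gi Γ η f b l) η i = app (shearS D Γ η f b) η i * η l
        + (D i b * pair (app g η) η + pair (fun a => D a b) η * app g η i)
          * app gi (fun a => D a f) l
        - (D i f * pair (app g η) η + pair (fun a => D a f) η * app g η i)
          * app gi (fun a => D a b) l
        - 4 * b * b * D i f * pair (fun a => D a f) η * app (fun l j => covV D Γ η j l) η l
        + 2 * b * (pair (fun a => D a f) η * covV D Γ η i l
          + D i f * app (fun l j => covV D Γ η j l) η l) := by
      rw [show app (shearT D g gi Γ η f b l) η i = ∑ j, shearT D g gi Γ η f b l i j * η j from rfl,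
        show app (shearS D Γ η f b) η i = ∑ j, shearS D Γ η f b i j * η j from rfl]
      simp only [shearT]
      generalize app gi (fun a => D a f) l = Fl
      generalize app gi (fun a => D a b) l = Bl
      generalize app g η = E
      simp only [pair, app, Fin.sum_univ_three]; ring
    rw [e, S.f_inv, S.b_inv]; ring
  have hκ : pair (fun i => pair (fun a => D a f) (covV D Γ η i)) η
      = pair (fun a => D a f) (app (fun l j => covV D Γ η j l) η) := by
    simp only [pair, app, Fin.sum_univ_three]; ring
  have h2 : bil (shearT D g gi Γ η f b l) η η
      = -2 * b * pair (fun a => D a f) (app (fun l j => covV D Γ η j l) η) * η l := by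
    have e : bil (shearT D g gi Γ η f b l) η η = pair (app (shearT D g gi Γ η f b l) η) η := by
      simp only [pair, app, bil, Fin.sum_univ_three]; ring
    have e2 : pair (app (shearT D g gi Γ η f b l) η) η
        = (-2 * b * pair (fun i => pair (fun a => D a f) (covV D Γ η i)) η
          + 4 * b * b * pair (fun a => D a f) (app (fun l j => covV D Γ η j l) η)
            * pair (fun a => D a f) η) * η l
        + pair (app g η) η * (pair (fun a => D a b) η * app gi (fun a => D a f) l
          - pair (fun a => D a f) η * app gi (fun a => D a b) l)
        + 2 * b * pair (fun a => D a f) η * app (fun l j => covV D Γ η j l) η l := by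
      rw [show app (shearT D g gi Γ η f b l) η = _ from funext h1]
      simp only [S.app_shearS]
      generalize pair (fun a => D a f) (app (fun l j => covV D Γ η j l) η) = κ
      generalize app (fun l j => covV D Γ η j l) η l = M
      generalize pair (app g η) η = m
      obtain ⟨ν, hν⟩ : ∃ ν : Fin 3 → A, ∀ j, pair (fun a => D a f) (covV D Γ η j) = ν j :=
        ⟨_, fun _ => rfl⟩
      simp only [hν]
      simp only [pair, Fin.sum_univ_three]; ring
    rw [e, e2, hκ, S.f_inv, S.b_inv]; ring
  rw [sum_transport (shearT D g gi Γ η f b l) (S.shearT_symm l) η (fun a => D a f), h1, h1, h2,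
    S.app_shearS, S.app_shearS]
  simp only [shearB, shearT, shearS]
  ring

end Shear

namespace Shear

variable {g gi : Fin 3 → Fin 3 → A} {Γ : Fin 3 → Fin 3 → Fin 3 → A} {η : Fin 3 → A} {f b : A}
  (S : Shear D g gi Γ η f b)
include S

theorem transport_mul (i j : Fin 3) :
    ∑ l, ((if i = l then 1 else 0) + 2 * b * η i * D l f)
      * ((if l = j then 1 else 0) - 2 * b * η l * D j f) = if i = j then (1 : A) else 0 := by
  have e : ∑ l, ((if i = l then 1 else 0) + 2 * b * η i * D l f)
      * ((if l = j then 1 else 0) - 2 * b * η l * D j f)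
      = (if i = j then (1 : A) else 0)
        - 4 * b * b * η i * D j f * pair (fun a => D a f) η := by
    fin_cases i <;> fin_cases j <;> simp [pair, Fin.sum_univ_three] <;> ring
  rw [e, S.f_inv]; ring

omit S in
theorem shearInv_eq (hi : ∀ i j, gi i j = gi j i) (i j : Fin 3) : shearInv D gi η f b i j
    = ∑ a, ∑ c, ((if i = a then 1 else 0) - 2 * b * η i * D a f)
      * ((if j = c then 1 else 0) - 2 * b * η j * D c f) * gi a c := by
  have t1 := hi 1 0
  have t2 := hi 2 0
  have t3 := hi 2 1
  simp only [shearInv]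
  fin_cases i <;> fin_cases j <;>
    simp [pair, app, Fin.sum_univ_three, t1, t2, t3] <;> ring

omit S in
theorem shearC_eq (l i j : Fin 3) : shearC D g gi Γ η f b l i j
    = ∑ p, ((if l = p then 1 else 0) - 2 * b * η l * D p f) * shearB D g gi Γ η f b p i j := by
  simp only [shearC]
  fin_cases l <;> simp [pair, Fin.sum_univ_three] <;> ring

/-- For symmetric `T`, contraction with the inverse of `shearMetric`. -/
theorem tr_shearInv (T : Fin 3 → Fin 3 → A) :
    tr (shearInv D gi η f b) (fun i j => ∑ q, ∑ s, T q s
      * ((if q = i then 1 else 0) + 2 * b * η q * D i f)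
      * ((if s = j then 1 else 0) + 2 * b * η s * D j f)) = tr gi T := by
  rw [← tr_conj gi _ _ S.transport_mul T]
  congr 1
  funext i j
  exact shearInv_eq S.lc.inv_symm i j

theorem quadratic_shear :
    tr (shearInv D gi η f b) (fun i j => ∑ l, ∑ m,
        shearC D g gi Γ η f b l i m * shearC D g gi Γ η f b m j l)
      = tr gi (fun i j => ∑ l, ∑ m,
        shearT D g gi Γ η f b l i m * shearT D g gi Γ η f b m j l) := by
  rw [← quadratic_conj gi _ _ S.transport_mul (shearT D g gi Γ η f b)]
  congr 1
  · funext i j; exact shearInv_eq S.lc.inv_symm i j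
  · funext i j
    simp only [shearC_eq, S.shearB_eq_transport]

omit S in
theorem pair_covV_eq (L : LeviCivita D g gi Γ) (K : Killing D g η) (X : Fin 3 → A) (i : Fin 3) :
    pair (app g X) (covV D Γ η i) = -app g (app (fun l j => covV D Γ η j l) X) i := by
  have h1 : pair (app g X) (covV D Γ η i) = ∑ j, app g (covV D Γ η i) j * X j := by
    simp only [pair, app, Fin.sum_univ_three, L.symm 1 0, L.symm 2 0, L.symm 2 1]; ring
  have h2 : app g (app (fun l j => covV D Γ η j l) X) i
      = ∑ j, app g (covV D Γ η j) i * X j := by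
    simp only [app, Fin.sum_univ_three]; ring
  rw [h1, h2, ← Finset.sum_neg_distrib]
  exact Finset.sum_congr rfl fun j _ => by rw [K.antisymm L i j]; ring

omit S in
/-- `g(∇_X η, X) = 0` and, more generally, `g(∇_X η, Z)` is antisymmetric. -/
theorem pair_cov_comm (L : LeviCivita D g gi Γ) (K : Killing D g η) (X Z : Fin 3 → A) :
    pair (app g X) (app (fun l j => covV D Γ η j l) Z)
      = -pair (app g Z) (app (fun l j => covV D Γ η j l) X) := by
  have h1 : pair (app g X) (app (fun l j => covV D Γ η j l) Z)
      = ∑ j, Z j * pair (app g X) (covV D Γ η j) := by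
    simp only [pair, app, Fin.sum_univ_three]; ring
  rw [h1]
  simp only [pair_covV_eq L K]
  rw [L.pair_lower_comm]
  simp only [pair, Fin.sum_univ_three]; ring

/-- Collected values of the contractions of `∇η` and `∇f`. -/
theorem contractions :
    pair (fun i => pair (fun a => D a f) (covV D Γ η i)) (app gi fun a => D a f) = 0
    ∧ pair (fun i => pair (fun a => D a f) (covV D Γ η i)) η
      = pair (fun a => D a f) (app (fun l j => covV D Γ η j l) η)
    ∧ (∀ l, app gi (fun i => pair (fun a => D a f) (covV D Γ η i)) l
      = -app (fun l j => covV D Γ η j l) (app gi fun a => D a f) l)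
    ∧ pair (app g η) (app (fun l j => covV D Γ η j l) (app gi fun a => D a f))
      = -pair (fun a => D a f) (app (fun l j => covV D Γ η j l) η) := by
  have L := S.lc
  have hgF : app g (app gi fun a => D a f) = fun a => D a f := funext (L.app_app' _)
  have h1 := pair_covV_eq L S.killing (app gi fun a => D a f)
  rw [hgF] at h1
  have h2 := pair_cov_comm L S.killing (app gi fun a => D a f) (app gi fun a => D a f)
  have h3 := pair_cov_comm L S.killing η (app gi fun a => D a f)
  rw [hgF] at h2 h3
  refine ⟨?_, ?_, ?_, h3⟩
  · have e : pair (fun i => pair (fun a => D a f) (covV D Γ η i)) (app gi fun a => D a f)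
      = pair (fun a => D a f) (app (fun l j => covV D Γ η j l) (app gi fun a => D a f)) := by
      generalize app gi (fun a => D a f) = F
      simp only [pair, app, Fin.sum_univ_three]; ring
    rw [e]; apply two_mul_cancel; linear_combination h2
  · simp only [pair, app, Fin.sum_univ_three]; ring
  · intro l
    simp only [h1]
    have := L.app_app (app (fun l j => covV D Γ η j l) (app gi fun a => D a f)) l
    generalize app g (app (fun l j => covV D Γ η j l) (app gi fun a => D a f)) = Z at *
    rw [← this]
    simp only [app, mul_neg, Finset.sum_neg_distrib]

theorem shearC_trace (i : Fin 3) : ∑ l, shearC D g gi Γ η f b l l i = 0 := by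
  obtain ⟨k1, k2, k3, k4⟩ := S.contractions
  have L := S.lc
  have e : ∑ l, shearC D g gi Γ η f b l l i
      = ∑ p, ∑ l, ((if l = p then 1 else 0) - 2 * b * η l * D p f)
        * ∑ q, ((if q = l then 1 else 0) + 2 * b * η q * D l f)
        * ∑ s, shearT D g gi Γ η f b p q s * ((if s = i then 1 else 0) + 2 * b * η s * D i f) := by
    simp only [shearC_eq, S.shearB_eq_transport, Fin.sum_univ_three]; ring
  have e2 : ∀ T : Fin 3 → Fin 3 → A, ∑ p, ∑ l, ((if l = p then 1 else 0) - 2 * b * η l * D p f)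
        * ∑ q, ((if q = l then 1 else 0) + 2 * b * η q * D l f) * T p q
      = ∑ p, ∑ q, (∑ l, ((if q = l then 1 else 0) + 2 * b * η q * D l f)
          * ((if l = p then 1 else 0) - 2 * b * η l * D p f)) * T p q := by
    intro T
    simp only [Fin.sum_univ_three]; ring
  have ht : ∀ s, ∑ p, shearT D g gi Γ η f b p p s = 0 := by
    intro s
    have hdiv := S.killing.divg_eq_zero L
    have hd2 : ∑ l, covV D Γ η l l = 0 := by
      rw [← hdiv]
      simp only [divg, covV, Fin.sum_univ_three, L.torsion _ 1 0, L.torsion _ 2 0,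
        L.torsion _ 2 1]
      ring
    have hηF : pair (app g η) (app gi fun a => D a f) = 0 := by rw [L.pair_lower_raise, S.f_inv]
    have hηB : pair (app g η) (app gi fun a => D a b) = 0 := by rw [L.pair_lower_raise, S.b_inv]
    have hcomm := L.pair_app_comm (fun a => D a b) (fun a => D a f)
    have e : ∑ p, shearT D g gi Γ η f b p p s = app (shearS D Γ η f b) η s
        + (pair (fun a => D a b) (app gi fun a => D a f) * app g η s
          + D s b * pair (app g η) (app gi fun a => D a f))
        - (pair (fun a => D a f) (app gi fun a => D a b) * app g η s
          + D s f * pair (app g η) (app gi fun a => D a b))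
        - 4 * b * b * D s f * pair (fun a => D a f) (app (fun l j => covV D Γ η j l) η)
        + 2 * b * (D s f * ∑ l, covV D Γ η l l + pair (fun a => D a f) (covV D Γ η s)) := by
      rw [show app (shearS D Γ η f b) η s = ∑ j, shearS D Γ η f b s j * η j from rfl]
      simp only [shearT, S.shearS_symm _ s]
      generalize app g η = E
      generalize app gi (fun a => D a f) = F
      generalize app gi (fun a => D a b) = G
      generalize app (fun l j => covV D Γ η j l) η = M
      simp only [pair, Fin.sum_univ_three]; ring
    rw [e, S.app_shearS, hηF, hηB, hcomm, hd2]; ring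
  rw [e, e2]
  simp only [S.transport_mul, ite_mul, one_mul, zero_mul, Finset.sum_ite_eq', Finset.mem_univ,
    if_true]
  rw [Finset.sum_comm]
  simp only [← Finset.sum_mul, ht, zero_mul, Finset.sum_const_zero]

/-- The contraction of the transported difference tensor. -/
theorem tr_shearT (l : Fin 3) : tr gi (shearT D g gi Γ η f b l)
    = (2 * b * divg D Γ (app gi fun a => D a f) - 8 * b * b * b
        * pair (fun a => D a f) (app (fun l j => covV D Γ η j l) η)
        * pair (fun a => D a f) (app gi fun a => D a f)
        + 2 * pair (fun a => D a b) (app gi fun a => D a f)) * η l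
      + 4 * b * app (fun l j => covV D Γ η j l) (app gi fun a => D a f) l
      - 4 * b * b * pair (fun a => D a f) (app gi fun a => D a f)
        * app (fun l j => covV D Γ η j l) η l := by
  obtain ⟨k1, k2, k3, k4⟩ := S.contractions
  have L := S.lc
  have hηF : pair (app g η) (app gi fun a => D a f) = 0 := by rw [L.pair_lower_raise, S.f_inv]
  have hηB : pair (app g η) (app gi fun a => D a b) = 0 := by rw [L.pair_lower_raise, S.b_inv]
  have hcomm := L.pair_app_comm (fun a => D a b) (fun a => D a f)
  have hΔ : tr gi (hess D Γ f) = divg D Γ (app gi fun a => D a f) := by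
    rw [← L.div1_eq]; rfl
  have hs : tr gi (shearS D Γ η f b) = 2 * b * (tr gi (hess D Γ f)
      + 4 * b * pair (fun i => pair (fun a => D a f) (covV D Γ η i)) (app gi fun a => D a f)
      - 4 * b * b * pair (fun a => D a f) (app (fun l j => covV D Γ η j l) η)
        * pair (fun a => D a f) (app gi fun a => D a f))
      + 2 * pair (fun a => D a b) (app gi fun a => D a f) := by
    rw [show tr gi (shearS D Γ η f b) = ∑ i, ∑ j, gi i j * shearS D Γ η f b i j from rfl]
    simp only [shearS]
    generalize pair (fun a => D a f) (app (fun l j => covV D Γ η j l) η) = κ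
    obtain ⟨ν, hν⟩ : ∃ ν : Fin 3 → A, ∀ j, pair (fun a => D a f) (covV D Γ η j) = ν j :=
      ⟨_, fun _ => rfl⟩
    simp only [hν]
    simp only [tr, pair, app, Fin.sum_univ_three, L.inv_symm 1 0, L.inv_symm 2 0,
      L.inv_symm 2 1]
    ring
  have e : tr gi (shearT D g gi Γ η f b l) = tr gi (shearS D Γ η f b) * η l
      + 2 * pair (app g η) (app gi fun a => D a b) * app gi (fun a => D a f) l
      - 2 * pair (app g η) (app gi fun a => D a f) * app gi (fun a => D a b) l
      - 4 * b * b * pair (fun a => D a f) (app gi fun a => D a f)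
        * app (fun l j => covV D Γ η j l) η l
      + 4 * b * app (fun l j => covV D Γ η j l) (app gi fun a => D a f) l := by
    rw [show tr gi (shearT D g gi Γ η f b l)
      = ∑ i, ∑ j, gi i j * shearT D g gi Γ η f b l i j from rfl]
    simp only [shearT]
    have e3 : app (fun l j => covV D Γ η j l) (app gi fun a => D a f) l
        = ∑ j, covV D Γ η j l * app gi (fun a => D a f) j := rfl
    rw [e3]
    generalize app (fun l j => covV D Γ η j l) η l = M
    generalize hF : app gi (fun a => D a f) l = Fl
    generalize hG : app gi (fun a => D a b) l = Gl
    generalize app g η = E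
    simp only [tr, pair, app, Fin.sum_univ_three, L.inv_symm 1 0, L.inv_symm 2 0,
      L.inv_symm 2 1]
    ring
  rw [e, hs, k1, hΔ, hηB, hηF]; ring

/-- The vector field whose divergence enters through `scal_add`. -/
theorem tr_shearC (l : Fin 3) : tr (shearInv D gi η f b) (shearC D g gi Γ η f b l)
    = (2 * b * divg D Γ (app gi fun a => D a f)
        + 2 * pair (fun a => D a b) (app gi fun a => D a f)) * η l
      + 4 * b * app (fun l j => covV D Γ η j l) (app gi fun a => D a f) l
      - 4 * b * b * pair (fun a => D a f) (app gi fun a => D a f)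
        * app (fun l j => covV D Γ η j l) η l := by
  obtain ⟨k1, k2, k3, k4⟩ := S.contractions
  have hB : ∀ p, tr (shearInv D gi η f b) (shearB D g gi Γ η f b p)
      = tr gi (shearT D g gi Γ η f b p) := fun p => by
    rw [← S.tr_shearInv]; congr 1; funext i j; exact S.shearB_eq_transport p i j
  have e : tr (shearInv D gi η f b) (shearC D g gi Γ η f b l)
      = tr (shearInv D gi η f b) (shearB D g gi Γ η f b l)
        - 2 * b * η l * pair (fun a => D a f)
          (fun p => tr (shearInv D gi η f b) (shearB D g gi Γ η f b p)) := by
    simp only [tr, shearC, pair, Fin.sum_univ_three]; ring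
  have k1' : pair (fun a => D a f) (app (fun l j => covV D Γ η j l) (app gi fun a => D a f))
      = 0 := by
    rw [← k1]
    generalize app gi (fun a => D a f) = F
    simp only [pair, app, Fin.sum_univ_three]; ring
  have e2 : ∀ (c d e : A) (X Z : Fin 3 → A), pair (fun a => D a f)
      (fun p => c * η p + d * X p - e * Z p) = c * pair (fun a => D a f) η
        + d * pair (fun a => D a f) X - e * pair (fun a => D a f) Z := fun c d e X Z => by
    simp only [pair, Fin.sum_univ_three]; ring
  rw [e]
  simp only [hB, S.tr_shearT]
  rw [e2, S.f_inv, k1']; ring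

end Shear

section Algebra

omit [Algebra ℝ A]
variable (gi : Fin 3 → Fin 3 → A) (α β γ δ X Z : Fin 3 → A) (a c d e : A)

theorem pair_linear_left : pair (fun i => a * α i + c * β i) X
    = a * pair α X + c * pair β X := by
  simp only [pair, Fin.sum_univ_three]; ring

theorem pair_app_linear_right : pair α (app gi fun i => d * γ i + e * δ i)
    = d * pair α (app gi γ) + e * pair α (app gi δ) := by
  simp only [pair, app, Fin.sum_univ_three]; ring

theorem app_symmProd : app (fun i j => α i * β j + α j * β i) X
    = fun i => pair β X * α i + pair α X * β i := by
  funext i; simp only [pair, app, Fin.sum_univ_three]; ring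

theorem app_neg_symmProd : app (fun i j => -(α i * β j + α j * β i)) X
    = fun i => -pair β X * α i + -pair α X * β i := by
  funext i; simp only [pair, app, Fin.sum_univ_three]; ring

theorem app_sq : app (fun i j => -(c * α i * α j)) X
    = fun i => -c * pair α X * α i + 0 * α i := by
  funext i; simp only [pair, app, Fin.sum_univ_three]; ring

theorem bil_symmProd : bil (fun i j => α i * β j + α j * β i) X Z
    = pair α X * pair β Z + pair β X * pair α Z := by
  simp only [pair, bil, Fin.sum_univ_three]; ring

theorem bil_neg_symmProd : bil (fun i j => -(α i * β j + α j * β i)) X Z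
    = -(pair α X * pair β Z + pair β X * pair α Z) := by
  simp only [pair, bil, Fin.sum_univ_three]; ring

theorem bil_sq : bil (fun i j => -(c * α i * α j)) X Z = -c * pair α X * pair α Z := by
  simp only [pair, bil, Fin.sum_univ_three]; ring

variable (N : Fin 3 → Fin 3 → A)

theorem contract_symmProd (hg : ∀ i j, gi i j = gi j i) :
    ∑ m, pair (fun j => α m * β j + α j * β m) (app gi fun j => N j m)
       = pair α (app (fun l j => N j l) (app gi β))
        + pair β (app (fun l j => N j l) (app gi α)) := by
  simp only [pair, app, Fin.sum_univ_three, hg 1 0, hg 2 0, hg 2 1]; ring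

theorem contract_neg_symmProd (hg : ∀ i j, gi i j = gi j i) :
    ∑ m, pair (fun j => -(α m * β j + α j * β m)) (app gi fun j => N j m)
      = -(pair α (app (fun l j => N j l) (app gi β))
        + pair β (app (fun l j => N j l) (app gi α))) := by
  simp only [pair, app, Fin.sum_univ_three, hg 1 0, hg 2 0, hg 2 1]; ring

theorem contract_sq (hg : ∀ i j, gi i j = gi j i) :
    ∑ m, pair (fun j => -(c * α m * α j)) (app gi fun j => N j m)
      = -c * pair α (app (fun l j => N j l) (app gi α)) := by
  simp only [pair, app, Fin.sum_univ_three, hg 1 0, hg 2 0, hg 2 1]; ring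

end Algebra

/-- The derivative of `|∇f|²`. -/
theorem deriv_normSq_grad {g gi : Fin 3 → Fin 3 → A} {Γ : Fin 3 → Fin 3 → Fin 3 → A}
    (L : LeviCivita D g gi Γ) (f : A) (i : Fin 3) :
    D i (pair (fun a => D a f) (app gi fun a => D a f))
      = 2 * pair (hess D Γ f i) (app gi fun a => D a f) := by
  rw [deriv_pair Γ, show covV D Γ (app gi fun a => D a f) i
    = app gi (cov1 D Γ (fun a => D a f) i) from funext (L.covV_app _ i),
    L.pair_app_comm (fun i => D i f)]
  simp only [two_mul]
  rfl

/-- The contraction of a Hessian with the antisymmetric tensor `∇η` vanishes. -/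
theorem sum_covV_grad {g gi : Fin 3 → Fin 3 → A} {Γ : Fin 3 → Fin 3 → Fin 3 → A}
    {η : Fin 3 → A} (L : LeviCivita D g gi Γ) (hc : ∀ i j a, D i (D j a) = D j (D i a))
    (K : Killing D g η) (f : A) :
    ∑ i, ∑ l, covV D Γ (app gi fun a => D a f) i l * covV D Γ η l i = 0 := by
  have h1 : ∀ i l, covV D Γ (app gi fun a => D a f) i l = app gi (hess D Γ f i) l :=
    fun i l => L.covV_app _ i l
  have h2 : ∀ i l, covV D Γ η i l = app gi (app g (covV D Γ η i)) l :=
    fun i l => (L.app_app _ l).symm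
  have hs := hess_symm L.torsion hc f
  have ha := K.antisymm L
  obtain ⟨P, hP⟩ : ∃ P : Fin 3 → Fin 3 → A, ∀ i, app g (covV D Γ η i) = P i := ⟨_, fun _ => rfl⟩
  simp only [hP] at h2 ha
  simp only [h1, h2]
  generalize hess D Γ f = H at hs
  have a0 : ∀ i, P i i = 0 := fun i => two_mul_cancel (by linear_combination ha i i)
  simp only [app, Fin.sum_univ_three, hs 1 0, hs 2 0, hs 2 1, ha 1 0, ha 2 0, ha 2 1, a0,
    L.inv_symm 1 0, L.inv_symm 2 0, L.inv_symm 2 1]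
  ring

namespace Shear

variable {g gi : Fin 3 → Fin 3 → A} {Γ : Fin 3 → Fin 3 → Fin 3 → A} {η : Fin 3 → A} {f b : A}
  (S : Shear D g gi Γ η f b)
include S

theorem quadratic_shearT :
    tr gi (fun i j => ∑ l, ∑ m, shearT D g gi Γ η f b l i m * shearT D g gi Γ η f b m j l)
    = 2 * pair (app g η) η * (pair (fun a => D a b) (app gi fun a => D a f)
          * pair (fun a => D a b) (app gi fun a => D a f)
        - pair (fun a => D a f) (app gi fun a => D a f)
          * pair (fun a => D a b) (app gi fun a => D a b))
      + 4 * b * b * pair (fun a => D a f) (app gi fun a => D a f)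
        * ∑ i, ∑ l, covV D Γ η i l * covV D Γ η l i
      + 8 * b * b * bil (hess D Γ f) (app gi fun a => D a f) (app (fun l j => covV D Γ η j l) η)
      + 8 * b * pair (fun a => D a f) (app gi fun a => D a f)
        * pair (fun a => D a b) (app (fun l j => covV D Γ η j l) η) := by
  obtain ⟨k1, k2, k3, k4⟩ := S.contractions
  have L := S.lc
  have hηF : pair (app g η) (app gi fun a => D a f) = 0 := by rw [L.pair_lower_raise, S.f_inv]
  have hηB : pair (app g η) (app gi fun a => D a b) = 0 := by rw [L.pair_lower_raise, S.b_inv]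
  have hηM := S.killing.pair_accel L
  have hfη := S.f_inv
  have hbη := S.b_inv
  have hfB := L.pair_app_comm (fun a => D a f) (fun a => D a b)
  have hgη : ∀ i, app gi (app g η) i = η i := L.app_app η
  have hηN := pair_covV_eq L S.killing η
  have hNB := pair_cov_comm L S.killing η (app gi fun a => D a b)
  rw [show app g (app gi fun a => D a b) = fun a => D a b from funext (L.app_app' _)] at hNB
  have hq := quadratic_expand gi (shearS D Γ η f b)
    (fun i j => D i b * app g η j + D j b * app g η i)
    (fun i j => -(D i f * app g η j + D j f * app g η i))
    (fun i j => -(4 * b * b * D i f * D j f))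
    η (app gi fun a => D a f) (app gi fun a => D a b) (app (fun l j => covV D Γ η j l) η)
    (fun a => D a f) (covV D Γ η) (2 * b) L.inv_symm S.shearS_symm (fun i j => by ring)
    (fun i j => by ring) (fun i j => by ring)
  refine hq.trans ?_
  clear hq
  have hSη : app (shearS D Γ η f b) η = fun i => -2 * b * pair (fun a => D a f) (covV D Γ η i)
      + 4 * b * b * pair (fun a => D a f) (app (fun l j => covV D Γ η j l) η) * D i f :=
    funext S.app_shearS
  have hSM : bil (shearS D Γ η f b) (app gi fun a => D a f) (app (fun l j => covV D Γ η j l) η)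
      = 2 * b * (bil (hess D Γ f) (app gi fun a => D a f) (app (fun l j => covV D Γ η j l) η)
        + 2 * b * (pair (fun a => D a f) (app gi fun a => D a f)
          * pair (fun i => pair (fun a => D a f) (covV D Γ η i))
            (app (fun l j => covV D Γ η j l) η)
          + pair (fun a => D a f) (app (fun l j => covV D Γ η j l) η)
          * pair (fun i => pair (fun a => D a f) (covV D Γ η i)) (app gi fun a => D a f))
        - 4 * b * b * pair (fun a => D a f) (app (fun l j => covV D Γ η j l) η)
          * pair (fun a => D a f) (app gi fun a => D a f)
          * pair (fun a => D a f) (app (fun l j => covV D Γ η j l) η))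
        + pair (fun a => D a b) (app gi fun a => D a f)
          * pair (fun a => D a f) (app (fun l j => covV D Γ η j l) η)
        + pair (fun a => D a f) (app gi fun a => D a f)
          * pair (fun a => D a b) (app (fun l j => covV D Γ η j l) η) := by
    generalize hκ : pair (fun a => D a f) (app (fun l j => covV D Γ η j l) η) = κ
    simp only [bil, shearS]
    rw [hκ]
    obtain ⟨ν, hν⟩ : ∃ ν : Fin 3 → A, ∀ j, pair (fun a => D a f) (covV D Γ η j) = ν j :=
      ⟨_, fun _ => rfl⟩
    simp only [hν]
    rw [← hκ]
    generalize app (fun l j => covV D Γ η j l) η = M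
    generalize app gi (fun a => D a f) = F
    simp only [pair, Fin.sum_univ_three]
    ring
  have hpf : ∀ N : Fin 3 → Fin 3 → A, app N (fun a => D a f)
      = fun i => pair (fun a => D a f) (N i) := fun N => by
    funext i; simp only [app, pair, mul_comm]
  have k1' : pair (fun a => D a f) (app (fun l j => covV D Γ η j l) (app gi fun a => D a f))
      = 0 := by
    rw [← k1]
    generalize app gi (fun a => D a f) = F
    simp only [pair, app, Fin.sum_univ_three]; ring
  have hsymm : ∀ X Z : Fin 3 → A, pair (app (shearS D Γ η f b) X) Z
      = pair (app (shearS D Γ η f b) Z) X := fun X Z => by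
    have h := S.shearS_symm
    generalize shearS D Γ η f b = T at h
    simp only [pair, app, Fin.sum_univ_three, h 1 0, h 2 0, h 2 1]; ring
  have hS := hsymm (app gi fun a => D a b) (app gi fun a => D a f)
  have hνν : pair (fun i => pair (fun a => D a f) (covV D Γ η i))
      (app gi fun i => pair (fun a => D a f) (covV D Γ η i))
      = -pair (fun i => pair (fun a => D a f) (covV D Γ η i))
        (app (fun l j => covV D Γ η j l) (app gi fun a => D a f)) := by
    rw [funext k3]; simp only [pair, mul_neg, Finset.sum_neg_distrib]
  have hfν := L.pair_app_comm (fun a => D a f)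
    (fun i => pair (fun a => D a f) (covV D Γ η i))
  rw [k1] at hfν
  have hνM : pair (fun i => pair (fun a => D a f) (covV D Γ η i))
      (app (fun l j => covV D Γ η j l) η)
      = pair (fun a => D a f)
        (app (fun l j => covV D Γ η j l) (app (fun l j => covV D Γ η j l) η)) := by
    generalize app (fun l j => covV D Γ η j l) η = M
    simp only [pair, app, Fin.sum_univ_three]; ring
  have hηη : app gi (app g η) = η := funext hgη
  rw [contract_symmProd gi _ _ _ L.inv_symm, contract_neg_symmProd gi _ _ _ L.inv_symm,
    contract_sq gi _ _ _ L.inv_symm, bil_symmProd, bil_neg_symmProd, bil_sq, hpf (covV D Γ η),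
    hSη, hSM]
  simp only [app_symmProd, app_neg_symmProd, app_sq, pair_linear_left, pair_app_linear_right,
    hfη, hbη, hηF, hηB, hηM, hηη, hfB, hνν, hfν, hνM, k1, k1', k4, hNB, hS]
  ring

theorem pair_grads_invariant :
    pair (fun i => D i (pair (fun a => D a b) (app gi fun a => D a f))) η = 0 := by
  have L := S.lc
  have h1 : ∀ i, D i (pair (fun a => D a b) (app gi fun a => D a f))
      = pair (hess D Γ b i) (app gi fun a => D a f)
        + pair (fun a => D a b) (covV D Γ (app gi fun a => D a f) i) := fun i =>
    deriv_pair Γ _ _ i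
  have h2 : pair (fun i => pair (hess D Γ b i) (app gi fun a => D a f)) η
      = pair (app (hess D Γ b) η) (app gi fun a => D a f) := by
    have hs := hess_symm L.torsion S.comm b
    generalize hess D Γ b = H at hs
    generalize app gi (fun a => D a f) = F
    simp only [pair, app, Fin.sum_univ_three, hs 1 0, hs 2 0, hs 2 1]; ring
  have h3 : pair (fun i => pair (fun a => D a b) (covV D Γ (app gi fun a => D a f) i)) η
      = pair (fun a => D a b)
        (app (fun l i => covV D Γ (app gi fun a => D a f) i l) η) := by
    simp only [pair, app, Fin.sum_univ_three]; ring
  have h4 : pair (app (hess D Γ b) η) (app gi fun a => D a f) = -pair (fun a => D a b)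
      (app (fun l i => covV D Γ η i l) (app gi fun a => D a f)) := by
    rw [show app (hess D Γ b) η = _ from funext (hess_app_of_invariant (Γ := Γ) S.b_inv)]
    generalize app gi (fun a => D a f) = F
    simp only [pair, app, Fin.sum_univ_three]; ring
  have h5 : pair (fun i => D i (pair (fun a => D a b) (app gi fun a => D a f))) η
      = pair (fun i => pair (hess D Γ b i) (app gi fun a => D a f)) η
        + pair (fun i => pair (fun a => D a b) (covV D Γ (app gi fun a => D a f) i)) η := by
    simp only [h1]
    simp only [pair, Fin.sum_univ_three]; ring
  rw [h5, h2, h3, h4, funext (S.killing.commute_grad L S.comm S.f_inv)]; ring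

/-- The scalar curvature of `shearMetric`. Since the difference tensor `shearC` has vanishing trace,
only `div (tr C)` and the quadratic term of `scal_add` contribute; the latter is computed after
transport by `1 + 2 b η ⊗ df`. -/
theorem scal_shear : tr (shearInv D gi η f b)
      (ric D fun l i j => Γ l i j + shearC D g gi Γ η f b l i j)
    = tr gi (ric D Γ)
      - 4 * pair (fun a => D a f) (app (fun l j => covV D Γ η j l) (app gi fun a => D a b))
      - 2 * pair (app g η) η * (pair (fun a => D a f) (app gi fun a => D a f)
          * pair (fun a => D a b) (app gi fun a => D a b)
        - pair (fun a => D a b) (app gi fun a => D a f)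
          * pair (fun a => D a b) (app gi fun a => D a f)) := by
  have L := S.lc
  have h1 := scal_add Γ (shearC D g gi Γ η f b) _ L.torsion S.shearC_symm
    S.leviCivita_shear.inv_symm S.leviCivita_shear.deriv_inv
  have happ0 : ∀ l, app (shearInv D gi η f b) (fun _ => (0 : A)) l = 0 := fun l => by
    simp [app]
  simp only [S.shearC_trace, happ0, mul_zero, sub_zero, S.quadratic_shear, S.quadratic_shearT,
    S.tr_shearC] at h1
  have hric : tr (shearInv D gi η f b) (ric D Γ) = tr gi (ric D Γ)
      - 4 * b * bil (ric D Γ) η (app gi fun a => D a f)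
      + 4 * b * b * pair (fun a => D a f) (app gi fun a => D a f) * bil (ric D Γ) η η := by
    have hs := L.ric_symm S.comm
    generalize ric D Γ = R at hs
    simp only [tr, shearInv]
    generalize pair (fun a => D a f) (app gi fun a => D a f) = n
    generalize app gi (fun a => D a f) = F
    simp only [bil, Fin.sum_univ_three, hs 1 0, hs 2 0, hs 2 1]; ring
  have hdiv := S.killing.divg_eq_zero L
  have hdF := divg_cov Γ L.torsion S.comm (app gi fun a => D a f) η
  have hdM := divg_cov Γ L.torsion S.comm η η
  have hp0 : ∀ X : Fin 3 → A, pair (fun _ => (0 : A)) X = 0 := fun X => by simp [pair]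
  rw [sum_covV_grad L S.comm S.killing, hdiv] at hdF
  rw [hdiv] at hdM
  simp only [map_zero, hp0] at hdF hdM
  have hΔ := S.killing.laplacian_invariant L S.comm S.f_inv
  have hbf := S.pair_grads_invariant
  have hcomm := pair_cov_comm L S.killing (app gi fun a => D a b) (app gi fun a => D a f)
  rw [show app g (app gi fun a => D a b) = fun a => D a b from funext (L.app_app' _),
    show app g (app gi fun a => D a f) = fun a => D a f from funext (L.app_app' _)] at hcomm
  have c4 : ∀ i, D i (4 : A) = 0 := fun i => Derivation.map_natCast (D i) 4
  have c2 : ∀ i, D i (2 : A) = 0 := fun i => Derivation.map_natCast (D i) 2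
  have e1 : pair (fun i => D i (2 * b * divg D Γ (app gi fun a => D a f)
        + 2 * pair (fun a => D a b) (app gi fun a => D a f))) η
      = 2 * b * pair (fun i => D i (divg D Γ (app gi fun a => D a f))) η
        + 2 * divg D Γ (app gi fun a => D a f) * pair (fun i => D i b) η
        + 2 * pair (fun i => D i (pair (fun a => D a b) (app gi fun a => D a f))) η := by
    generalize divg D Γ (app gi fun a => D a f) = Δ
    generalize pair (fun a => D a b) (app gi fun a => D a f) = s
    simp only [pair, map_add, Derivation.leibniz, smul_eq_mul, c2, Fin.sum_univ_three]; ring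
  have e2 : ∀ X, pair (fun i => D i (4 * b)) X = 4 * pair (fun i => D i b) X := fun X => by
    simp only [pair, Derivation.leibniz, smul_eq_mul, c4, Fin.sum_univ_three]; ring
  have e3 : pair (fun i => D i (4 * b * b * pair (fun a => D a f) (app gi fun a => D a f)))
        (app (fun l j => covV D Γ η j l) η)
      = 8 * b * pair (fun a => D a f) (app gi fun a => D a f)
          * pair (fun a => D a b) (app (fun l j => covV D Γ η j l) η)
        + 8 * b * b
          * bil (hess D Γ f) (app gi fun a => D a f) (app (fun l j => covV D Γ η j l) η) := by
    have hn := deriv_normSq_grad L f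
    have hs := hess_symm L.torsion S.comm f
    generalize app (fun l j => covV D Γ η j l) η = M
    generalize pair (fun a => D a f) (app gi fun a => D a f) = n at hn
    generalize hess D Γ f = H at hn hs
    simp only [pair, bil, Derivation.leibniz, smul_eq_mul, c4, hn, Fin.sum_univ_three, hs 1 0,
      hs 2 0, hs 2 1]
    ring
  rw [h1, hric, divg_sub, divg_add, divg_smul, divg_smul, divg_smul, hdiv, e1, e2, e3, hΔ, hbf,
    S.b_inv, hdF, hdM, hcomm]
  ring

end Shear

/-! ### Invariant tensors and functions -/

/-- The inner product of two covariant 2-tensors. -/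
def inner2 (gi h p : Fin 3 → Fin 3 → A) : A :=
  ∑ i, ∑ j, ∑ a, ∑ b, gi i a * gi j b * h i j * p a b

section Algebra

omit [Algebra ℝ A]
variable (gi h p : Fin 3 → Fin 3 → A) (α β X Z : Fin 3 → A) (c : A)

theorem normSq_add_mul (hg : ∀ i j, gi i j = gi j i) :
    normSq gi (fun i j => h i j + c * p i j)
      = normSq gi h + 2 * c * inner2 gi h p + c * c * normSq gi p := by
  simp only [normSq, inner2, Fin.sum_univ_three, hg 1 0, hg 2 0, hg 2 1]; ring

theorem inner2_symmProd (hg : ∀ i j, gi i j = gi j i) (hh : ∀ i j, h i j = h j i) :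
    inner2 gi h (fun i j => α i * β j + α j * β i)
      = 2 * bil h (app gi α) (app gi β) := by
  simp only [inner2, bil, app, Fin.sum_univ_three, hg 1 0, hg 2 0, hg 2 1, hh 1 0, hh 2 0, hh 2 1]
  ring

theorem normSq_mul_symmProd (hg : ∀ i j, gi i j = gi j i) :
    normSq gi (fun i j => c * (α i * β j + α j * β i))
      = 2 * c * c * (pair α (app gi α) * pair β (app gi β)
        + pair α (app gi β) * pair α (app gi β)) := by
  simp only [normSq, pair, app, Fin.sum_univ_three, hg 1 0, hg 2 0, hg 2 1]
  ring

theorem tr_add_mul_symmProd (hg : ∀ i j, gi i j = gi j i) :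
    tr gi (fun i j => h i j + c * (α i * β j + α j * β i))
      = tr gi h + 2 * c * pair α (app gi β) := by
  simp only [tr, pair, app, Fin.sum_univ_three, hg 1 0, hg 2 0, hg 2 1]; ring

end Algebra

/-- The divergence of the vector field dual to `h(X, ·)`, for a symmetric tensor `h`. -/
theorem LeviCivita.two_divg_app {g gi : Fin 3 → Fin 3 → A} {Γ : Fin 3 → Fin 3 → Fin 3 → A}
    (L : LeviCivita D g gi Γ) {h : Fin 3 → Fin 3 → A} (hh : ∀ i j, h i j = h j i)
    (X : Fin 3 → A) :
    2 * divg D Γ (app gi (app h X)) = 2 * pair (div2 D gi Γ h) X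
      + inner2 gi h (fun i j => app g (covV D Γ X i) j + app g (covV D Γ X j) i) := by
  have t1 := L.inv_symm 1 0
  have t2 := L.inv_symm 2 0
  have t3 := L.inv_symm 2 1
  have e1 := fun l => L.torsion l 1 0
  have e2 := fun l => L.torsion l 2 0
  have e3 := fun l => L.torsion l 2 1
  have h1 := hh 1 0
  have h2 := hh 2 0
  have h3 := hh 2 1
  have e : divg D Γ (app gi (app h X)) = pair (div2 D gi Γ h) X
      + ∑ i, ∑ l, ∑ j, gi i l * h i j * covV D Γ X l j := by
    simp only [divg, pair, div2, cov2, covV, app, Fin.sum_univ_three, map_add, Derivation.leibniz,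
      smul_eq_mul, L.deriv_inv, t1, t2, t3, e1, e2, e3, h1, h2, h3]
    ring
  have e4 : ∀ l j, covV D Γ X l j = app gi (app g (covV D Γ X l)) j :=
    fun l j => (L.app_app _ j).symm
  obtain ⟨P, hP⟩ : ∃ P : Fin 3 → Fin 3 → A, ∀ i, app g (covV D Γ X i) = P i := ⟨_, fun _ => rfl⟩
  simp only [hP] at e4 ⊢
  rw [e]
  simp only [e4, inner2, app, Fin.sum_univ_three, t1, t2, t3, h1, h2, h3]
  ring

/-- The covariant derivative of the dual 1-form of a Killing field is its exterior derivative. -/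
theorem Killing.two_covV {g gi : Fin 3 → Fin 3 → A} {Γ : Fin 3 → Fin 3 → Fin 3 → A}
    {η : Fin 3 → A} (L : LeviCivita D g gi Γ) (K : Killing D g η) (i j : Fin 3) :
    2 * app g (covV D Γ η i) j = D i (app g η j) - D j (app g η i) := by
  have h := K.antisymm L i j
  have h1 := L.cov1_app η i j
  have h2 := L.cov1_app η j i
  have e : ∀ l, Γ l j i = Γ l i j := fun l => L.torsion l j i
  simp only [cov1, e] at h1 h2
  linear_combination h - h1 + h2

/-- The differential of an invariant function is invariant. -/
theorem lie_grad {η : Fin 3 → A} (hc : ∀ i j a, D i (D j a) = D j (D i a)) {f : A}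
    (hf : pair (fun i => D i f) η = 0) (i : Fin 3) :
    ∑ l, (η l * D l (D i f) + D l f * D i (η l)) = 0 := by
  have h := congrArg (D i) hf
  simp only [pair, Fin.sum_univ_three, map_add, Derivation.leibniz, smul_eq_mul, map_zero] at h
  simp only [Fin.sum_univ_three, hc _ i]
  linear_combination h

/-- The dual 1-form of a Killing field is invariant. -/
theorem Killing.lie_app {g : Fin 3 → Fin 3 → A} {η : Fin 3 → A} (K : Killing D g η)
    (i : Fin 3) : ∑ l, (η l * D l (app g η i) + app g η l * D i (η l)) = 0 := by
  have h0 := K i 0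
  have h1 := K i 1
  have h2 := K i 2
  simp only [app, Fin.sum_univ_three, map_add, Derivation.leibniz, smul_eq_mul] at h0 h1 h2 ⊢
  linear_combination η 0 * h0 + η 1 * h1 + η 2 * h2

theorem Killing.normSq_invariant {g gi : Fin 3 → Fin 3 → A} {Γ : Fin 3 → Fin 3 → Fin 3 → A}
    {η : Fin 3 → A} (L : LeviCivita D g gi Γ) (K : Killing D g η) :
    pair (fun i => D i (pair (app g η) η)) η = 0 := by
  have h := K.pair_accel L
  rw [L.pair_lower_comm] at h
  simp only [K.deriv_normSq L]
  simp only [pair, Fin.sum_univ_three] at h ⊢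
  linear_combination -2 * h

/-- Adding an invariant multiple of a symmetric product of invariant 1-forms preserves
invariance. -/
theorem Killing.add_symmProd {g : Fin 3 → Fin 3 → A} {η : Fin 3 → A} (K : Killing D g η)
    {c : A} (hc : pair (fun i => D i c) η = 0) {α β : Fin 3 → A}
    (hα : ∀ i, ∑ l, (η l * D l (α i) + α l * D i (η l)) = 0)
    (hβ : ∀ i, ∑ l, (η l * D l (β i) + β l * D i (η l)) = 0) :
    Killing D (fun i j => g i j + c * (α i * β j + α j * β i)) η := by
  intro i j
  have h := K i j
  have a1 := hα i
  have a2 := hα j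
  have b1 := hβ i
  have b2 := hβ j
  simp only [pair, Fin.sum_univ_three, map_add, Derivation.leibniz, smul_eq_mul]
    at h hc a1 a2 b1 b2 ⊢
  linear_combination h + (α i * β j + α j * β i) * hc + c * β j * a1 + c * β i * a2
    + c * α j * b1 + c * α i * b2

theorem invariant_mul {η : Fin 3 → A} {c d : A} (hc : pair (fun i => D i c) η = 0)
    (hd : pair (fun i => D i d) η = 0) : pair (fun i => D i (c * d)) η = 0 := by
  simp only [pair, Fin.sum_univ_three, Derivation.leibniz, smul_eq_mul] at hc hd ⊢
  linear_combination d * hc + c * hd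

theorem invariant_add {η : Fin 3 → A} {c d : A} (hc : pair (fun i => D i c) η = 0)
    (hd : pair (fun i => D i d) η = 0) : pair (fun i => D i (c + d)) η = 0 := by
  simp only [pair, Fin.sum_univ_three, map_add] at hc hd ⊢
  linear_combination hc + hd

theorem invariant_natCast (η : Fin 3 → A) (n : ℕ) : pair (fun i => D i (n : A)) η = 0 := by
  simp [pair]

/-- The function `h(X, Z)` is invariant if `h` is invariant and `X`, `Z` commute with `η`. -/
theorem Killing.bil_invariant {h : Fin 3 → Fin 3 → A} {η X Z : Fin 3 → A} (K : Killing D h η)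
    (hX : ∀ l, ∑ i, (η i * D i (X l) - X i * D i (η l)) = 0)
    (hZ : ∀ l, ∑ i, (η i * D i (Z l) - Z i * D i (η l)) = 0) :
    pair (fun i => D i (bil h X Z)) η = 0 := by
  have e : pair (fun i => D i (bil h X Z)) η
      = ∑ i, ∑ j, (∑ l, (η l * D l (h i j) + h l j * D i (η l) + h i l * D j (η l))) * X i * Z j
      + ∑ i, ∑ j, h i j * ((∑ l, (η l * D l (X i) - X l * D l (η i))) * Z j
        + X i * ∑ l, (η l * D l (Z j) - Z l * D l (η j))) := by
    simp only [pair, bil, Fin.sum_univ_three, map_add, Derivation.leibniz, smul_eq_mul]; ring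
  have K' := fun i j => K i j
  rw [e]
  simp only [K', hX, hZ]
  simp

theorem Killing.lie_gradient {g gi : Fin 3 → Fin 3 → A} {Γ : Fin 3 → Fin 3 → Fin 3 → A}
    {η : Fin 3 → A} (L : LeviCivita D g gi Γ) (K : Killing D g η)
    (hc : ∀ i j a, D i (D j a) = D j (D i a)) {f : A} (hf : pair (fun i => D i f) η = 0)
    (l : Fin 3) : ∑ i, (η i * D i (app gi (fun a => D a f) l)
      - app gi (fun a => D a f) i * D i (η l)) = 0 := by
  have h := K.commute_grad L hc hf l
  generalize app gi (fun a => D a f) = F at h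
  have e := L.torsion l
  simp only [app, covV, Fin.sum_univ_three, e 1 0, e 2 0, e 2 1] at h ⊢
  linear_combination h

/-! ### The axially symmetric deformation -/

variable (D) in
/-- The metric `g + u² df²`. -/
def graphMetric (g : Fin 3 → Fin 3 → A) (f u : A) (i j : Fin 3) : A := g i j + u * u * D i f * D j f

variable (D) in
/-- The inverse of `graphMetric`. -/
def graphInv (gi : Fin 3 → Fin 3 → A) (f u ρ : A) (i j : Fin 3) : A :=
  gi i j - u * ρ * app gi (fun a => D a f) i * (u * ρ * app gi (fun a => D a f) j)

variable (D) in
/-- The Christoffel symbols of `graphMetric`. -/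
def graphΓ (gi : Fin 3 → Fin 3 → A) (Γ : Fin 3 → Fin 3 → Fin 3 → A) (f u ρ : A)
    (l i j : Fin 3) : A := Γ l i j + staticC D gi Γ f u ρ l i j

variable (D) in
/-- The deformed metric `ḡ`, for the vector field `Ȳ = 2 b η`: the shear of `g + u² df²`. -/
def barMetric (g : Fin 3 → Fin 3 → A) (η : Fin 3 → A) (f u b : A) : Fin 3 → Fin 3 → A :=
  shearMetric D (graphMetric D g f u) η f b

variable (D) in
/-- The inverse of `barMetric`. -/
def barInv (gi : Fin 3 → Fin 3 → A) (η : Fin 3 → A) (f u ρ b : A) : Fin 3 → Fin 3 → A :=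
  shearInv D (graphInv D gi f u ρ) η f b

variable (D) in
/-- The Christoffel symbols of `barMetric`. -/
def barΓ (g gi : Fin 3 → Fin 3 → A) (Γ : Fin 3 → Fin 3 → Fin 3 → A) (η : Fin 3 → A) (f u ρ b : A)
    (l i j : Fin 3) : A :=
  graphΓ D gi Γ f u ρ l i j
    + shearC D (graphMetric D g f u) (graphInv D gi f u ρ) (graphΓ D gi Γ f u ρ) η f b l i j

variable (D) in
/-- The second fundamental form `π` of the graph of `f`, for `Ȳ = 2 b η`. -/
def sff (g : Fin 3 → Fin 3 → A) (Γ : Fin 3 → Fin 3 → Fin 3 → A) (η : Fin 3 → A) (f u ui ρ b : A)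
    (i j : Fin 3) : A :=
  sff0 D Γ f u ρ i j + ρ * ui * (D i b * app g η j + D j b * app g η i)

variable (D) in
/-- The tensor `k̄ = (∇̄ᵢ Yⱼ + ∇̄ⱼ Yᵢ) / (2u)`. As `Y` is `2 b` times the 1-form dual to the
Killing field `η` of `ḡ`, only the derivatives of `b` contribute. -/
def kbar (g : Fin 3 → Fin 3 → A) (η : Fin 3 → A) (f u ui b : A) (i j : Fin 3) : A :=
  ui * (D i b * app (barMetric D g η f u b) η j + D j b * app (barMetric D g η f u b) η i)

variable (D) in
/-- The vector field `β = u² ∇f + 2 b η`, the shift of the foliation by time translates of the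
graph. -/
def shift (gi : Fin 3 → Fin 3 → A) (η : Fin 3 → A) (f u b : A) (i : Fin 3) : A :=
  u * u * app gi (fun a => D a f) i + 2 * b * η i

variable (D) in
/-- The axially symmetric setting: a Killing field `η` that leaves `f`, `u` and `b` invariant, on
top of `Static`. -/
structure Axisym (g gi : Fin 3 → Fin 3 → A) (Γ : Fin 3 → Fin 3 → Fin 3 → A) (η : Fin 3 → A)
    (f u ui r ρ b : A) : Prop extends Static D g gi Γ f u ui r ρ where
  killing : Killing D g η
  f_inv : pair (fun i => D i f) η = 0
  u_inv' : pair (fun i => D i u) η = 0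
  b_inv : pair (fun i => D i b) η = 0

namespace Axisym

variable {g gi : Fin 3 → Fin 3 → A} {Γ : Fin 3 → Fin 3 → Fin 3 → A} {η : Fin 3 → A}
  {f u ui r ρ b : A} (S : Axisym D g gi Γ η f u ui r ρ b)
include S

theorem lc_graph : LeviCivita D (graphMetric D g f u) (graphInv D gi f u ρ)
    (graphΓ D gi Γ f u ρ) := S.toStatic.leviCivita_graph

omit S in
theorem app_graphMetric (X : Fin 3 → A) (i : Fin 3) : app (graphMetric D g f u) X i
    = app g X i + u * u * pair (fun a => D a f) X * D i f := by
  simp only [app, graphMetric, pair, Fin.sum_univ_three]; ring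

omit S in
theorem app_graphInv (α : Fin 3 → A) (i : Fin 3) : app (graphInv D gi f u ρ) α i
    = app gi α i - u * u * ρ * ρ * pair α (app gi fun a => D a f)
      * app gi (fun a => D a f) i := by
  rw [show app (graphInv D gi f u ρ) α i = ∑ j, graphInv D gi f u ρ i j * α j from rfl]
  simp only [graphInv]
  obtain ⟨F, hF⟩ : ∃ F, app gi (fun a => D a f) = F := ⟨_, rfl⟩
  simp only [hF]
  simp only [app, pair, Fin.sum_univ_three]; ring

theorem app_graphMetric_self : app (graphMetric D g f u) η = app g η :=
  funext fun i => by rw [app_graphMetric, S.f_inv]; ring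

theorem app_graphInv_grad : app (graphInv D gi f u ρ) (fun a => D a f)
    = fun i => ρ * ρ * app gi (fun a => D a f) i := funext fun i => by
  rw [app_graphInv]
  linear_combination (-app gi (fun a => D a f) i) * S.toStatic.rho_sq

theorem shear_grad {c : A} (hc : pair (fun i => D i c) η = 0) {d : A}
    (hd : pair (fun i => D i d) η = 0) : Shear D g gi Γ η c d :=
  ⟨S.lc, S.comm, S.killing, hc, hd⟩

/-- The inner product of the gradients of invariant functions is invariant. -/
theorem grads_invariant {c : A} (hc : pair (fun i => D i c) η = 0) {d : A}
    (hd : pair (fun i => D i d) η = 0) :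
    pair (fun i => D i (pair (fun a => D a d) (app gi fun a => D a c))) η = 0 :=
  (S.shear_grad hc hd).pair_grads_invariant

theorem killing_graph : Killing D (graphMetric D g f u) η := by
  have hl := lie_grad S.comm S.f_inv
  intro i j
  have h := S.killing i j
  have hu := S.u_inv'
  have h1 := hl i
  have h2 := hl j
  simp only [graphMetric, pair, Fin.sum_univ_three, map_add, Derivation.leibniz, smul_eq_mul]
    at h hu h1 h2 ⊢
  linear_combination h + 2 * u * D i f * D j f * hu + u * u * D j f * h1 + u * u * D i f * h2

theorem shear : Shear D (graphMetric D g f u) (graphInv D gi f u ρ) (graphΓ D gi Γ f u ρ) η f b :=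
  ⟨S.lc_graph, S.comm, S.killing_graph, S.f_inv, S.b_inv⟩

theorem lc_bar : LeviCivita D (barMetric D g η f u b) (barInv D gi η f u ρ b)
    (barΓ D g gi Γ η f u ρ b) := S.shear.leviCivita_shear

theorem barMetric_eq (i j : Fin 3) : barMetric D g η f u b i j = g i j + u * u * D i f * D j f
    + 2 * b * (D i f * app g η j + D j f * app g η i)
    + 4 * b * b * pair (app g η) η * D i f * D j f := by
  simp only [barMetric, shearMetric, S.app_graphMetric_self]; rfl

theorem app_bar (X : Fin 3 → A) (i : Fin 3) : app (barMetric D g η f u b) X i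
    = app g X i + u * u * pair (fun a => D a f) X * D i f
      + 2 * b * (D i f * pair (app g η) X + pair (fun a => D a f) X * app g η i)
      + 4 * b * b * pair (app g η) η * pair (fun a => D a f) X * D i f := by
  rw [show app (barMetric D g η f u b) X i = ∑ j, barMetric D g η f u b i j * X j from rfl,
    show app g X i = ∑ j, g i j * X j from rfl]
  simp only [S.barMetric_eq]
  generalize pair (app g η) η = m
  generalize app g η = E
  simp only [pair, Fin.sum_univ_three]; ring

theorem app_bar_self (i : Fin 3) : app (barMetric D g η f u b) η i
    = app g η i + 2 * b * pair (app g η) η * D i f := by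
  rw [S.app_bar, S.f_inv]; ring

omit S in
theorem app_barInv {α : Fin 3 → A} (hα : pair α η = 0) (i : Fin 3) :
    app (barInv D gi η f u ρ b) α i = app (graphInv D gi f u ρ) α i
      + (4 * b * b * pair (fun a => D a f) (app (graphInv D gi f u ρ) fun a => D a f) * pair α η
        - 2 * b * pair α (app (graphInv D gi f u ρ) fun a => D a f)) * η i := by
  rw [show app (barInv D gi η f u ρ b) α i = ∑ j, barInv D gi η f u ρ b i j * α j from rfl,
    show app (graphInv D gi f u ρ) α i = ∑ j, graphInv D gi f u ρ i j * α j from rfl]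
  simp only [barInv, shearInv]
  generalize graphInv D gi f u ρ = hi
  generalize pair (fun a => D a f) (app hi fun a => D a f) = n
  generalize app hi (fun a => D a f) = F
  simp only [pair, Fin.sum_univ_three] at hα ⊢
  linear_combination (-2 * b * F i) * hα

theorem killing_bar : Killing D (barMetric D g η f u b) η := by
  have hm := S.killing.normSq_invariant S.lc
  have h2 := invariant_natCast (D := D) η 2
  have hc : pair (fun i => D i (2 * b * b * pair (app g η) η)) η = 0 :=
    invariant_mul (invariant_mul (invariant_mul h2 S.b_inv) S.b_inv) hm
  have hl := lie_grad S.comm S.f_inv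
  have hg := (S.killing_graph.add_symmProd (invariant_mul h2 S.b_inv) hl
    S.killing.lie_app).add_symmProd hc hl hl
  convert hg using 1
  funext i j
  rw [S.barMetric_eq, graphMetric]
  push_cast
  ring

/-- The trace of the symbols of `ḡ`: its volume density with respect to `g` is `r`. -/
theorem r_mul_divg_bar (X : Fin 3 → A) :
    r * divg D (barΓ D g gi Γ η f u ρ b) X = divg D Γ (fun i => r * X i) := by
  have h1 : divg D (barΓ D g gi Γ η f u ρ b) X = _ := divg_add_symbols _ _ _
  have h2 : divg D (graphΓ D gi Γ f u ρ) X = _ := divg_add_symbols _ _ _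
  rw [h1, h2, divg_smul]
  simp only [S.shear.shearC_trace, S.toStatic.deriv_r, pair, Fin.sum_univ_three]
  ring

end Axisym

namespace Axisym

variable {g gi : Fin 3 → Fin 3 → A} {Γ : Fin 3 → Fin 3 → Fin 3 → A} {η : Fin 3 → A}
  {f u ui r ρ b : A} (S : Axisym D g gi Γ η f u ui r ρ b)
include S

/-! ### Invariance under the Killing field -/

theorem ui_invariant : pair (fun i => D i ui) η = 0 := by
  have h : pair (fun i => D i (u * ui)) η = 0 := by
    simp [S.u_inv, pair]
  have h2 := S.u_inv'
  have h3 := S.u_inv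
  simp only [pair, Fin.sum_univ_three, Derivation.leibniz, smul_eq_mul] at h h2 ⊢
  linear_combination ui * h - ui * ui * h2
    - (D 0 ui * η 0 + D 1 ui * η 1 + D 2 ui * η 2) * h3

theorem normSq_grad_invariant :
    pair (fun i => D i (pair (fun a => D a f) (app gi fun a => D a f))) η = 0 :=
  S.grads_invariant S.f_inv S.f_inv

theorem r_invariant : pair (fun i => D i r) η = 0 := by
  have h : pair (fun i => D i (r * r)) η = 0 := by
    rw [S.r_sq]
    refine invariant_add ?_ (invariant_mul (invariant_mul S.u_inv' S.u_inv')
      S.normSq_grad_invariant)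
    simp [pair]
  apply two_mul_cancel
  have h3 := S.r_inv
  simp only [pair, Fin.sum_univ_three, Derivation.leibniz, smul_eq_mul] at h ⊢
  linear_combination ρ * h - 2 * (D 0 r * η 0 + D 1 r * η 1 + D 2 r * η 2) * h3

theorem rho_invariant : pair (fun i => D i ρ) η = 0 := by
  have h : pair (fun i => D i (r * ρ)) η = 0 := by
    simp [S.r_inv, pair]
  have h2 := S.r_invariant
  have h3 := S.r_inv
  simp only [pair, Fin.sum_univ_three, Derivation.leibniz, smul_eq_mul] at h h2 ⊢
  linear_combination ρ * h - ρ * ρ * h2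
    - (D 0 ρ * η 0 + D 1 ρ * η 1 + D 2 ρ * η 2) * h3

omit S in
theorem two_invariant : pair (fun i => D i (2 : A)) η = 0 := by
  simpa using invariant_natCast (D := D) η 2

/-- An invariant multiple of `η` is divergence free. -/
theorem divg_mul_self {c : A} (hc : pair (fun i => D i c) η = 0) :
    divg D Γ (fun i => c * η i) = 0 := by
  rw [divg_smul, S.killing.divg_eq_zero S.lc, hc]; ring

theorem two_hess_grad : 2 * bil (hess D Γ f) (app gi fun a => D a f) (app gi fun a => D a f)
    = pair (fun i => D i (pair (fun a => D a f) (app gi fun a => D a f)))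
      (app gi fun a => D a f) := by
  simp only [deriv_normSq_grad S.lc f]
  generalize app gi (fun a => D a f) = F
  simp only [bil, pair, Fin.sum_univ_three]; ring

/-- `∇η` is antisymmetric: `df(∇_{∇f} η) = 0`. -/
theorem grad_app_cov : pair (fun a => D a f) (app (fun l j => covV D Γ η j l)
    (app gi fun a => D a f)) = 0 := by
  have h := Shear.pair_cov_comm S.lc S.killing (app gi fun a => D a f) (app gi fun a => D a f)
  rw [show app g (app gi fun a => D a f) = fun a => D a f from funext (S.lc.app_app' _)] at h
  apply two_mul_cancel
  linear_combination h

/-- The one-form `Hess f(η, ·)`. -/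
theorem hess_self (i : Fin 3) : app (hess D Γ f) η i
    = app g (app (fun l j => covV D Γ η j l) (app gi fun a => D a f)) i := by
  rw [hess_app_of_invariant S.f_inv]
  have h := Shear.pair_covV_eq S.lc S.killing (app gi fun a => D a f) i
  rw [show app g (app gi fun a => D a f) = fun a => D a f from funext (S.lc.app_app' _)] at h
  rw [h]; ring

omit S in
theorem app_sff0 (X : Fin 3 → A) (i : Fin 3) : app (sff0 D Γ f u ρ) X i
    = ρ * (u * app (hess D Γ f) X i + pair (fun a => D a f) X * D i u
      + pair (fun a => D a u) X * D i f) := by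
  simp only [app, sff0, pair, Fin.sum_univ_three]; ring

omit S in
theorem app_sff (X : Fin 3 → A) (i : Fin 3) : app (sff D g Γ η f u ui ρ b) X i
    = app (sff0 D Γ f u ρ) X i
      + ρ * ui * (pair (app g η) X * D i b + pair (fun a => D a b) X * app g η i) := by
  rw [show app (sff D g Γ η f u ui ρ b) X i = ∑ j, sff D g Γ η f u ui ρ b i j * X j from rfl]
  simp only [sff]
  generalize app g η = E
  simp only [app, pair, Fin.sum_univ_three]; ring

theorem sff_symm (i j : Fin 3) : sff D g Γ η f u ui ρ b i j = sff D g Γ η f u ui ρ b j i := by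
  rw [sff, sff, S.toStatic.sff0_symm]; ring

/-- The function `π(β, ∇f)` is invariant. -/
theorem sff_shift_invariant : pair (fun i => D i (bil (sff D g Γ η f u ui ρ b)
    (shift D gi η f u b) (app gi fun a => D a f))) η = 0 := by
  have h1 : pair (fun i => D i (bil (hess D Γ f) (app gi fun a => D a f)
      (app gi fun a => D a f))) η = 0 := by
    have h := S.grads_invariant S.f_inv S.normSq_grad_invariant
    rw [← S.two_hess_grad] at h
    apply two_mul_cancel
    have c2 : ∀ i, D i (2 : A) = 0 := fun i => Derivation.map_natCast (D i) 2
    simp only [pair, Fin.sum_univ_three, Derivation.leibniz, smul_eq_mul, c2] at h ⊢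
    linear_combination h
  have e : bil (sff D g Γ η f u ui ρ b) (shift D gi η f u b) (app gi fun a => D a f)
      = u * u * ρ * (u * bil (hess D Γ f) (app gi fun a => D a f) (app gi fun a => D a f)
        + 2 * pair (fun a => D a u) (app gi fun a => D a f)
          * pair (fun a => D a f) (app gi fun a => D a f))
        + 2 * b * ρ * ui * pair (app g η) η * pair (fun a => D a b) (app gi fun a => D a f) := by
    have e1 : ∀ X Z : Fin 3 → A, bil (sff D g Γ η f u ui ρ b) X Z
        = pair (app (sff D g Γ η f u ui ρ b) Z) X := fun X Z => by
      simp only [bil, pair, app, Fin.sum_univ_three]; ring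
    have e2 : pair (app (sff D g Γ η f u ui ρ b) (app gi fun a => D a f)) (shift D gi η f u b)
        = u * u * pair (app (sff D g Γ η f u ui ρ b) (app gi fun a => D a f))
            (app gi fun a => D a f)
          + 2 * b * pair (app (sff D g Γ η f u ui ρ b) (app gi fun a => D a f)) η := by
      simp only [pair, shift, Fin.sum_univ_three]; ring
    have hηF : pair (app g η) (app gi fun a => D a f) = 0 := by
      rw [S.lc.pair_lower_raise, S.f_inv]
    have e3 : ∀ Z, pair (app (sff D g Γ η f u ui ρ b) (app gi fun a => D a f)) Z
        = ρ * (u * pair (app (hess D Γ f) (app gi fun a => D a f)) Z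
          + pair (fun a => D a f) (app gi fun a => D a f) * pair (fun a => D a u) Z
          + pair (fun a => D a u) (app gi fun a => D a f) * pair (fun a => D a f) Z)
          + ρ * ui * pair (fun a => D a b) (app gi fun a => D a f) * pair (app g η) Z := by
      intro Z
      rw [show app (sff D g Γ η f u ui ρ b) (app gi fun a => D a f) = _ from
        funext fun i => app_sff _ i]
      simp only [app_sff0, hηF]
      simp only [pair, Fin.sum_univ_three]; ring
    have e4 : pair (app (hess D Γ f) (app gi fun a => D a f)) (app gi fun a => D a f)
        = bil (hess D Γ f) (app gi fun a => D a f) (app gi fun a => D a f) := by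
      generalize app gi (fun a => D a f) = F
      simp only [bil, pair, app, Fin.sum_univ_three]; ring
    have e5 : pair (app (hess D Γ f) (app gi fun a => D a f)) η = 0 := by
      have e6 : pair (app (hess D Γ f) (app gi fun a => D a f)) η
          = pair (app (hess D Γ f) η) (app gi fun a => D a f) := by
        have hs := hess_symm S.lc.torsion S.comm f
        generalize app gi (fun a => D a f) = F
        simp only [pair, app, Fin.sum_univ_three, hs 1 0, hs 2 0, hs 2 1]; ring
      rw [e6, show app (hess D Γ f) η = _ from funext S.hess_self, S.lc.pair_lower_raise,
        S.grad_app_cov]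
    rw [e1, e2, e3, e3, e4, e5, hηF, S.f_inv, S.u_inv']
    ring
  have hF := S.f_inv
  have hu := S.u_inv'
  have hρ := S.rho_invariant
  have h2 := two_invariant (D := D) (η := η)
  have hFu := S.grads_invariant S.f_inv S.u_inv'
  have hFb := S.grads_invariant S.f_inv S.b_inv
  have hm := S.killing.normSq_invariant S.lc
  rw [e]
  exact invariant_add
    (invariant_mul (invariant_mul (invariant_mul hu hu) hρ) (invariant_add (invariant_mul hu h1)
      (invariant_mul (invariant_mul h2 hFu) S.normSq_grad_invariant)))
    (invariant_mul (invariant_mul (invariant_mul (invariant_mul (invariant_mul h2 S.b_inv) hρ)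
      S.ui_invariant) hm) hFb)

theorem bil_shift_invariant {k : Fin 3 → Fin 3 → A} (K : Killing D k η) :
    pair (fun i => D i (bil k (shift D gi η f u b) (app gi fun a => D a f))) η = 0 := by
  have e : bil k (shift D gi η f u b) (app gi fun a => D a f)
      = u * u * bil k (app gi fun a => D a f) (app gi fun a => D a f)
        + 2 * b * bil k η (app gi fun a => D a f) := by
    simp only [bil, shift, Fin.sum_univ_three]; ring
  have h1 := S.killing.lie_gradient S.lc S.comm S.f_inv
  have h2 : ∀ l, ∑ i, (η i * D i (η l) - η i * D i (η l)) = 0 := fun l => by simp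
  rw [e]
  exact invariant_add (invariant_mul (invariant_mul S.u_inv' S.u_inv') (K.bil_invariant h1 h1))
    (invariant_mul (invariant_mul two_invariant S.b_inv) (K.bil_invariant h2 h1))

/-- The symmetrized derivative of the shift vector field is the second fundamental form. -/
theorem covV_shift_symm (i j : Fin 3) :
    app g (covV D Γ (shift D gi η f u b) i) j + app g (covV D Γ (shift D gi η f u b) j) i
      = 2 * (u * r) * sff D g Γ η f u ui ρ b i j := by
  have hl : ∀ i, app g (shift D gi η f u b) i = u * u * D i f + 2 * b * app g η i := fun i => by
    have h := S.lc.app_app' (fun a => D a f) i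
    rw [← h]
    simp only [shift, app, Fin.sum_univ_three]; ring
  have c2 : ∀ i, D i (2 : A) = 0 := fun i => Derivation.map_natCast (D i) 2
  have e : ∀ i j, app g (covV D Γ (shift D gi η f u b) i) j
      = 2 * u * D i u * D j f + u * u * hess D Γ f i j + 2 * D i b * app g η j
        + 2 * b * app g (covV D Γ η i) j := fun i j => by
    rw [← S.lc.cov1_app, ← S.lc.cov1_app, show app g (shift D gi η f u b) = _ from funext hl]
    generalize app g η = E
    simp only [cov1, hess, Fin.sum_univ_three, map_add, Derivation.leibniz, smul_eq_mul, c2]; ring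
  rw [e, e, S.killing.antisymm S.lc i j, hess_symm S.lc.torsion S.comm f j i]
  simp only [sff, sff0]
  linear_combination (-2 * u * (u * hess D Γ f i j + D i u * D j f + D j u * D i f)
    - 2 * u * ui * (D i b * app g η j + D j b * app g η i)) * S.r_inv
    - 2 * (D i b * app g η j + D j b * app g η i) * S.u_inv

/-- The divergence of `h(β, ·)` for the shift vector field `β`. -/
theorem divg_app_shift {h : Fin 3 → Fin 3 → A} (hh : ∀ i j, h i j = h j i) :
    divg D Γ (app gi (app h (shift D gi η f u b))) = pair (div2 D gi Γ h) (shift D gi η f u b)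
      + u * r * inner2 gi h (sff D g Γ η f u ui ρ b) := by
  have e := S.lc.two_divg_app hh (shift D gi η f u b)
  simp only [S.covV_shift_symm] at e
  have e2 : inner2 gi h (fun i j => 2 * (u * r) * sff D g Γ η f u ui ρ b i j)
      = 2 * (u * r) * inner2 gi h (sff D g Γ η f u ui ρ b) := by
    simp only [inner2, Finset.mul_sum]
    exact Finset.sum_congr rfl fun _ _ => Finset.sum_congr rfl fun _ _ =>
      Finset.sum_congr rfl fun _ _ => Finset.sum_congr rfl fun _ _ => by ring
  rw [e2] at e
  apply two_mul_cancel
  linear_combination e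

/-- Lowering with `ḡ` the vector field dual to `h(w) + u r h(w, w) df`, where `u r w = β` is the
shift vector field. -/
theorem app_bar_lin {h : Fin 3 → Fin 3 → A} (hh : ∀ i j, h i j = h j i) {w : Fin 3 → A}
    (hw : ∀ i, u * r * w i = shift D gi η f u b i) (i : Fin 3) :
    app (barMetric D g η f u b) (fun l => app gi (app h w) l
        - bil h w (app gi fun a => D a f) * (2 * b * η l)) i
      = app h w i + u * D i f * bil h w w * r := by
  have L := S.lc
  have hs : pair (fun a => D a f) (app gi (app h w)) = bil h w (app gi fun a => D a f) := by
    rw [L.pair_app_comm]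
    generalize app gi (fun a => D a f) = F
    simp only [bil, pair, app, Fin.sum_univ_three, hh 1 0, hh 2 0, hh 2 1]; ring
  have hE : pair (app g η) (app gi (app h w)) = bil h w η := by
    rw [L.pair_lower_raise]
    simp only [bil, pair, app, Fin.sum_univ_three, hh 1 0, hh 2 0, hh 2 1]; ring
  have e : app (barMetric D g η f u b) (fun l => app gi (app h w) l
        - bil h w (app gi fun a => D a f) * (2 * b * η l)) i
      = app (barMetric D g η f u b) (app gi (app h w)) i
        - 2 * b * bil h w (app gi fun a => D a f) * app (barMetric D g η f u b) η i := by
    generalize bil h w (app gi fun a => D a f) = s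
    generalize app gi (app h w) = X
    simp only [app, Fin.sum_univ_three]; ring
  have hb : u * r * bil h w w = u * u * bil h w (app gi fun a => D a f) + 2 * b * bil h w η := by
    have : u * r * bil h w w = bil h w (fun i => u * r * w i) := by
      simp only [bil, Fin.sum_univ_three]; ring
    rw [this]
    simp only [hw]
    simp only [bil, shift, Fin.sum_univ_three]; ring
  rw [e, S.app_bar, S.app_bar_self, L.app_app', hs, hE]
  linear_combination (-D i f) * hb

end Axisym

/-! ### The 1-form `Q` -/

namespace Axisym

variable {g gi : Fin 3 → Fin 3 → A} {Γ : Fin 3 → Fin 3 → Fin 3 → A} {η : Fin 3 → A}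
  {f u ui r ρ b : A} (S : Axisym D g gi Γ η f u ui r ρ b)
include S

/-- The covariant derivatives of `η` for `ḡ` and `g`, with lowered indices, differ by the exterior
derivative of `2 b |η|² df`. -/
theorem bar_covV (i j : Fin 3) :
    app (barMetric D g η f u b) (covV D (barΓ D g gi Γ η f u ρ b) η i) j
      = app g (covV D Γ η i) j + D i (b * pair (app g η) η) * D j f
        - D j (b * pair (app g η) η) * D i f := by
  have h1 := S.killing_bar.two_covV S.lc_bar i j
  have h2 := S.killing.two_covV S.lc i j
  simp only [S.app_bar_self] at h1
  have c2 : ∀ i, D i (2 : A) = 0 := fun i => Derivation.map_natCast (D i) 2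
  have hc := S.comm i j f
  generalize pair (app g η) η = m at h1 ⊢
  simp only [map_add, Derivation.leibniz, smul_eq_mul, c2] at h1 ⊢
  apply two_mul_cancel
  linear_combination h1 - h2 + 2 * b * m * hc

theorem bar_raise_grad (l : Fin 3) : app (barInv D gi η f u ρ b) (fun a => D a f) l
    = ρ * ρ * app gi (fun a => D a f) l
      - 2 * b * (ρ * ρ * pair (fun a => D a f) (app gi fun a => D a f)) * η l := by
  rw [app_barInv S.f_inv, S.app_graphInv_grad, S.f_inv]
  have e : pair (fun a => D a f) (fun i => ρ * ρ * app gi (fun a => D a f) i)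
      = ρ * ρ * pair (fun a => D a f) (app gi fun a => D a f) := by
    simp only [pair, Fin.sum_univ_three]; ring
  rw [e]; ring

theorem two_covV_self (i : Fin 3) :
    2 * pair (app g (covV D Γ η i)) η = D i (pair (app g η) η) := by
  rw [deriv_pair Γ, show cov1 D Γ (app g η) i = app g (covV D Γ η i) from
    funext (S.lc.cov1_app η i), S.lc.pair_lower_comm η]
  ring

/-- The one-form `Hess̄ f(η, ·)`. -/
theorem bar_hess_self (i : Fin 3) : app (hess D (barΓ D g gi Γ η f u ρ b) f) η i
    = ρ * ρ * app g (app (fun l j => covV D Γ η j l) (app gi fun a => D a f)) i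
      - ρ * ρ * pair (app g η) η * (pair (fun a => D a f) (app gi fun a => D a f) * D i b
        - pair (fun a => D a b) (app gi fun a => D a f) * D i f)
      + ρ * ρ * b * pair (fun i => D i (pair (app g η) η)) (app gi fun a => D a f) * D i f := by
  have L := S.lc
  rw [hess_app_of_invariant S.f_inv]
  have h1 : pair (fun a => D a f) (covV D (barΓ D g gi Γ η f u ρ b) η i)
      = pair (app (barMetric D g η f u b) (covV D (barΓ D g gi Γ η f u ρ b) η i))
        (app (barInv D gi η f u ρ b) fun a => D a f) := (S.lc_bar.pair_lower_raise _ _).symm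
  have h2 : pair (app g (covV D Γ η i)) (app gi fun a => D a f)
      = -app g (app (fun l j => covV D Γ η j l) (app gi fun a => D a f)) i := by
    have h := Shear.pair_covV_eq L S.killing (app gi fun a => D a f) i
    rw [show app g (app gi fun a => D a f) = fun a => D a f from funext (L.app_app' _)] at h
    rw [L.pair_lower_raise, h]
  have h3 := S.two_covV_self i
  have hm := S.killing.normSq_invariant L
  have hf := S.f_inv
  have hb := S.b_inv
  rw [h1, show app (barMetric D g η f u b) (covV D (barΓ D g gi Γ η f u ρ b) η i) = _ from
    funext (S.bar_covV i), show app (barInv D gi η f u ρ b) (fun a => D a f) = _ from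
    funext S.bar_raise_grad]
  rw [← neg_eq_iff_eq_neg] at h2
  rw [← h2]
  generalize app g (covV D Γ η i) = P at h3 ⊢
  generalize pair (app g η) η = m at h3 hm ⊢
  have e : pair (fun j => P j + D i (b * m) * D j f - D j (b * m) * D i f)
      (fun l => ρ * ρ * app gi (fun a => D a f) l
        - 2 * b * (ρ * ρ * pair (fun a => D a f) (app gi fun a => D a f)) * η l)
      = ρ * ρ * (pair P (app gi fun a => D a f)
          + D i (b * m) * pair (fun a => D a f) (app gi fun a => D a f)
          - (b * pair (fun a => D a m) (app gi fun a => D a f)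
            + m * pair (fun a => D a b) (app gi fun a => D a f)) * D i f)
        - 2 * b * (ρ * ρ * pair (fun a => D a f) (app gi fun a => D a f))
          * (pair P η + D i (b * m) * pair (fun a => D a f) η
            - (b * pair (fun a => D a m) η + m * pair (fun a => D a b) η) * D i f) := by
    generalize hn : pair (fun a => D a f) (app gi fun a => D a f) = n
    have hn' := hn
    generalize app gi (fun a => D a f) = F at hn hn' ⊢
    subst hn
    simp only [pair, Fin.sum_univ_three, Derivation.leibniz, smul_eq_mul]
    ring
  rw [e, hf, hb, hm]
  simp only [Derivation.leibniz, smul_eq_mul]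
  linear_combination b * ρ * ρ * pair (fun a => D a f) (app gi fun a => D a f) * h3

/-- The vector field `ḡ`-dual to the first two terms of `Q`. -/
theorem app_bar_Q (i : Fin 3) :
    2 * b * app (hess D (barΓ D g gi Γ η f u ρ b) f) η i
      - u * app (kbar D g η f u ui b) (app (barInv D gi η f u ρ b) fun a => D a f) i
    = app (barMetric D g η f u b) (fun l =>
        2 * b * ρ * ρ * app (fun l j => covV D Γ η j l) (app gi fun a => D a f) l
        - 2 * b * ρ * ρ * pair (app g η) η
          * (pair (fun a => D a f) (app gi fun a => D a f) * app gi (fun a => D a b) l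
            - pair (fun a => D a b) (app gi fun a => D a f) * app gi (fun a => D a f) l)
        - ρ * ρ * pair (fun a => D a b) (app gi fun a => D a f) * η l) i := by
  have L := S.lc
  have hηF : pair (app g η) (app gi fun a => D a f) = 0 := by rw [L.pair_lower_raise, S.f_inv]
  have hηB : pair (app g η) (app gi fun a => D a b) = 0 := by rw [L.pair_lower_raise, S.b_inv]
  have hfB := L.pair_app_comm (fun a => D a f) (fun a => D a b)
  have hN := S.grad_app_cov
  have hηN : 2 * pair (app g η) (app (fun l j => covV D Γ η j l) (app gi fun a => D a f))
      = pair (fun i => D i (pair (app g η) η)) (app gi fun a => D a f) := by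
    have e : pair (app g η) (app (fun l j => covV D Γ η j l) (app gi fun a => D a f))
        = ∑ j, app gi (fun a => D a f) j * pair (app g η) (covV D Γ η j) := by
      simp only [pair, app, Fin.sum_univ_three]; ring
    have e2 : pair (fun i => D i (pair (app g η) η)) (app gi fun a => D a f)
        = 2 * ∑ j, app gi (fun a => D a f) j * pair (app g (covV D Γ η j)) η := by
      simp only [← S.two_covV_self]
      generalize app gi (fun a => D a f) = F
      simp only [pair, Fin.sum_univ_three]; ring
    rw [e, e2]
    congr 1
    exact Finset.sum_congr rfl fun j _ => by rw [L.pair_lower_comm]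
  have hk : u * app (kbar D g η f u ui b) (app (barInv D gi η f u ρ b) fun a => D a f) i
      = ρ * ρ * pair (fun a => D a b) (app gi fun a => D a f)
        * app (barMetric D g η f u b) η i := by
    have e : app (kbar D g η f u ui b) (app (barInv D gi η f u ρ b) fun a => D a f) i
        = ui * (D i b * pair (app (barMetric D g η f u b) η)
            (app (barInv D gi η f u ρ b) fun a => D a f)
          + pair (fun a => D a b) (app (barInv D gi η f u ρ b) fun a => D a f)
            * app (barMetric D g η f u b) η i) := by
      rw [show app (kbar D g η f u ui b) (app (barInv D gi η f u ρ b) fun a => D a f) i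
        = ∑ j, kbar D g η f u ui b i j * app (barInv D gi η f u ρ b) (fun a => D a f) j from rfl]
      simp only [kbar]
      generalize app (barMetric D g η f u b) η = E
      simp only [pair, Fin.sum_univ_three]; ring
    have e2 : pair (fun a => D a b) (app (barInv D gi η f u ρ b) fun a => D a f)
        = ρ * ρ * pair (fun a => D a b) (app gi fun a => D a f) := by
      rw [show app (barInv D gi η f u ρ b) (fun a => D a f) = _ from funext S.bar_raise_grad]
      have hb := S.b_inv
      generalize pair (fun a => D a f) (app gi fun a => D a f) = n
      generalize app gi (fun a => D a f) = F
      simp only [pair, Fin.sum_univ_three] at hb ⊢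
      linear_combination (-2 * b * ρ * ρ * n) * hb
    rw [e, S.lc_bar.pair_lower_raise, S.f_inv, e2]
    linear_combination ρ * ρ * pair (fun a => D a b) (app gi fun a => D a f)
        * app (barMetric D g η f u b) η i * S.u_inv
  rw [hk, S.bar_hess_self]
  generalize pair (fun i => D i (pair (app g η) η)) (app gi fun a => D a f) = mF at hηN ⊢
  generalize app (fun l j => covV D Γ η j l) (app gi fun a => D a f) = N at hN hηN ⊢
  have e : ∀ (h : Fin 3 → Fin 3 → A) (c d e n s : A) (B F : Fin 3 → A) (i : Fin 3),
      app h (fun l => c * N l - d * (n * B l - s * F l) - e * η l) i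
      = c * app h N i - d * (n * app h B i - s * app h F i) - e * app h η i := by
    intros; simp only [app, Fin.sum_univ_three]; ring
  have hf : app g (app gi fun a => D a f) = fun a => D a f := funext (L.app_app' _)
  have hb : app g (app gi fun a => D a b) = fun a => D a b := funext (L.app_app' _)
  rw [e]
  simp only [S.app_bar, hN, hηF, hηB, hfB, hf, hb]
  linear_combination (-2 * b * b * ρ * ρ * D i f) * hηN

/-- The vector field of `app_bar_Q`, multiplied by `u r`, cancels the difference between `π(β)` and
its static counterpart `π₀(u² ∇f)`, up to `-2 b` times the divergence free vector field of
`divg_grad_b` and an invariant multiple of `η`. -/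
theorem lapse_mul_Q (l : Fin 3) :
    u * r * (2 * b * ρ * ρ * app (fun l j => covV D Γ η j l) (app gi fun a => D a f) l
        - 2 * b * ρ * ρ * pair (app g η) η
          * (pair (fun a => D a f) (app gi fun a => D a f) * app gi (fun a => D a b) l
            - pair (fun a => D a b) (app gi fun a => D a f) * app gi (fun a => D a f) l)
        - ρ * ρ * pair (fun a => D a b) (app gi fun a => D a f) * η l)
      - app gi (app (sff D g Γ η f u ui ρ b) (shift D gi η f u b)) l
    = -app gi (app (sff0 D Γ f u ρ) fun i => u * u * app gi (fun a => D a f) i) l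
      - 2 * b * (pair (app g η) η * ui * r * app (graphInv D gi f u ρ) (fun a => D a b) l)
      - 2 * u * ρ * pair (fun a => D a b) (app gi fun a => D a f) * η l := by
  have L := S.lc
  have hηF : pair (app g η) (app gi fun a => D a f) = 0 := by rw [L.pair_lower_raise, S.f_inv]
  have e0 : app (sff0 D Γ f u ρ) (shift D gi η f u b)
      = fun i => app (sff0 D Γ f u ρ) (fun i => u * u * app gi (fun a => D a f) i) i
        + 2 * b * (ρ * u * app g (app (fun l j => covV D Γ η j l) (app gi fun a => D a f)) i) := by
    funext i
    have h : app (sff0 D Γ f u ρ) (shift D gi η f u b) i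
        = app (sff0 D Γ f u ρ) (fun i => u * u * app gi (fun a => D a f) i) i
          + 2 * b * app (sff0 D Γ f u ρ) η i := by
      generalize sff0 D Γ f u ρ = p
      simp only [shift, app, Fin.sum_univ_three]; ring
    rw [h, app_sff0 η, S.hess_self, S.f_inv, S.u_inv']; ring
  have e1 : pair (app g η) (shift D gi η f u b) = 2 * b * pair (app g η) η := by
    have : pair (app g η) (shift D gi η f u b)
        = u * u * pair (app g η) (app gi fun a => D a f) + 2 * b * pair (app g η) η := by
      generalize app g η = E
      simp only [shift, pair, Fin.sum_univ_three]; ring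
    rw [this, hηF]; ring
  have e2 : pair (fun a => D a b) (shift D gi η f u b)
      = u * u * pair (fun a => D a b) (app gi fun a => D a f) := by
    have : pair (fun a => D a b) (shift D gi η f u b)
        = u * u * pair (fun a => D a b) (app gi fun a => D a f)
          + 2 * b * pair (fun a => D a b) η := by
      simp only [shift, pair, Fin.sum_univ_three]; ring
    rw [this, S.b_inv]; ring
  have e3 : app gi (app (sff D g Γ η f u ui ρ b) (shift D gi η f u b)) l
      = app gi (app (sff0 D Γ f u ρ) fun i => u * u * app gi (fun a => D a f) i) l
        + 2 * b * ρ * u * app (fun l j => covV D Γ η j l) (app gi fun a => D a f) l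
        + ρ * ui * (2 * b * pair (app g η) η * app gi (fun a => D a b) l
          + u * u * pair (fun a => D a b) (app gi fun a => D a f) * η l) := by
    rw [show app (sff D g Γ η f u ui ρ b) (shift D gi η f u b) = _ from
      funext fun i => app_sff _ i, e0, e1, e2]
    have h1 := L.app_app η l
    have h2 := L.app_app (app (fun l j => covV D Γ η j l) (app gi fun a => D a f)) l
    rw [← h1, ← h2]
    generalize app (sff0 D Γ f u ρ) (fun i => u * u * app gi (fun a => D a f) i) = p
    generalize app (fun l j => covV D Γ η j l) (app gi fun a => D a f) = N
    generalize pair (app g η) η = m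
    generalize app g η = E
    generalize app g N = N'
    generalize pair (fun a => D a b) (app gi fun a => D a f) = s
    simp only [app, Fin.sum_univ_three]; ring
  rw [e3, app_graphInv]
  have h1 := S.r_inv
  have h2 := S.u_inv
  have hR := S.toStatic.rho_sq
  generalize pair (fun a => D a f) (app gi fun a => D a f) = n at hR ⊢
  generalize app (fun l j => covV D Γ η j l) (app gi fun a => D a f) l = N
  generalize app gi (fun a => D a b) l = B
  generalize app gi (fun a => D a f) l = F
  generalize pair (fun a => D a b) (app gi fun a => D a f) = s
  generalize pair (app g η) η = m
  linear_combination (2 * b * u * ρ * N - u * ρ * s * η l + 2 * b * m * B * ui * ρ) * h1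
    + (-ρ * u * s * η l - 2 * b * m * u * r * ρ * ρ * s * F
      + 2 * b * m * B * u * r * ρ * ρ * n) * h2
    - 2 * b * m * B * ui * r * hR

end Axisym

/-! ### The condition on `div k̄`, and the norms of `k̄` and `π` -/

namespace Axisym

variable {g gi : Fin 3 → Fin 3 → A} {Γ : Fin 3 → Fin 3 → Fin 3 → A} {η : Fin 3 → A}
  {f u ui r ρ b : A} (S : Axisym D g gi Γ η f u ui r ρ b)
include S

omit S in
theorem pair_kbar_self (i : Fin 3) : app (kbar D g η f u ui b) η i
    = ui * (D i b * pair (app (barMetric D g η f u b) η) η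
      + pair (fun a => D a b) η * app (barMetric D g η f u b) η i) := by
  rw [show app (kbar D g η f u ui b) η i = ∑ j, kbar D g η f u ui b i j * η j from rfl]
  simp only [kbar]
  generalize app (barMetric D g η f u b) η = E
  simp only [pair, Fin.sum_univ_three]; ring

omit S [Algebra ℝ A] in
theorem pair_add_mul (α β X : Fin 3 → A) (c : A) :
    pair (fun i => α i + c * β i) X = pair α X + c * pair β X := by
  simp only [pair, Fin.sum_univ_three]; ring

theorem bar_normSq_self : pair (app (barMetric D g η f u b) η) η = pair (app g η) η := by
  rw [show app (barMetric D g η f u b) η = _ from funext S.app_bar_self]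
  rw [pair_add_mul, S.f_inv]; ring

/-- The momentum constraint `div k̄(η) = 0` of the deformed metric, as an equation for `b`. -/
theorem divg_grad_b (hk : pair (div2 D (barInv D gi η f u ρ b) (barΓ D g gi Γ η f u ρ b)
      (kbar D g η f u ui b)) η = 0) :
    divg D Γ (fun l => pair (app g η) η * ui * r * app (graphInv D gi f u ρ) (fun a => D a b) l)
      = 0 := by
  have LB := S.lc_bar
  have h1 := LB.two_divg_app (h := kbar D g η f u ui b)
    (fun i j => by simp only [kbar]; ring) η
  have h2 : inner2 (barInv D gi η f u ρ b) (kbar D g η f u ui b) (fun i j =>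
      app (barMetric D g η f u b) (covV D (barΓ D g gi Γ η f u ρ b) η i) j
      + app (barMetric D g η f u b) (covV D (barΓ D g gi Γ η f u ρ b) η j) i) = 0 := by
    have : ∀ i j, app (barMetric D g η f u b) (covV D (barΓ D g gi Γ η f u ρ b) η i) j
      + app (barMetric D g η f u b) (covV D (barΓ D g gi Γ η f u ρ b) η j) i = 0 := fun i j => by
      rw [S.killing_bar.antisymm LB i j]; ring
    simp only [this, inner2, mul_zero, Finset.sum_const_zero]
  rw [hk, h2] at h1
  have h3 : divg D (barΓ D g gi Γ η f u ρ b)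
      (app (barInv D gi η f u ρ b) (app (kbar D g η f u ui b) η)) = 0 :=
    two_mul_cancel (by linear_combination h1)
  have h4 := S.r_mul_divg_bar (app (barInv D gi η f u ρ b) (app (kbar D g η f u ui b) η))
  have hb0 := S.b_inv
  have h5 : ∀ l, r * app (barInv D gi η f u ρ b) (app (kbar D g η f u ui b) η) l
      = pair (app g η) η * ui * r * app (graphInv D gi f u ρ) (fun a => D a b) l
        + (-2 * b * ρ * ρ * pair (app g η) η * ui * r
          * pair (fun a => D a b) (app gi fun a => D a f)) * η l := by
    intro l
    have e1 : app (kbar D g η f u ui b) η = fun i => pair (app g η) η * ui * D i b := by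
      funext i; rw [pair_kbar_self, S.bar_normSq_self, hb0]; ring
    have e2 : ∀ h : Fin 3 → Fin 3 → A, app h (app (kbar D g η f u ui b) η) l
        = pair (app g η) η * ui * app h (fun a => D a b) l := fun h => by
      rw [e1]; simp only [app, Fin.sum_univ_three]; ring
    have e3 : pair (fun a => D a b) (fun i => ρ * ρ * app gi (fun a => D a f) i)
        = ρ * ρ * pair (fun a => D a b) (app gi fun a => D a f) := by
      simp only [pair, Fin.sum_univ_three]; ring
    rw [e2, app_barInv hb0, hb0, S.app_graphInv_grad, e3]; ring
  have hη : divg D Γ (fun l => (-2 * b * ρ * ρ * pair (app g η) η * ui * r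
          * pair (fun a => D a b) (app gi fun a => D a f)) * η l) = 0 := by
    have c2 : pair (fun i => D i (-2 : A)) η = 0 := by
      simpa [pair] using two_invariant (D := D) (η := η)
    have i1 := S.rho_invariant
    exact S.divg_mul_self (invariant_mul (invariant_mul (invariant_mul (invariant_mul
      (invariant_mul (invariant_mul (invariant_mul c2 hb0) i1) i1)
      (S.killing.normSq_invariant S.lc)) S.ui_invariant) S.r_invariant)
      (S.grads_invariant S.f_inv hb0))
  rw [h3, mul_zero] at h4
  simp only [h5] at h4
  rw [divg_add, hη, add_zero] at h4
  exact h4.symm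

omit S in
theorem normSq_grad_b_graph : pair (fun a => D a b) (app (graphInv D gi f u ρ) fun a => D a b)
    = pair (fun a => D a b) (app gi fun a => D a b) - u * u * ρ * ρ
      * (pair (fun a => D a b) (app gi fun a => D a f)
        * pair (fun a => D a b) (app gi fun a => D a f)) := by
  rw [show app (graphInv D gi f u ρ) (fun a => D a b) = _ from funext (app_graphInv _)]
  have e : ∀ s B F : Fin 3 → A, ∀ c : A,
      pair s (fun i => B i - c * F i) = pair s B - c * pair s F := by
    intros; simp only [pair, Fin.sum_univ_three]; ring
  rw [e]; ring

theorem normSq_kbar : normSq (barInv D gi η f u ρ b) (kbar D g η f u ui b)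
    = 2 * ui * ui * pair (app g η) η
      * pair (fun a => D a b) (app (graphInv D gi f u ρ) fun a => D a b) := by
  have LB := S.lc_bar
  have h1 : normSq (barInv D gi η f u ρ b) (kbar D g η f u ui b) = _ :=
    normSq_mul_symmProd (barInv D gi η f u ρ b) (fun i => D i b)
      (app (barMetric D g η f u b) η) ui LB.inv_symm
  have h2 : app (barInv D gi η f u ρ b) (app (barMetric D g η f u b) η) = η :=
    funext (LB.app_app η)
  have h3 : ∀ s B : Fin 3 → A, ∀ c : A,
      pair s (fun i => B i + c * η i) = pair s B + c * pair s η := by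
    intros; simp only [pair, Fin.sum_univ_three]; ring
  rw [h1, h2, S.b_inv, S.bar_normSq_self,
    show app (barInv D gi η f u ρ b) (fun a => D a b) = _ from funext (app_barInv S.b_inv), h3,
    S.b_inv]
  ring

theorem normSq_sff : normSq gi (sff D g Γ η f u ui ρ b) = normSq gi (sff0 D Γ f u ρ)
    + 4 * ρ * ρ * pair (fun a => D a b) (app (fun l j => covV D Γ η j l) (app gi fun a => D a f))
    + 2 * ρ * ρ * ui * ui * pair (app g η) η * pair (fun a => D a b) (app gi fun a => D a b) := by
  have L := S.lc
  have h1 : normSq gi (sff D g Γ η f u ui ρ b) = _ :=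
    normSq_add_mul gi (sff0 D Γ f u ρ) (fun i j => D i b * app g η j + D j b * app g η i)
      (ρ * ui) L.inv_symm
  have h2 := inner2_symmProd gi (sff0 D Γ f u ρ) (fun i => D i b) (app g η) L.inv_symm
    S.toStatic.sff0_symm
  have h3 := normSq_mul_symmProd gi (fun i => D i b) (app g η) 1 L.inv_symm
  have hη : app gi (app g η) = η := funext (L.app_app η)
  simp only [one_mul, mul_one] at h3
  have h4 : bil (sff0 D Γ f u ρ) (app gi fun a => D a b) η
      = ρ * u * pair (fun a => D a b)
        (app (fun l j => covV D Γ η j l) (app gi fun a => D a f)) := by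
    have e : bil (sff0 D Γ f u ρ) (app gi fun a => D a b) η
        = pair (app (sff0 D Γ f u ρ) η) (app gi fun a => D a b) := by
      generalize app gi (fun a => D a b) = B
      simp only [bil, pair, app, Fin.sum_univ_three]; ring
    have e2 : app (sff0 D Γ f u ρ) η = fun i => ρ * u
        * app g (app (fun l j => covV D Γ η j l) (app gi fun a => D a f)) i := by
      funext i; rw [app_sff0, S.hess_self, S.f_inv, S.u_inv']; ring
    have e3 : ∀ X B : Fin 3 → A, pair (fun i => ρ * u * X i) B = ρ * u * pair X B := by
      intros; simp only [pair, Fin.sum_univ_three]; ring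
    rw [e, e2, e3, L.pair_lower_raise]
  rw [h1, h2, h3, hη, h4, S.b_inv]
  linear_combination 4 * ρ * ρ * pair (fun a => D a b)
    (app (fun l j => covV D Γ η j l) (app gi fun a => D a f)) * S.u_inv

end Axisym

/-! ### The scalar curvature of the deformed metric -/

variable (D) in
/-- The vector field `w = v + Ȳ / (u r)`. -/
def shiftUnit (gi : Fin 3 → Fin 3 → A) (η : Fin 3 → A) (f u ui ρ b : A) (i : Fin 3) : A :=
  ui * ρ * shift D gi η f u b i

variable (D) in
/-- The 1-form `Q`. -/
def Qform (g gi : Fin 3 → Fin 3 → A) (Γ : Fin 3 → Fin 3 → Fin 3 → A) (k : Fin 3 → Fin 3 → A)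
    (η : Fin 3 → A) (f u ui r ρ b : A) (i : Fin 3) : A :=
  2 * b * app (hess D (barΓ D g gi Γ η f u ρ b) f) η i
    - u * app (kbar D g η f u ui b) (app (barInv D gi η f u ρ b) fun a => D a f) i
    + (app (fun i j => k i j - sff D g Γ η f u ui ρ b i j) (shiftUnit D gi η f u ui ρ b) i
      + u * D i f * bil (fun i j => k i j - sff D g Γ η f u ui ρ b i j)
        (shiftUnit D gi η f u ui ρ b) (shiftUnit D gi η f u ui ρ b) * r)

namespace Axisym

variable {g gi : Fin 3 → Fin 3 → A} {Γ : Fin 3 → Fin 3 → Fin 3 → A} {η : Fin 3 → A}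
  {f u ui r ρ b : A} (S : Axisym D g gi Γ η f u ui r ρ b)
include S

theorem lapse_mul_shiftUnit (i : Fin 3) :
    u * r * shiftUnit D gi η f u ui ρ b i = shift D gi η f u b i := by
  rw [shiftUnit]
  linear_combination shift D gi η f u b i * (u * ui * S.r_inv + S.u_inv)

/-- The divergence of the vector field `ḡ`-dual to `Q`, weighted with the lapse. -/
theorem divg_Q {k : Fin 3 → Fin 3 → A} (hk : ∀ i j, k i j = k j i) (Kk : Killing D k η)
    (hkη : pair (div2 D gi Γ k) η = 0)
    (hb : pair (div2 D (barInv D gi η f u ρ b) (barΓ D g gi Γ η f u ρ b)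
      (kbar D g η f u ui b)) η = 0) :
    div1 D (barInv D gi η f u ρ b) (barΓ D g gi Γ η f u ρ b)
      (fun i => u * Qform D g gi Γ k η f u ui r ρ b i)
    = ρ * (u * u * pair (div2 D gi Γ k) (app gi fun a => D a f)
        + u * r * inner2 gi k (sff D g Γ η f u ui ρ b)
        - divg D Γ (app gi (app (sff0 D Γ f u ρ) fun i => u * u * app gi (fun a => D a f) i))
        - 2 * pair (app g η) η * ui * r
          * pair (fun a => D a b) (app (graphInv D gi f u ρ) fun a => D a b)) := by
  have L := S.lc
  have LB := S.lc_bar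
  have hβ := S.lapse_mul_shiftUnit
  have hs := S.sff_symm
  have hX := S.app_bar_lin (h := fun i j => k i j - sff D g Γ η f u ui ρ b i j)
    (fun i j => by rw [hk, hs]) hβ
  have hQ := S.app_bar_Q
  have hQ2 := S.lapse_mul_Q
  have hdk := S.divg_app_shift hk
  have hdb := S.divg_grad_b hb
  have ik := S.bil_shift_invariant Kk
  have ip := S.sff_shift_invariant
  have is := S.grads_invariant S.f_inv S.b_inv
  set p := sff D g Γ η f u ui ρ b with hpd
  set w := shiftUnit D gi η f u ui ρ b with hw
  set β := shift D gi η f u b with hβd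
  set F := app gi fun a => D a f with hF
  set X0 : Fin 3 → A := fun l => 2 * b * ρ * ρ * app (fun l j => covV D Γ η j l) F l
        - 2 * b * ρ * ρ * pair (app g η) η
          * (pair (fun a => D a f) F * app gi (fun a => D a b) l - pair (fun a => D a b) F * F l)
        - ρ * ρ * pair (fun a => D a b) F * η l with hX0
  set X1 : Fin 3 → A := fun l => app gi (app (fun i j => k i j - p i j) w) l
        - bil (fun i j => k i j - p i j) w F * (2 * b * η l) with hX1
  set Z : Fin 3 → A := fun l => pair (app g η) η * ui * r
    * app (graphInv D gi f u ρ) (fun a => D a b) l with hZ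
  set p0 := app gi (app (sff0 D Γ f u ρ) fun i => u * u * F i) with hp0
  -- the vector field dual to `u Q`
  have hdual : app (barInv D gi η f u ρ b) (fun i => u * Qform D g gi Γ k η f u ui r ρ b i)
      = fun l => u * (X0 l + X1 l) := by
    have e : (fun i => u * Qform D g gi Γ k η f u ui r ρ b i)
        = app (barMetric D g η f u b) fun l => u * (X0 l + X1 l) := by
      funext i
      have e1 : app (barMetric D g η f u b) (fun l => u * (X0 l + X1 l)) i
          = u * (app (barMetric D g η f u b) X0 i + app (barMetric D g η f u b) X1 i) := by
        simp only [app, Fin.sum_univ_three]; ring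
      rw [e1, hX, ← hQ]
      rfl
    rw [e]; exact funext (LB.app_app _)
  have hvec : ∀ l, r * (u * (X0 l + X1 l)) = app gi (app k β) l - p0 l - 2 * b * Z l
      + ((bil p β F * (2 * b) + -1 * (bil k β F * (2 * b)))
        + -1 * (2 * u * ρ * pair (fun a => D a b) F)) * η l := by
    intro l
    have h1 := hQ2 l
    have h2 : u * r * X1 l = app gi (app k β) l - app gi (app p β) l
        - (bil k β F - bil p β F) * (2 * b * η l) := by
      have e : ∀ h : Fin 3 → Fin 3 → A,
          app gi (app h β) l = u * r * app gi (app h w) l := fun h => by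
        simp only [app, ← hβ, Fin.sum_univ_three]; ring
      have e2 : ∀ h : Fin 3 → Fin 3 → A, bil h β F = u * r * bil h w F := fun h => by
        simp only [bil, ← hβ, Fin.sum_univ_three]; ring
      have e3 : app gi (app (fun i j => k i j - p i j) w) l
          = app gi (app k w) l - app gi (app p w) l := by
        simp only [app, Fin.sum_univ_three]; ring
      have e4 : bil (fun i j => k i j - p i j) w F = bil k w F - bil p w F := by
        simp only [bil, Fin.sum_univ_three]; ring
      rw [e, e, e2, e2, hX1]
      simp only [e3, e4]; ring
    linear_combination h1 + h2
  have i2 := two_invariant (D := D) (η := η)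
  have i1 : pair (fun i => D i (-1 : A)) η = 0 := by simp [pair]
  have hη : divg D Γ (fun l => ((bil p β F * (2 * b) + -1 * (bil k β F * (2 * b)))
        + -1 * (2 * u * ρ * pair (fun a => D a b) F)) * η l) = 0 :=
    S.divg_mul_self (invariant_add (invariant_add (invariant_mul ip (invariant_mul i2 S.b_inv))
      (invariant_mul i1 (invariant_mul ik (invariant_mul i2 S.b_inv))))
      (invariant_mul i1 (invariant_mul (invariant_mul (invariant_mul i2 S.u_inv')
        S.rho_invariant) is)))
  have hbZ : divg D Γ (fun l => 2 * b * Z l) = 2 * pair (app g η) η * ui * r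
      * pair (fun a => D a b) (app (graphInv D gi f u ρ) fun a => D a b) := by
    rw [divg_smul, hdb]
    have c2 : ∀ i, D i (2 : A) = 0 := fun i => Derivation.map_natCast (D i) 2
    simp only [hZ, Derivation.leibniz, smul_eq_mul, c2]
    generalize app (graphInv D gi f u ρ) (fun a => D a b) = B
    generalize pair (app g η) η = m
    simp only [pair, Fin.sum_univ_three]; ring
  have hβk : pair (div2 D gi Γ k) β = u * u * pair (div2 D gi Γ k) F := by
    have : pair (div2 D gi Γ k) β = u * u * pair (div2 D gi Γ k) F
        + 2 * b * pair (div2 D gi Γ k) η := by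
      generalize div2 D gi Γ k = d
      simp only [hβd, shift, pair, Fin.sum_univ_three, ← hF]; ring
    rw [this, hkη]; ring
  have hfin := S.r_mul_divg_bar (fun l => u * (X0 l + X1 l))
  simp only [hvec] at hfin
  rw [divg_add, divg_sub, divg_sub, hη, hbZ, hdk, hβk] at hfin
  rw [LB.div1_eq, hdual]
  linear_combination ρ * hfin - divg D (barΓ D g gi Γ η f u ρ b) (fun l => u * (X0 l + X1 l))
    * S.r_inv

/-- `df(∇_{∇b} η)` for the metric `g + u² df²`. -/
theorem graph_cov_grad_b :
    pair (fun a => D a f) (app (fun l j => covV D (graphΓ D gi Γ f u ρ) η j l)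
      (app (graphInv D gi f u ρ) fun a => D a b))
    = -(ρ * ρ * pair (fun a => D a b)
      (app (fun l j => covV D Γ η j l) (app gi fun a => D a f))) := by
  have L := S.lc
  have LG := S.lc_graph
  have hP : ∀ i j, app (graphMetric D g f u) (covV D (graphΓ D gi Γ f u ρ) η i) j
      = app g (covV D Γ η i) j := fun i j => two_mul_cancel (by
    rw [S.killing_graph.two_covV LG, S.killing.two_covV L, S.app_graphMetric_self])
  have h1 : ∀ (Γ' : Fin 3 → Fin 3 → Fin 3 → A) (Z : Fin 3 → A),
      pair (fun a => D a f) (app (fun l j => covV D Γ' η j l) Z)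
        = ∑ j, Z j * pair (fun a => D a f) (covV D Γ' η j) := fun Γ' Z => by
    simp only [pair, app, Fin.sum_univ_three]; ring
  have h2 : ∀ j, pair (fun a => D a f) (covV D (graphΓ D gi Γ f u ρ) η j)
      = ρ * ρ * pair (fun a => D a f) (covV D Γ η j) := fun j => by
    rw [← LG.pair_lower_raise, show app (graphMetric D g f u)
      (covV D (graphΓ D gi Γ f u ρ) η j) = _ from funext (hP j), S.app_graphInv_grad]
    have e : ∀ X Z : Fin 3 → A, pair X (fun i => ρ * ρ * Z i) = ρ * ρ * pair X Z := by
      intros; simp only [pair, Fin.sum_univ_three]; ring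
    rw [e, L.pair_lower_raise]
  have h3 : ∀ Z : Fin 3 → A, ∑ j, Z j * (ρ * ρ * pair (fun a => D a f) (covV D Γ η j))
      = ρ * ρ * pair (fun a => D a f) (app (fun l j => covV D Γ η j l) Z) := fun Z => by
    rw [h1, Finset.mul_sum]
    exact Finset.sum_congr rfl fun j _ => by ring
  have h4 : pair (fun a => D a f) (app (fun l j => covV D Γ η j l)
      (app (graphInv D gi f u ρ) fun a => D a b))
      = pair (fun a => D a f) (app (fun l j => covV D Γ η j l) (app gi fun a => D a b))
        - u * u * ρ * ρ * pair (fun a => D a b) (app gi fun a => D a f)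
          * pair (fun a => D a f) (app (fun l j => covV D Γ η j l) (app gi fun a => D a f)) := by
    rw [show app (graphInv D gi f u ρ) (fun a => D a b) = _ from funext (app_graphInv _)]
    generalize pair (fun a => D a b) (app gi fun a => D a f) = s
    generalize app gi (fun a => D a f) = F
    generalize app gi (fun a => D a b) = B
    simp only [pair, app, Fin.sum_univ_three]; ring
  have h5 := Shear.pair_cov_comm L S.killing (app gi fun a => D a f) (app gi fun a => D a b)
  rw [show app g (app gi fun a => D a f) = fun a => D a f from funext (L.app_app' _),
    show app g (app gi fun a => D a b) = fun a => D a b from funext (L.app_app' _)] at h5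
  rw [h1]
  simp only [h2]
  rw [h3, h4, S.grad_app_cov, h5]; ring

/-- The scalar curvature formula, before the definitions of `μ` and `J` are inserted: `scal_shear`
over the metric `g + u² df²`, then `scal_graph`, and `divg_Q` for the divergence terms. -/
theorem scal_bar {k : Fin 3 → Fin 3 → A} (hk : ∀ i j, k i j = k j i) (Kk : Killing D k η)
    (hkη : pair (div2 D gi Γ k) η = 0)
    (hb : pair (div2 D (barInv D gi η f u ρ b) (barΓ D g gi Γ η f u ρ b)
      (kbar D g η f u ui b)) η = 0) :
    tr (barInv D gi η f u ρ b) (ric D (barΓ D g gi Γ η f u ρ b))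
      - normSq (barInv D gi η f u ρ b) (kbar D g η f u ui b)
    = tr gi (ric D Γ) - 2 * inner2 gi k (sff D g Γ η f u ui ρ b)
      + normSq gi (sff D g Γ η f u ui ρ b)
      + tr gi (sff D g Γ η f u ui ρ b) * tr gi (sff D g Γ η f u ui ρ b)
      + 2 * pair (fun i => D i (tr gi (sff D g Γ η f u ui ρ b)))
        (fun i => u * ρ * app gi (fun a => D a f) i)
      - 2 * pair (div2 D gi Γ k) (fun i => u * ρ * app gi (fun a => D a f) i)
      + 2 * ui * div1 D (barInv D gi η f u ρ b) (barΓ D g gi Γ η f u ρ b)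
        (fun i => u * Qform D g gi Γ k η f u ui r ρ b i) := by
  have h1 : tr (barInv D gi η f u ρ b) (ric D (barΓ D g gi Γ η f u ρ b)) = _ := S.shear.scal_shear
  have h2 : tr (graphInv D gi f u ρ) (ric D (graphΓ D gi Γ f u ρ)) = _ := S.toStatic.scal_graph
  have h3 := S.divg_Q hk Kk hkη hb
  have htr : tr gi (sff D g Γ η f u ui ρ b) = tr gi (sff0 D Γ f u ρ) := by
    have : tr gi (sff D g Γ η f u ui ρ b) = _ := tr_add_mul_symmProd gi (sff0 D Γ f u ρ)
      (fun i => D i b) (app g η) (ρ * ui) S.lc.inv_symm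
    rw [this, show app gi (app g η) = η from funext (S.lc.app_app η), S.b_inv]; ring
  have e1 : ∀ s B : Fin 3 → A, pair s (fun i => ρ * ρ * B i) = ρ * ρ * pair s B := by
    intros; simp only [pair, Fin.sum_univ_three]; ring
  have e2 : ∀ s B : Fin 3 → A, pair s (fun i => u * ρ * B i) = u * ρ * pair s B := by
    intros; simp only [pair, Fin.sum_univ_three]; ring
  have e3 : divg D Γ (fun l => u * r * app gi (app (sff0 D Γ f u ρ)
      (fun l => u * ρ * app gi (fun a => D a f) l)) l)
      = divg D Γ (app gi (app (sff0 D Γ f u ρ) fun i => u * u * app gi (fun a => D a f) i)) := by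
    congr 1
    funext l
    generalize sff0 D Γ f u ρ = p
    generalize app gi (fun a => D a f) = F
    have : app gi (app p fun i => u * u * F i) l = u * u * app gi (app p F) l := by
      simp only [app, Fin.sum_univ_three]; ring
    have h : app gi (app p fun i => u * ρ * F i) l = u * ρ * app gi (app p F) l := by
      simp only [app, Fin.sum_univ_three]; ring
    rw [this, h]
    linear_combination u * u * app gi (app p F) l * S.r_inv
  rw [e3] at h2
  rw [h1, h2, h3, S.normSq_kbar, S.normSq_sff, htr, S.graph_cov_grad_b, S.app_graphInv_grad,
    S.app_graphMetric_self, normSq_grad_b_graph]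
  simp only [e1, e2]
  have hu := S.u_inv
  have hr := S.r_inv
  have hR := S.toStatic.rho_sq
  generalize pair (div2 D gi Γ k) (app gi fun a => D a f) = d
  generalize inner2 gi k (sff D g Γ η f u ui ρ b) = I
  generalize pair (app g η) η = m
  generalize pair (fun a => D a f) (app gi fun a => D a f) = n at hR ⊢
  generalize pair (fun a => D a b) (app gi fun a => D a f) = s
  generalize pair (fun a => D a b) (app gi fun a => D a b) = q
  linear_combination (-2 * I * u * ui + 4 * ui * ui * m * (q - u * u * ρ * ρ * (s * s))) * hr
    + (-2 * I - 2 * u * ρ * d + 2 * m * (u * ui + 1)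
      * (ρ * ρ * n * (q - u * u * ρ * ρ * (s * s)) - ρ * ρ * ρ * ρ * s * s)) * hu
    - 2 * m * ui * ui * (q - u * u * ρ * ρ * (s * s)) * hR

end Axisym

end DerivCalc

/-! ### Germs of smooth functions -/

/-- The germs at `y` of functions that are smooth at `y`. -/
def smoothGerms (y : E3) : Subring (Germ (𝓝 y) ℝ) where
  carrier := {φ | ∃ F : E3 → ℝ, ContDiffAt ℝ ∞ F y ∧ φ = (F : Germ (𝓝 y) ℝ)}
  zero_mem' := ⟨0, contDiffAt_const, rfl⟩
  one_mem' := ⟨1, contDiffAt_const, rfl⟩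
  add_mem' := by
    rintro _ _ ⟨F, hF, rfl⟩ ⟨G, hG, rfl⟩
    exact ⟨F + G, hF.add hG, rfl⟩
  mul_mem' := by
    rintro _ _ ⟨F, hF, rfl⟩ ⟨G, hG, rfl⟩
    exact ⟨F * G, hF.mul hG, rfl⟩
  neg_mem' := by
    rintro _ ⟨F, hF, rfl⟩
    exact ⟨-F, hF.neg, rfl⟩

namespace SmoothGerm

open Coord

variable {y : E3}

/-- The function `F` represents the germ `a`. -/
def Rep (a : smoothGerms y) (F : E3 → ℝ) : Prop := (a : Germ (𝓝 y) ℝ) = (F : Germ (𝓝 y) ℝ)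

theorem exists_rep {F : E3 → ℝ} (hF : ContDiffAt ℝ ∞ F y) : ∃ a : smoothGerms y, Rep a F :=
  ⟨⟨F, F, hF, rfl⟩, rfl⟩

theorem exists_rep' (a : smoothGerms y) : ∃ F, Rep a F ∧ ContDiffAt ℝ ∞ F y := by
  obtain ⟨_, F, hF, rfl⟩ := a
  exact ⟨F, rfl, hF⟩

theorem Rep.iff_eventuallyEq {a c : smoothGerms y} {F G : E3 → ℝ} (ha : Rep a F) (hc : Rep c G) :
    a = c ↔ F =ᶠ[𝓝 y] G := by
  rw [Subtype.ext_iff, ha, hc, Germ.coe_eq]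

theorem Rep.congr {a : smoothGerms y} {F G : E3 → ℝ} (ha : Rep a F) (h : F =ᶠ[𝓝 y] G) :
    Rep a G := ha.trans (Germ.coe_eq.2 h)

theorem Rep.eventuallyEq {a : smoothGerms y} {F G : E3 → ℝ} (ha : Rep a F) (hc : Rep a G) :
    F =ᶠ[𝓝 y] G := (ha.iff_eventuallyEq hc).1 rfl

theorem Rep.eq_at {a : smoothGerms y} {F G : E3 → ℝ} (ha : Rep a F) (hc : Rep a G) :
    F y = G y := (ha.eventuallyEq hc).eq_of_nhds

theorem Rep.contDiffAt {a : smoothGerms y} {F : E3 → ℝ} (ha : Rep a F) : ContDiffAt ℝ ∞ F y := by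
  obtain ⟨G, hG, hG'⟩ := exists_rep' a
  exact hG'.congr_of_eventuallyEq (ha.eventuallyEq hG)

theorem Rep.add {a c : smoothGerms y} {F G : E3 → ℝ} (ha : Rep a F) (hc : Rep c G) :
    Rep (a + c) (fun z => F z + G z) := by
  show (a : Germ (𝓝 y) ℝ) + (c : Germ (𝓝 y) ℝ) = _
  rw [ha, hc]; rfl

theorem Rep.mul {a c : smoothGerms y} {F G : E3 → ℝ} (ha : Rep a F) (hc : Rep c G) :
    Rep (a * c) (fun z => F z * G z) := by
  show (a : Germ (𝓝 y) ℝ) * (c : Germ (𝓝 y) ℝ) = _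
  rw [ha, hc]; rfl

theorem Rep.sub {a c : smoothGerms y} {F G : E3 → ℝ} (ha : Rep a F) (hc : Rep c G) :
    Rep (a - c) (fun z => F z - G z) := by
  show (a : Germ (𝓝 y) ℝ) - (c : Germ (𝓝 y) ℝ) = _
  rw [ha, hc]; rfl

theorem rep_zero : Rep (0 : smoothGerms y) (fun _ => 0) := rfl

theorem rep_one : Rep (1 : smoothGerms y) (fun _ => 1) := rfl

theorem Rep.sum {ι : Type*} (s : Finset ι) {a : ι → smoothGerms y} {F : ι → E3 → ℝ}
    (h : ∀ i, Rep (a i) (F i)) : Rep (∑ i ∈ s, a i) (fun z => ∑ i ∈ s, F i z) := by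
  classical
  induction s using Finset.induction_on with
  | empty => simpa using rep_zero
  | insert i s hi ih => simpa only [Finset.sum_insert hi] using (h i).add ih

/-- The constant germs. -/
def const (y : E3) : ℝ →+* smoothGerms y where
  toFun c := ⟨((fun _ => c : E3 → ℝ) : Germ (𝓝 y) ℝ), _, contDiffAt_const, rfl⟩
  map_one' := rfl
  map_zero' := rfl
  map_add' _ _ := rfl
  map_mul' _ _ := rfl

instance : Algebra ℝ (smoothGerms y) := (const y).toAlgebra

theorem rep_const (c : ℝ) : Rep (algebraMap ℝ (smoothGerms y) c) (fun _ => c) := rfl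

theorem rep_two : Rep (2 : smoothGerms y) (fun _ => 2) :=
  (map_ofNat (algebraMap ℝ (smoothGerms y)) 2) ▸ rep_const 2

theorem Rep.inv {a : smoothGerms y} {F : E3 → ℝ} (ha : Rep a F) (h : F y ≠ 0) :
    ∃ c : smoothGerms y, Rep c (fun z => (F z)⁻¹) ∧ a * c = 1 := by
  obtain ⟨c, hc⟩ := exists_rep (ha.contDiffAt.inv h)
  refine ⟨c, hc, ((ha.mul hc).iff_eventuallyEq rep_one).2 ?_⟩
  filter_upwards [ha.contDiffAt.continuousAt.eventually_ne h] with z hz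
  exact mul_inv_cancel₀ hz

theorem Rep.sqrt {a : smoothGerms y} {F : E3 → ℝ} (ha : Rep a F) (h : 0 < F y) :
    ∃ c : smoothGerms y, Rep c (fun z => Real.sqrt (F z)) ∧ c * c = a := by
  obtain ⟨c, hc⟩ := exists_rep (ha.contDiffAt.sqrt h.ne')
  refine ⟨c, hc, ((hc.mul hc).iff_eventuallyEq ha).2 ?_⟩
  filter_upwards [ha.contDiffAt.continuousAt.eventually (lt_mem_nhds h)] with z hz
  exact Real.mul_self_sqrt hz.le

theorem contDiffAt_pd {F : E3 → ℝ} (hF : ContDiffAt ℝ ∞ F y) (i : Fin 3) :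
    ContDiffAt ℝ ∞ (pd i F) y :=
  have h : ContDiffAt ℝ ∞ (fderiv ℝ F) y := hF.fderiv_right le_rfl
  h.clm_apply contDiffAt_const

theorem eventually_differentiableAt {F : E3 → ℝ} (hF : ContDiffAt ℝ ∞ F y) :
    ∀ᶠ z in 𝓝 y, DifferentiableAt ℝ F z := by
  filter_upwards [(hF.of_le (m := 1) ENat.LEInfty.out).eventually (by simp)] with z hz
  exact hz.differentiableAt (by simp)

theorem eventuallyEq_pd {F G : E3 → ℝ} (h : F =ᶠ[𝓝 y] G) (i : Fin 3) :
    pd i F =ᶠ[𝓝 y] pd i G := by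
  filter_upwards [h.fderiv (𝕜 := ℝ)] with z hz
  rw [pd, pd, hz]

/-- The germ of the partial derivative. -/
def derivFun (i : Fin 3) (a : smoothGerms y) : smoothGerms y :=
  ⟨(pd i (exists_rep' a).choose : E3 → ℝ), _, contDiffAt_pd (exists_rep' a).choose_spec.2 i, rfl⟩

theorem Rep.derivFun {a : smoothGerms y} {F : E3 → ℝ} (ha : Rep a F) (i : Fin 3) :
    Rep (derivFun i a) (pd i F) :=
  Germ.coe_eq.2 (eventuallyEq_pd ((exists_rep' a).choose_spec.1.eventuallyEq ha) i)

/-- The partial derivatives, as derivations of the ring of germs. -/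
def deriv (y : E3) (i : Fin 3) : Derivation ℝ (smoothGerms y) (smoothGerms y) :=
  have mul : ∀ a c : smoothGerms y, derivFun i (a * c) = a * derivFun i c + c * derivFun i a := by
    intro a c
    obtain ⟨F, ha, hF⟩ := exists_rep' a
    obtain ⟨G, hc, hG⟩ := exists_rep' c
    refine (((ha.mul hc).derivFun i).iff_eventuallyEq
      ((ha.mul (hc.derivFun i)).add (hc.mul (ha.derivFun i)))).2 ?_
    filter_upwards [eventually_differentiableAt hF, eventually_differentiableAt hG] with z h1 h2
    simp [pd, fderiv_fun_mul h1 h2]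
  Derivation.mk'
    { toFun := derivFun i
      map_add' := fun a c => by
        obtain ⟨F, ha, hF⟩ := exists_rep' a
        obtain ⟨G, hc, hG⟩ := exists_rep' c
        refine (((ha.add hc).derivFun i).iff_eventuallyEq
          ((ha.derivFun i).add (hc.derivFun i))).2 ?_
        filter_upwards [eventually_differentiableAt hF, eventually_differentiableAt hG] with z h1 h2
        simp [pd, fderiv_fun_add h1 h2]
      map_smul' := fun c a => by
        have h0 : derivFun i (algebraMap ℝ (smoothGerms y) c) = 0 := by
          refine (((rep_const c).derivFun i).iff_eventuallyEq rep_zero).2 (.of_forall fun z => ?_)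
          simp [pd]
        rw [Algebra.smul_def, mul, h0, mul_zero, add_zero, RingHom.id_apply, Algebra.smul_def] }
    mul

theorem Rep.deriv {a : smoothGerms y} {F : E3 → ℝ} (ha : Rep a F) (i : Fin 3) :
    Rep (deriv y i a) (pd i F) := ha.derivFun i

theorem deriv_comm (i j : Fin 3) (a : smoothGerms y) :
    deriv y i (deriv y j a) = deriv y j (deriv y i a) := by
  obtain ⟨F, ha, hF⟩ := exists_rep' a
  refine (((ha.deriv j).deriv i).iff_eventuallyEq ((ha.deriv i).deriv j)).2 ?_
  filter_upwards [(hF.of_le (m := 2) ENat.LEInfty.out).eventually (by simp)] with z hz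
  have h : DifferentiableAt ℝ (fderiv ℝ F) z :=
    (hz.fderiv_right (m := 1) (by norm_num)).differentiableAt (by simp)
  have hs := (hz.isSymmSndFDerivAt (by simp)) (EuclideanSpace.single i 1)
    (EuclideanSpace.single j 1)
  have e : ∀ i j : Fin 3, pd i (pd j F) z
      = fderiv ℝ (fderiv ℝ F) z (EuclideanSpace.single i 1) (EuclideanSpace.single j 1) := by
    intro i j
    show fderiv ℝ (fun z => fderiv ℝ F z (EuclideanSpace.single j 1)) z _ = _
    rw [fderiv_clm_apply h (differentiableAt_const _)]
    simp
  rw [e, e, hs]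

end SmoothGerm

/-! ### Matrices and Christoffel symbols of germs -/

namespace DerivCalc

variable {A : Type*} [CommRing A] [Algebra ℝ A] (D : Fin 3 → Derivation ℝ A A)

/-- The Christoffel symbols of the metric `g` with inverse `gi`. -/
def christoffel (g gi : Fin 3 → Fin 3 → A) (l i j : Fin 3) : A :=
  algebraMap ℝ A (1 / 2) * ∑ m, gi l m * (D i (g m j) + D j (g m i) - D m (g i j))

variable {D}

/-- The Koszul formula. -/
theorem leviCivita_christoffel {g gi : Fin 3 → Fin 3 → A} (symm : ∀ i j, g i j = g j i)
    (inv_symm : ∀ i j, gi i j = gi j i)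
    (inv : ∀ i j, ∑ l, gi i l * g l j = if i = j then 1 else 0) :
    LeviCivita D g gi (christoffel D g gi) where
  symm := symm
  inv_symm := inv_symm
  inv := inv
  torsion l i j := by simp only [christoffel, symm i j, add_comm]
  compat i j k := by
    have h2 : 2 * algebraMap ℝ A (1 / 2) = 1 := by
      rw [← map_ofNat (algebraMap ℝ A) 2, ← map_mul]; norm_num
    have low : ∀ i j k, ∑ l, christoffel D g gi l i j * g l k
        = algebraMap ℝ A (1 / 2) * (D i (g k j) + D j (g k i) - D k (g i j)) := by
      intro i j k
      have e : ∑ l, christoffel D g gi l i j * g l k = algebraMap ℝ A (1 / 2) *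
          ∑ m, (∑ l, gi m l * g l k) * (D i (g m j) + D j (g m i) - D m (g i j)) := by
        simp only [christoffel, Fin.sum_univ_three, inv_symm 1 0, inv_symm 2 0, inv_symm 2 1]; ring
      rw [e]; simp [inv]
    have e : ∀ l, christoffel D g gi l i k * g j l = christoffel D g gi l i k * g l j := fun l => by
      rw [symm j l]
    simp only [e, Finset.sum_add_distrib, low]
    rw [symm k j, symm k i, symm i j]
    linear_combination -D i (g j k) * h2

end DerivCalc

namespace SmoothGerm

open Coord

variable {y : E3}

/-- The inverse of a matrix of germs is represented by the inverse matrices. -/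
theorem rep_inv {g gi : Fin 3 → Fin 3 → smoothGerms y} {G : E3 → Matrix (Fin 3) (Fin 3) ℝ}
    (hg : ∀ i j, Rep (g i j) fun z => G z i j)
    (inv : ∀ i j, ∑ l, gi i l * g l j = if i = j then 1 else 0) (i j : Fin 3) :
    Rep (gi i j) fun z => (G z)⁻¹ i j := by
  choose B hB _ using fun i j => exists_rep' (gi i j)
  refine (hB i j).congr ?_
  have h : ∀ i j, ∀ᶠ z in 𝓝 y, ∑ l, B i l z * G z l j = if i = j then 1 else 0 := fun i j => by
    have h0 : Rep (if i = j then (1 : smoothGerms y) else 0) fun _ => if i = j then 1 else 0 := by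
      split_ifs
      exacts [rep_one, rep_zero]
    rw [← inv i j] at h0
    exact (Rep.sum _ fun l => (hB i l).mul (hg l j)).eventuallyEq h0
  filter_upwards [eventually_all.2 fun i => eventually_all.2 fun j => h i j] with z hz
  have : (Matrix.of fun i j => B i j z) * G z = 1 := by
    ext i j; simpa [Matrix.mul_apply, Matrix.one_apply] using hz i j
  rw [Matrix.inv_eq_left_inv this]; rfl

theorem rep_det {g : Fin 3 → Fin 3 → smoothGerms y} {G : E3 → Matrix (Fin 3) (Fin 3) ℝ}
    (hg : ∀ i j, Rep (g i j) fun z => G z i j) : ∃ d : smoothGerms y, Rep d fun z => (G z).det := by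
  simp only [Matrix.det_fin_three]
  exact ⟨_, ((((((((hg _ _).mul (hg _ _)).mul (hg _ _)).sub (((hg _ _).mul (hg _ _)).mul
    (hg _ _))).sub (((hg _ _).mul (hg _ _)).mul (hg _ _))).add (((hg _ _).mul (hg _ _)).mul
    (hg _ _))).add (((hg _ _).mul (hg _ _)).mul (hg _ _))).sub
    (((hg _ _).mul (hg _ _)).mul (hg _ _)))⟩

theorem exists_inv {g : Fin 3 → Fin 3 → smoothGerms y} {G : E3 → Matrix (Fin 3) (Fin 3) ℝ}
    (hg : ∀ i j, Rep (g i j) fun z => G z i j) (h : (G y).det ≠ 0) :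
    ∃ gi : Fin 3 → Fin 3 → smoothGerms y,
      ∀ i j, ∑ l, gi i l * g l j = if i = j then 1 else 0 := by
  obtain ⟨d, hd⟩ := rep_det hg
  obtain ⟨di, hdi, hdd⟩ := hd.inv h
  have hadj : ∀ i j, ∃ a : smoothGerms y, Rep a fun z => (G z).adjugate i j := fun i j => by
    simp only [Matrix.adjugate_apply]
    refine rep_det (g := fun a b => if a = j then (if b = i then 1 else 0) else g a b)
      (G := fun z => (G z).updateRow j (Pi.single i 1)) fun a b => ?_
    simp only [Matrix.updateRow_apply, Pi.single_apply]
    split_ifs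
    exacts [rep_one, rep_zero, hg a b]
  choose adj hadj using hadj
  refine ⟨fun i j => di * adj i j, fun i j => ?_⟩
  have h0 : Rep (if i = j then (1 : smoothGerms y) else 0) fun _ => if i = j then 1 else 0 := by
    split_ifs
    exacts [rep_one, rep_zero]
  refine ((Rep.sum _ fun l => (hdi.mul (hadj i l)).mul (hg l j)).iff_eventuallyEq h0).2 ?_
  filter_upwards [hd.contDiffAt.continuousAt.eventually_ne h] with z hz
  have e := congrFun (congrFun ((G z).adjugate_mul) i) j
  simp only [Matrix.mul_apply, Matrix.smul_apply, Matrix.one_apply, smul_eq_mul] at e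
  simp only [mul_assoc, ← Finset.mul_sum, e]
  rw [inv_mul_cancel_left₀ hz]

/-! ### The tensor calculus of germs represents that of functions -/

section Calculus

variable {g gi h : Fin 3 → Fin 3 → smoothGerms y} {Γ : Fin 3 → Fin 3 → Fin 3 → smoothGerms y}
  {α X : Fin 3 → smoothGerms y} {f : smoothGerms y}
  {G H : E3 → Matrix (Fin 3) (Fin 3) ℝ} {α' X' : E3 → Fin 3 → ℝ} {F : E3 → ℝ}

theorem rep_pair (hα : ∀ i, Rep (α i) fun z => α' z i) (hX : ∀ i, Rep (X i) fun z => X' z i) :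
    Rep (DerivCalc.pair α X) fun z => ∑ i, α' z i * X' z i :=
  Rep.sum _ fun i => (hα i).mul (hX i)

theorem rep_app (hh : ∀ i j, Rep (h i j) fun z => H z i j) (hX : ∀ i, Rep (X i) fun z => X' z i)
    (i : Fin 3) : Rep (DerivCalc.app h X i) fun z => ∑ j, H z i j * X' z j :=
  Rep.sum _ fun j => (hh i j).mul (hX j)

theorem rep_lie0 (hX : ∀ i, Rep (X i) fun z => X' z i) (hf : Rep f F) :
    Rep (DerivCalc.pair (fun i => deriv y i f) X) (lie0 X' F) := by
  have h := Rep.sum Finset.univ fun i => (hX i).mul (hf.deriv i)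
  rw [show DerivCalc.pair (fun i => deriv y i f) X = ∑ i, X i * deriv y i f from
    Finset.sum_congr rfl fun i _ => mul_comm _ _]
  exact h

theorem rep_lie1 (hX : ∀ i, Rep (X i) fun z => X' z i) (hα : ∀ i, Rep (α i) fun z => α' z i)
    (i : Fin 3) : Rep (∑ l, (X l * deriv y l (α i) + α l * deriv y i (X l)))
      fun z => lie1 X' α' z i :=
  Rep.sum _ fun l => ((hX l).mul ((hα i).deriv l)).add ((hα l).mul ((hX l).deriv i))

theorem rep_lie2 (hX : ∀ i, Rep (X i) fun z => X' z i) (hh : ∀ i j, Rep (h i j) fun z => H z i j)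
    (i j : Fin 3) : Rep (∑ l, (X l * deriv y l (h i j) + h l j * deriv y i (X l)
      + h i l * deriv y j (X l))) fun z => lie2 X' H z i j :=
  Rep.sum _ fun l => (((hX l).mul ((hh i j).deriv l)).add ((hh l j).mul ((hX l).deriv i))).add
    ((hh i l).mul ((hX l).deriv j))

theorem rep_tr (hgi : ∀ i j, Rep (gi i j) fun z => (G z)⁻¹ i j)
    (hh : ∀ i j, Rep (h i j) fun z => H z i j) : Rep (DerivCalc.tr gi h) (Coord.tr G H) :=
  Rep.sum _ fun i => Rep.sum _ fun j => (hgi i j).mul (hh i j)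

theorem rep_normSq (hgi : ∀ i j, Rep (gi i j) fun z => (G z)⁻¹ i j)
    (hh : ∀ i j, Rep (h i j) fun z => H z i j) :
    Rep (DerivCalc.normSq gi h) (Coord.normSq G H) :=
  Rep.sum _ fun i => Rep.sum _ fun j => Rep.sum _ fun a => Rep.sum _ fun b =>
    (((hgi i a).mul (hgi j b)).mul (hh i j)).mul (hh a b)

theorem rep_christoffel (L : DerivCalc.LeviCivita (deriv y) g gi Γ)
    (hg : ∀ i j, Rep (g i j) fun z => G z i j) (l i j : Fin 3) :
    Rep (Γ l i j) (Coord.christoffel G l i j) := by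
  rw [L.unique (DerivCalc.leviCivita_christoffel L.symm L.inv_symm L.inv)]
  exact (rep_const _).mul (Rep.sum _ fun m => (rep_inv hg L.inv l m).mul
    ((((hg m j).deriv i).add ((hg m i).deriv j)).sub ((hg i j).deriv m)))

theorem rep_ric (L : DerivCalc.LeviCivita (deriv y) g gi Γ)
    (hg : ∀ i j, Rep (g i j) fun z => G z i j) (i j : Fin 3) :
    Rep (DerivCalc.ric (deriv y) Γ i j) (Coord.ricci G i j) := by
  have hΓ := rep_christoffel L hg
  exact Rep.sum _ fun l => (((hΓ l i j).deriv l).sub ((hΓ l i l).deriv j)).add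
    (Rep.sum _ fun m => ((hΓ l l m).mul (hΓ m i j)).sub ((hΓ l j m).mul (hΓ m i l)))

theorem rep_scal (L : DerivCalc.LeviCivita (deriv y) g gi Γ)
    (hg : ∀ i j, Rep (g i j) fun z => G z i j) :
    Rep (DerivCalc.tr gi (DerivCalc.ric (deriv y) Γ)) (Coord.scal G) :=
  Rep.sum _ fun i => Rep.sum _ fun j => (rep_inv hg L.inv i j).mul (rep_ric L hg i j)

theorem rep_cov1 (L : DerivCalc.LeviCivita (deriv y) g gi Γ)
    (hg : ∀ i j, Rep (g i j) fun z => G z i j) (hα : ∀ i, Rep (α i) fun z => α' z i)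
    (i j : Fin 3) : Rep (DerivCalc.cov1 (deriv y) Γ α i j) (Coord.cov1 G α' i j) :=
  ((hα j).deriv i).sub (Rep.sum _ fun l => (rep_christoffel L hg l i j).mul (hα l))

theorem rep_cov2 (L : DerivCalc.LeviCivita (deriv y) g gi Γ)
    (hg : ∀ i j, Rep (g i j) fun z => G z i j) (hh : ∀ i j, Rep (h i j) fun z => H z i j)
    (l i j : Fin 3) : Rep (DerivCalc.cov2 (deriv y) Γ h l i j) (Coord.cov2 G H l i j) := by
  have hΓ := rep_christoffel L hg
  exact ((hh i j).deriv l).sub (Rep.sum _ fun m =>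
    ((hΓ m l i).mul (hh m j)).add ((hΓ m l j).mul (hh i m)))

theorem rep_hess (L : DerivCalc.LeviCivita (deriv y) g gi Γ)
    (hg : ∀ i j, Rep (g i j) fun z => G z i j) (hf : Rep f F) (i j : Fin 3) :
    Rep (DerivCalc.hess (deriv y) Γ f i j) (Coord.hess G F i j) :=
  rep_cov1 L hg (fun a => hf.deriv a) i j

theorem rep_div1 (L : DerivCalc.LeviCivita (deriv y) g gi Γ)
    (hg : ∀ i j, Rep (g i j) fun z => G z i j) (hα : ∀ i, Rep (α i) fun z => α' z i) :
    Rep (DerivCalc.div1 (deriv y) gi Γ α) (Coord.div1 G α') :=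
  Rep.sum _ fun i => Rep.sum _ fun j => (rep_inv hg L.inv i j).mul (rep_cov1 L hg hα i j)

theorem rep_div2 (L : DerivCalc.LeviCivita (deriv y) g gi Γ)
    (hg : ∀ i j, Rep (g i j) fun z => G z i j) (hh : ∀ i j, Rep (h i j) fun z => H z i j)
    (j : Fin 3) : Rep (DerivCalc.div2 (deriv y) gi Γ h j) fun z => Coord.div2 G H z j :=
  Rep.sum _ fun i => Rep.sum _ fun l => (rep_inv hg L.inv i l).mul (rep_cov2 L hg hh l i j)

end Calculus

end SmoothGerm

/-! ### The axially symmetric deformation in a chart -/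

namespace DerivCalc

variable {A : Type*} [CommRing A] [Algebra ℝ A] {D : Fin 3 → Derivation ℝ A A}
  {g gbar gi : Fin 3 → Fin 3 → A} {Γ : Fin 3 → Fin 3 → Fin 3 → A} {η Y : Fin 3 → A} {f u φ b : A}

/-- The 1-form `Y`, expressed through the Killing field. -/
theorem shift_form_eq (hf : pair (fun i => D i f) η = 0)
    (hg : ∀ i j, gbar i j = g i j + D i f * Y j + D j f * Y i + φ * D i f * D j f)
    (hY : ∀ i, Y i = ∑ j, gbar i j * (2 * b * η j)) (i : Fin 3) :
    Y i = 2 * b * (app g η i + 2 * b * pair (app g η) η * D i f) := by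
  have h1 : ∀ i, Y i = 2 * b * (app g η i + pair Y η * D i f) := fun i => by
    have e : ∑ j, gbar i j * (2 * b * η j) = 2 * b * (app g η i + pair Y η * D i f
        + (Y i + φ * D i f) * pair (fun i => D i f) η) := by
      simp only [hg, app, pair, Fin.sum_univ_three]; ring
    rw [hY, e, hf]; ring
  have h2 : pair Y η = 2 * b * pair (app g η) η := by
    have e : pair (fun i => 2 * b * (app g η i + pair Y η * D i f)) η
        = 2 * b * (pair (app g η) η + pair Y η * pair (fun i => D i f) η) := by
      generalize pair Y η = y
      generalize app g η = E
      simp only [pair, Fin.sum_univ_three]; ring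
    rw [← funext h1, hf] at e
    rw [e]; ring
  rw [h1, h2]

theorem lapse_eq (hf : pair (fun i => D i f) η = 0)
    (hY : ∀ i, Y i = 2 * b * (app g η i + 2 * b * pair (app g η) η * D i f))
    (hu : u * u = φ + ∑ i, Y i * (2 * b * η i)) :
    φ = u * u - 4 * b * b * pair (app g η) η := by
  have e : ∑ i, Y i * (2 * b * η i) = 4 * b * b * (pair (app g η) η
      + 2 * b * pair (app g η) η * pair (fun i => D i f) η) := by
    simp only [hY]
    generalize app g η = E
    simp only [pair, Fin.sum_univ_three]; ring
  rw [hu, e, hf]; ring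

/-- If the 1-form `Y` dual to `2 b η` is invariant, then so is `b` where `η` does not vanish. -/
theorem normSq_mul_invariant (L : LeviCivita D g gi Γ) (hc : ∀ i j a, D i (D j a) = D j (D i a))
    (K : Killing D g η) (hf : pair (fun i => D i f) η = 0)
    (hY : ∀ i, Y i = 2 * b * (app g η i + 2 * b * pair (app g η) η * D i f))
    (hlie : ∀ i, ∑ l, (η l * D l (Y i) + Y l * D i (η l)) = 0) :
    pair (app g η) η * pair (fun i => D i b) η = 0 := by
  have hm := K.normSq_invariant L
  have hE := K.lie_app
  have hF := lie_grad hc hf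
  have c2 : ∀ i, D i (2 : A) = 0 := fun i => Derivation.map_natCast (D i) 2
  have e : ∀ i, 2 * pair (fun i => D i b) η * app g η i
      + 8 * b * pair (fun i => D i b) η * pair (app g η) η * D i f = 0 := fun i => by
    have h := hlie i
    have hEi := hE i
    have hFi := hF i
    simp only [hY] at h
    generalize app g η = E at h hEi hm ⊢
    have hm' := hm
    generalize pair E η = m at h hm' ⊢
    simp only [pair, Fin.sum_univ_three, Derivation.leibniz, smul_eq_mul, map_add, c2]
      at h hEi hFi hm' ⊢
    linear_combination h - 2 * b * hEi - 4 * b * b * m * hFi - 4 * b * b * D i f * hm'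
  have e2 : 2 * pair (fun i => D i b) η * pair (app g η) η
      + 8 * b * pair (fun i => D i b) η * pair (app g η) η * pair (fun i => D i f) η
      = ∑ i, (2 * pair (fun i => D i b) η * app g η i
      + 8 * b * pair (fun i => D i b) η * pair (app g η) η * D i f) * η i := by
    generalize pair (fun i => D i b) η = s
    generalize app g η = E
    generalize hm : pair E η = m
    rw [show pair E η = ∑ i, E i * η i from rfl] at hm
    rw [← hm]
    simp only [pair, Fin.sum_univ_three]; ring
  simp only [e, zero_mul, Finset.sum_const_zero, hf] at e2
  apply two_mul_cancel
  linear_combination e2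

theorem lapse_invariant (hu : φ = u * u - 4 * b * b * pair (app g η) η)
    (hφ : pair (fun i => D i φ) η = 0) (hb : pair (fun i => D i b) η = 0)
    (hm : pair (fun i => D i (pair (app g η) η)) η = 0) {ui : A} (hui : u * ui = 1) :
    pair (fun i => D i u) η = 0 := by
  have c4 : ∀ i, D i (4 : A) = 0 := fun i => Derivation.map_natCast (D i) 4
  rw [hu] at hφ
  generalize pair (app g η) η = m at hφ hm
  simp only [pair, Fin.sum_univ_three, Derivation.leibniz, smul_eq_mul, map_sub, c4]
    at hφ hb hm ⊢
  apply two_mul_cancel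
  linear_combination ui * hφ + ui * 8 * b * m * hb + 4 * ui * b * b * hm
    - 2 * (D 0 u * η 0 + D 1 u * η 1 + D 2 u * η 2) * hui

omit [Algebra ℝ A] in
theorem inv_symm_of_symm (hg : ∀ i j, g i j = g j i)
    (h : ∀ i j, ∑ l, gi i l * g l j = if i = j then 1 else 0) (i j : Fin 3) :
    gi i j = gi j i := by
  have h1 : Matrix.of gi * Matrix.of g = 1 := by
    ext i j; simpa [Matrix.mul_apply, Matrix.one_apply] using h i j
  have h2 : (Matrix.of g).transpose = Matrix.of g := by ext i j; exact hg j i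
  have h3 : Matrix.of g * (Matrix.of gi).transpose = 1 := by
    rw [← h2, ← Matrix.transpose_mul, h1, Matrix.transpose_one]
  have h4 : Matrix.of gi = (Matrix.of gi).transpose := left_inv_eq_right_inv h1 h3
  exact congrFun (congrFun h4 i) j

end DerivCalc

namespace ChartData

open Coord SmoothGerm DerivCalc

/-- The relations between the components of the fields in the axially symmetric case, in a
neighbourhood of the point `y`. -/
structure AxisymAt (L : ChartData) (y : E3) : Prop where
  g_smooth : ∀ i j, ContDiffAt ℝ ∞ (fun z => L.g z i j) y
  k_smooth : ∀ i j, ContDiffAt ℝ ∞ (fun z => L.k z i j) y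
  Y_smooth : ∀ i, ContDiffAt ℝ ∞ (fun z => L.Y z i) y
  η_smooth : ∀ i, ContDiffAt ℝ ∞ (fun z => L.η z i) y
  f_smooth : ContDiffAt ℝ ∞ L.f y
  φ_smooth : ContDiffAt ℝ ∞ L.φ y
  u_smooth : ContDiffAt ℝ ∞ L.u y
  Yφ_smooth : ContDiffAt ℝ ∞ L.Yφ y
  g_symm : ∀ᶠ z in 𝓝 y, ∀ i j, L.g z i j = L.g z j i
  k_symm : ∀ᶠ z in 𝓝 y, ∀ i j, L.k z i j = L.k z j i
  g_pos : ∀ᶠ z in 𝓝 y, ∀ X : Fin 3 → ℝ, X ≠ 0 → 0 < ∑ i, ∑ j, L.g z i j * X i * X j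
  gbar_eq : ∀ᶠ z in 𝓝 y, ∀ i j, L.gbar z i j
    = L.g z i j + L.df z i * L.Y z j + L.df z j * L.Y z i + L.φ z * L.df z i * L.df z j
  Y_eq : ∀ᶠ z in 𝓝 y, ∀ i, L.Y z i = ∑ j, L.gbar z i j * L.Ybar z j
  u_pos : ∀ᶠ z in 𝓝 y, 0 < L.u z
  u_sq : ∀ᶠ z in 𝓝 y, L.u z ^ 2 = L.φ z + ∑ i, L.Y z i * L.Ybar z i
  shift : ∀ᶠ z in 𝓝 y, ∀ i, L.Ybar z i = L.Yφ z * L.η z i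
  lie_g : ∀ᶠ z in 𝓝 y, ∀ i j, lie2 L.η L.g z i j = 0
  lie_k : ∀ᶠ z in 𝓝 y, ∀ i j, lie2 L.η L.k z i j = 0
  div_k : ∀ᶠ z in 𝓝 y, ∑ j, div2 L.g L.k z j * L.η z j = 0
  lie_f : ∀ᶠ z in 𝓝 y, lie0 L.η L.f z = 0
  lie_φ : ∀ᶠ z in 𝓝 y, lie0 L.η L.φ z = 0
  lie_Y : ∀ᶠ z in 𝓝 y, ∀ i, lie1 L.η L.Y z i = 0
  div_kbar : ∀ᶠ z in 𝓝 y, ∑ j, div2 L.gbar L.kbar z j * L.η z j = 0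

/-- The germs at `y` of the components of all fields: an instance of the algebraic setting `Axisym`,
with `b = Yφ / 2`, and the fields that its elements represent. -/
structure Lift (L : ChartData) (y : E3) where
  g : Fin 3 → Fin 3 → smoothGerms y
  gi : Fin 3 → Fin 3 → smoothGerms y
  k : Fin 3 → Fin 3 → smoothGerms y
  Γ : Fin 3 → Fin 3 → Fin 3 → smoothGerms y
  η : Fin 3 → smoothGerms y
  f : smoothGerms y
  u : smoothGerms y
  ui : smoothGerms y
  r : smoothGerms y
  ρ : smoothGerms y
  b : smoothGerms y
  axisym : Axisym (deriv y) g gi Γ η f u ui r ρ b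
  k_symm : ∀ i j, k i j = k j i
  killing_k : Killing (deriv y) k η
  rep_g : ∀ i j, Rep (g i j) fun z => L.g z i j
  rep_k : ∀ i j, Rep (k i j) fun z => L.k z i j
  rep_gbar : ∀ i j, Rep (barMetric (deriv y) g η f u b i j) fun z => L.gbar z i j
  rep_η : ∀ i, Rep (η i) fun z => L.η z i
  rep_f : Rep f L.f
  rep_u : Rep u L.u
  rep_ui : Rep ui fun z => (L.u z)⁻¹
  rep_r : Rep r L.root
  rep_ρ : Rep ρ fun z => (L.root z)⁻¹
  rep_Yφ : Rep (2 * b) L.Yφ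
  rep_Ybar : ∀ i, Rep (2 * b * η i) fun z => L.Ybar z i
  rep_Y : ∀ i, Rep (2 * b * app (barMetric (deriv y) g η f u b) η i) fun z => L.Y z i
  rep_φ : Rep (u * u - 4 * b * b * pair (app g η) η) L.φ

end ChartData

/-! ### The scalar curvature formula in a chart -/

/-- The divergence of `k - t g`, the tensor in the definition of `J` for `t = tr k`. -/
theorem DerivCalc.LeviCivita.div2_sub_mul {A : Type*} [CommRing A] [Algebra ℝ A]
    {D : Fin 3 → Derivation ℝ A A} {g gi : Fin 3 → Fin 3 → A} {Γ : Fin 3 → Fin 3 → Fin 3 → A}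
    (L : DerivCalc.LeviCivita D g gi Γ) (k : Fin 3 → Fin 3 → A) (t : A) (j : Fin 3) :
    DerivCalc.div2 D gi Γ (fun i j => k i j - t * g i j) j
      = DerivCalc.div2 D gi Γ k j - D j t := by
  have h : ∀ l i, DerivCalc.cov2 D Γ (fun i j => k i j - t * g i j) l i j
      = DerivCalc.cov2 D Γ k l i j - D l t * g i j := fun l i => by
    have c := L.compat l i j
    simp only [DerivCalc.cov2, Fin.sum_univ_three, map_sub, Derivation.leibniz, smul_eq_mul]
      at c ⊢
    linear_combination -t * c
  have e : ∑ i, ∑ l, gi i l * (D l t * g i j) = ∑ l, D l t * ∑ i, gi l i * g i j := by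
    simp only [Fin.sum_univ_three, L.inv_symm 1 0, L.inv_symm 2 0, L.inv_symm 2 1]; ring
  simp only [L.inv, mul_ite, mul_one, mul_zero, Finset.sum_ite_eq', Finset.mem_univ, if_true] at e
  simp only [DerivCalc.div2, h, mul_sub, Finset.sum_sub_distrib, e]

namespace SmoothGerm

/-- The value of a germ. -/
def val (y : E3) : smoothGerms y →+* ℝ := Germ.valueRingHom.comp (smoothGerms y).subtype

theorem Rep.val_eq {y : E3} {a : smoothGerms y} {F : E3 → ℝ} (ha : Rep a F) : val y a = F y := by
  show Germ.value (a : Germ (𝓝 y) ℝ) = F y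
  rw [ha]; rfl

end SmoothGerm

namespace ChartData

open Coord SmoothGerm DerivCalc

variable {L : ChartData} {y : E3}

theorem det_ne_zero_of_pos {G : Matrix (Fin 3) (Fin 3) ℝ}
    (h : ∀ X : Fin 3 → ℝ, X ≠ 0 → 0 < ∑ i, ∑ j, G i j * X i * X j) : G.det ≠ 0 := by
  intro h0
  obtain ⟨X, hX, hX0⟩ := Matrix.exists_mulVec_eq_zero_iff.2 h0
  have h1 := h X hX
  have e : ∑ i, ∑ j, G i j * X i * X j = ∑ i, X i * G.mulVec X i := by
    simp only [Matrix.mulVec, dotProduct, Finset.mul_sum]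
    exact Finset.sum_congr rfl fun i _ => Finset.sum_congr rfl fun j _ => by ring
  rw [e, hX0] at h1
  simp at h1

/-- The hypotheses are equations between germs. The invariance of `b` and `u` is not among them: it
follows from that of `Y`, `φ` and `g`. -/
theorem AxisymAt.nonempty_lift (H : L.AxisymAt y) : Nonempty (L.Lift y) := by
  choose g hg using fun i j => exists_rep (H.g_smooth i j)
  choose k hk using fun i j => exists_rep (H.k_smooth i j)
  choose Y hY using fun i => exists_rep (H.Y_smooth i)
  choose η hη using fun i => exists_rep (H.η_smooth i)
  obtain ⟨f, hf⟩ := exists_rep H.f_smooth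
  obtain ⟨φ, hφ⟩ := exists_rep H.φ_smooth
  obtain ⟨u, hu⟩ := exists_rep H.u_smooth
  obtain ⟨a, ha⟩ := exists_rep H.Yφ_smooth
  obtain ⟨ui, hui, huui⟩ := hu.inv H.u_pos.self_of_nhds.ne'
  have gs : ∀ i j, g i j = g j i := fun i j =>
    ((hg i j).iff_eventuallyEq (hg j i)).2 (H.g_symm.mono fun z hz => hz i j)
  have ks : ∀ i j, k i j = k j i := fun i j =>
    ((hk i j).iff_eventuallyEq (hk j i)).2 (H.k_symm.mono fun z hz => hz i j)
  obtain ⟨gi, inv⟩ := exists_inv hg (det_ne_zero_of_pos H.g_pos.self_of_nhds)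
  have lc : LeviCivita (deriv y) g gi (DerivCalc.christoffel (deriv y) g gi) :=
    leviCivita_christoffel gs (inv_symm_of_symm gs inv) inv
  have hgi := rep_inv hg inv
  have hdf : ∀ i, Rep (deriv y i f) fun z => L.df z i := fun i => hf.deriv i
  have hF : ∀ i, Rep (app gi (fun a => deriv y a f) i) fun z => L.gradf z i :=
    fun i => rep_app hgi hdf i
  have hn := rep_pair hF hdf
  rw [show pair (app gi fun i => deriv y i f) (fun i => deriv y i f)
    = pair (fun i => deriv y i f) (app gi fun i => deriv y i f) from
      Finset.sum_congr rfl fun i _ => mul_comm _ _] at hn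
  have harg : Rep (1 + u * u * pair (fun i => deriv y i f) (app gi fun i => deriv y i f))
      fun z => 1 + L.u z ^ 2 * ∑ i, L.gradf z i * L.df z i := by
    simpa only [sq] using rep_one.add ((hu.mul hu).mul hn)
  have hn0 : 0 ≤ ∑ i, L.gradf y i * L.df y i := by
    have h1 : pair (fun i => deriv y i f) (app gi fun i => deriv y i f)
        = ∑ i, ∑ j, g i j * app gi (fun a => deriv y a f) i * app gi (fun a => deriv y a f) j := by
      have e := lc.app_app' (fun a => deriv y a f)
      have e2 : pair (app g (app gi fun i => deriv y i f)) (app gi fun i => deriv y i f)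
        = ∑ i, ∑ j, g i j * app gi (fun a => deriv y a f) i
          * app gi (fun a => deriv y a f) j := by
        generalize app gi (fun i => deriv y i f) = F
        simp only [pair, app, Fin.sum_univ_three]; ring
      rw [← e2, funext e]
    have h2 : Rep _ (fun z => ∑ i, ∑ j, L.g z i j * L.gradf z i * L.gradf z j) :=
      Rep.sum Finset.univ fun i => Rep.sum Finset.univ fun j => ((hg i j).mul (hF i)).mul (hF j)
    rw [← h1] at h2
    rw [hn.eq_at h2]
    by_cases h0 : L.gradf y = 0
    · simp [h0]
    · exact (H.g_pos.self_of_nhds _ h0).le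
  obtain ⟨r, hr, hrr⟩ := harg.sqrt (by positivity)
  have hr : Rep r L.root := hr
  have hroot : L.root y ≠ 0 := (Real.sqrt_pos.2 (by positivity)).ne'
  obtain ⟨ρ, hρ, hrρ⟩ := hr.inv hroot
  have f_inv : pair (fun i => deriv y i f) η = 0 :=
    ((rep_lie0 hη hf).iff_eventuallyEq rep_zero).2 H.lie_f
  have killing : Killing (deriv y) g η := fun i j =>
    ((rep_lie2 hη hg i j).iff_eventuallyEq rep_zero).2 (H.lie_g.mono fun z hz => hz i j)
  have killing_k : Killing (deriv y) k η := fun i j =>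
    ((rep_lie2 hη hk i j).iff_eventuallyEq rep_zero).2 (H.lie_k.mono fun z hz => hz i j)
  have hφ0 : pair (fun i => deriv y i φ) η = 0 :=
    ((rep_lie0 hη hφ).iff_eventuallyEq rep_zero).2 H.lie_φ
  have hlieY : ∀ i, ∑ l, (η l * deriv y l (Y i) + Y l * deriv y i (η l)) = 0 := fun i =>
    ((rep_lie1 hη hY i).iff_eventuallyEq rep_zero).2 (H.lie_Y.mono fun z hz => hz i)
  set b := algebraMap ℝ (smoothGerms y) (1 / 2) * a with hbdef
  have hb : Rep b fun z => 1 / 2 * L.Yφ z := (rep_const _).mul ha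
  have hYbar : ∀ i, Rep (2 * b * η i) fun z => L.Ybar z i := fun i =>
    ((rep_two.mul hb).mul (hη i)).congr (H.shift.mono fun z hz => by
      simp only [hz i]; ring)
  obtain ⟨gbar, hgbar⟩ : ∃ gbar : Fin 3 → Fin 3 → smoothGerms y, ∀ i j, gbar i j
      = g i j + deriv y i f * Y j + deriv y j f * Y i + φ * deriv y i f * deriv y j f :=
    ⟨_, fun _ _ => rfl⟩
  have rep_gbar : ∀ i j, Rep (gbar i j) fun z => L.gbar z i j := fun i j => by
    rw [hgbar]
    exact ((((hg i j).add ((hdf i).mul (hY j))).add ((hdf j).mul (hY i))).add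
      ((hφ.mul (hdf i)).mul (hdf j))).congr (H.gbar_eq.mono fun z hz => (hz i j).symm)
  have hYeq := shift_form_eq (b := b) f_inv hgbar (fun i =>
    ((hY i).iff_eventuallyEq (Rep.sum _ fun j => (rep_gbar i j).mul (hYbar j))).2
      (H.Y_eq.mono fun z hz => hz i))
  have hφeq := lapse_eq f_inv hYeq (φ := φ) (u := u) (((hu.mul hu).iff_eventuallyEq
    (hφ.add (Rep.sum _ fun i => (hY i).mul (hYbar i)))).2
      (H.u_sq.mono fun z hz => by simpa only [sq] using hz))
  have hmb := normSq_mul_invariant lc deriv_comm killing f_inv hYeq hlieY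
  -- at the zeros of `η` the derivative along `η` vanishes anyway
  have b_inv : pair (fun i => deriv y i b) η = 0 := by
    have h1 := rep_lie0 hη hb
    have h2 := (rep_pair (rep_app hg hη) hη).mul h1
    rw [hmb] at h2
    refine (h1.iff_eventuallyEq rep_zero).2 ?_
    filter_upwards [H.g_pos, h2.eventuallyEq rep_zero] with z hz hz2
    -- Where `η` vanishes, so does `η(b)`; elsewhere `|η|² η(b) = 0` may be divided by `|η|²`.
    by_cases h0 : L.η z = 0
    · simp [lie0, h0]
    · have h3 := hz _ h0
      have e : ∑ i, (∑ j, L.g z i j * L.η z j) * L.η z i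
          = ∑ i, ∑ j, L.g z i j * L.η z i * L.η z j := by
        simp only [Finset.sum_mul]
        exact Finset.sum_congr rfl fun i _ => Finset.sum_congr rfl fun j _ => by ring
      rw [e] at hz2
      exact (mul_eq_zero.1 hz2).resolve_left h3.ne'
  have u_inv := lapse_invariant hφeq hφ0 b_inv (killing.normSq_invariant lc) huui
  have S : Axisym (deriv y) g gi (DerivCalc.christoffel (deriv y) g gi) η f u ui r ρ b :=
    { lc := lc, comm := deriv_comm, u_inv := huui, r_inv := hrρ, r_sq := hrr,
      killing := killing, f_inv := f_inv, u_inv' := u_inv, b_inv := b_inv }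
  have hbar : ∀ i j, barMetric (deriv y) g η f u b i j = gbar i j := fun i j => by
    rw [S.barMetric_eq, hgbar, hYeq, hYeq, hφeq]; ring
  refine ⟨{ g := g, gi := gi, k := k, Γ := _, η := η, f := f, u := u, ui := ui, r := r, ρ := ρ,
            b := b, axisym := S, k_symm := ks, killing_k := killing_k, rep_g := hg, rep_k := hk,
            rep_gbar := fun i j => by rw [hbar]; exact rep_gbar i j
            rep_η := hη, rep_f := hf, rep_u := hu, rep_ui := hui, rep_r := hr, rep_ρ := hρ,
            rep_Yφ := (rep_two.mul hb).congr (.of_forall fun z => by ring), rep_Ybar := hYbar,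
            rep_Y := fun i => by
              rw [S.app_bar_self, ← hYeq]; exact hY i
            rep_φ := by rw [← hφeq]; exact hφ }⟩

namespace Lift

variable (l : L.Lift y)

local notation "D" => SmoothGerm.deriv y

theorem rep_gi (i j : Fin 3) : Rep (l.gi i j) fun z => (L.g z)⁻¹ i j :=
  rep_inv l.rep_g l.axisym.lc.inv i j

theorem rep_barInv (i j : Fin 3) : Rep (barInv D l.gi l.η l.f l.u l.ρ l.b i j)
    fun z => (L.gbar z)⁻¹ i j :=
  rep_inv l.rep_gbar l.axisym.lc_bar.inv i j

theorem rep_df (i : Fin 3) : Rep (D i l.f) fun z => L.df z i := l.rep_f.deriv i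

theorem rep_gradf (i : Fin 3) : Rep (app l.gi (fun a => D a l.f) i) fun z => L.gradf z i :=
  rep_app l.rep_gi l.rep_df i

theorem rep_gη (i : Fin 3) : Rep (app l.g l.η i) fun z => L.gη z i :=
  rep_app l.rep_g l.rep_η i

theorem half_mul : algebraMap ℝ (smoothGerms y) (1 / 2) * 2 = 1 := by
  rw [← map_ofNat (algebraMap ℝ (smoothGerms y)) 2, ← map_mul]; norm_num

theorem rep_sff (i j : Fin 3) :
    Rep (DerivCalc.sff D l.g l.Γ l.η l.f l.u l.ui l.ρ l.b i j) fun z => L.sff z i j := by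
  have hH := rep_hess l.axisym.lc l.rep_g l.rep_f i j
  have h2 := half_mul (y := y)
  have c2 : ∀ i, D i (2 : smoothGerms y) = 0 := fun i => Derivation.map_natCast (D i) 2
  have h := ((((l.rep_u.mul hH).add ((l.rep_u.deriv i).mul (l.rep_df j))).add
    ((l.rep_u.deriv j).mul (l.rep_df i))).add (((rep_const (1 / 2)).mul l.rep_ui).mul
    (((l.rep_gη i).mul (l.rep_Yφ.deriv j)).add ((l.rep_gη j).mul (l.rep_Yφ.deriv i))))).mul l.rep_ρ
  have e : DerivCalc.sff D l.g l.Γ l.η l.f l.u l.ui l.ρ l.b i j = (l.u * hess D l.Γ l.f i j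
      + D i l.u * D j l.f + D j l.u * D i l.f + algebraMap ℝ (smoothGerms y) (1 / 2) * l.ui
      * (app l.g l.η i * D j (2 * l.b) + app l.g l.η j * D i (2 * l.b))) * l.ρ := by
    simp only [DerivCalc.sff, sff0, Derivation.leibniz, smul_eq_mul, c2]
    linear_combination (-l.ui * l.ρ * (D i l.b * app l.g l.η j + D j l.b * app l.g l.η i)) * h2
  rw [e]
  refine h.congr (.of_forall fun z => ?_)
  simp only [ChartData.sff, Matrix.of_apply]
  rw [div_eq_mul_inv]
  ring

theorem rep_kbar (i j : Fin 3) :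
    Rep (DerivCalc.kbar D l.g l.η l.f l.u l.ui l.b i j) fun z => L.kbar z i j := by
  have LB := l.axisym.lc_bar
  have h2 := half_mul (y := y)
  have c2 : ∀ i, D i (2 : smoothGerms y) = 0 := fun i => Derivation.map_natCast (D i) 2
  have h := ((rep_const (1 / 2)).mul l.rep_ui).mul ((rep_cov1 LB l.rep_gbar l.rep_Y i j).add
    (rep_cov1 LB l.rep_gbar l.rep_Y j i))
  have e : ∀ i j, DerivCalc.cov1 D (barΓ D l.g l.gi l.Γ l.η l.f l.u l.ρ l.b)
      (fun i => 2 * l.b * app (barMetric D l.g l.η l.f l.u l.b) l.η i) i j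
      = 2 * D i l.b * app (barMetric D l.g l.η l.f l.u l.b) l.η j
        + 2 * l.b * app (barMetric D l.g l.η l.f l.u l.b)
          (covV D (barΓ D l.g l.gi l.Γ l.η l.f l.u l.ρ l.b) l.η i) j := fun i j => by
    rw [← LB.cov1_app]
    generalize app (barMetric D l.g l.η l.f l.u l.b) l.η = E
    simp only [DerivCalc.cov1, Derivation.leibniz, smul_eq_mul, c2, Fin.sum_univ_three]; ring
  rw [e, e, l.axisym.killing_bar.antisymm LB i j] at h
  have e2 : DerivCalc.kbar D l.g l.η l.f l.u l.ui l.b i j = _ :=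
    show _ = algebraMap ℝ (smoothGerms y) (1 / 2) * l.ui * (2 * D i l.b
        * app (barMetric D l.g l.η l.f l.u l.b) l.η j + 2 * l.b
        * -app (barMetric D l.g l.η l.f l.u l.b)
          (covV D (barΓ D l.g l.gi l.Γ l.η l.f l.u l.ρ l.b) l.η j) i
      + (2 * D j l.b * app (barMetric D l.g l.η l.f l.u l.b) l.η i
        + 2 * l.b * app (barMetric D l.g l.η l.f l.u l.b)
          (covV D (barΓ D l.g l.gi l.Γ l.η l.f l.u l.ρ l.b) l.η j) i)) by
      rw [DerivCalc.kbar]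
      linear_combination (-l.ui * (D i l.b * app (barMetric D l.g l.η l.f l.u l.b) l.η j
        + D j l.b * app (barMetric D l.g l.η l.f l.u l.b) l.η i)) * h2
  rw [e2]
  refine h.congr (.of_forall fun z => ?_)
  simp only [ChartData.kbar, Matrix.of_apply]
  ring

theorem rep_v (i : Fin 3) : Rep (l.u * l.ρ * app l.gi (fun a => D a l.f) i)
    fun z => L.v z i :=
  ((l.rep_u.mul l.rep_ρ).mul (l.rep_gradf i)).congr (.of_forall fun z => by
    simp only [v]; ring)

theorem rep_w (i : Fin 3) : Rep (shiftUnit D l.gi l.η l.f l.u l.ui l.ρ l.b i)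
    fun z => L.w z i := by
  have e : shiftUnit D l.gi l.η l.f l.u l.ui l.ρ l.b i
      = (l.u * app l.gi (fun a => D a l.f) i + l.ui * (2 * l.b * l.η i)) * l.ρ := by
    rw [shiftUnit, shift]
    linear_combination l.ρ * l.u * app l.gi (fun a => D a l.f) i * l.axisym.u_inv
  rw [e]
  exact (((l.rep_u.mul (l.rep_gradf i)).add (l.rep_ui.mul (l.rep_Ybar i))).mul l.rep_ρ).congr
    (.of_forall fun z => by simp only [w]; ring)

theorem rep_Q (i : Fin 3) : Rep (Qform D l.g l.gi l.Γ l.k l.η l.f l.u l.ui l.r l.ρ l.b i)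
    fun z => L.Q z i := by
  have hs : ∀ i j, Rep (l.k i j - DerivCalc.sff D l.g l.Γ l.η l.f l.u l.ui l.ρ l.b i j)
    fun z => (L.k z - L.sff z) i j := fun i j => (l.rep_k i j).sub (l.rep_sff i j)
  have hw := l.rep_w
  have hH := rep_hess l.axisym.lc_bar l.rep_gbar l.rep_f i
  have h := (((Rep.sum Finset.univ fun j => (l.rep_Ybar j).mul (hH j)).sub
    (l.rep_u.mul (Rep.sum Finset.univ fun j => Rep.sum Finset.univ fun m =>
      ((l.rep_barInv j m).mul (l.rep_df m)).mul (l.rep_kbar i j)))).add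
    (Rep.sum Finset.univ fun j => (hw j).mul (hs i j))).add
    (((l.rep_u.mul (l.rep_df i)).mul (Rep.sum Finset.univ fun m => Rep.sum Finset.univ fun j =>
      ((hw m).mul (hw j)).mul (hs m j))).mul l.rep_r)
  refine Eq.trans ?_ h
  congr 1
  rw [Qform]
  simp only [app, bil, Fin.sum_univ_three]
  ring

theorem formula (l : L.Lift y) (H : L.AxisymAt y) : L.ScalarCurvatureFormula y := by
  have S := l.axisym
  have hkη : pair (DerivCalc.div2 D l.gi l.Γ l.k) l.η = 0 :=
    ((rep_pair (rep_div2 S.lc l.rep_g l.rep_k) l.rep_η).iff_eventuallyEq rep_zero).2 H.div_k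
  have hb : pair (DerivCalc.div2 D (barInv D l.gi l.η l.f l.u l.ρ l.b)
      (barΓ D l.g l.gi l.Γ l.η l.f l.u l.ρ l.b)
      (DerivCalc.kbar D l.g l.η l.f l.u l.ui l.b)) l.η = 0 :=
    ((rep_pair (rep_div2 S.lc_bar l.rep_gbar l.rep_kbar) l.rep_η).iff_eventuallyEq
      rep_zero).2 H.div_kbar
  have key := S.scal_bar l.k_symm l.killing_k hkη hb
  set p := DerivCalc.sff D l.g l.Γ l.η l.f l.u l.ui l.ρ l.b with hp
  have hdiff : DerivCalc.normSq l.gi (fun i j => l.k i j - p i j) = DerivCalc.normSq l.gi l.k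
      - 2 * inner2 l.gi l.k p + DerivCalc.normSq l.gi p := by
    have := normSq_add_mul l.gi l.k p (-1) S.lc.inv_symm
    have e : (fun i j => l.k i j - p i j) = fun i j => l.k i j + -1 * p i j := by
      funext i j; ring
    rw [e, this]; ring
  have hdiv : pair (DerivCalc.div2 D l.gi l.Γ fun i j =>
      l.k i j - DerivCalc.tr l.gi l.k * l.g i j)
        (fun i => l.u * l.ρ * app l.gi (fun a => D a l.f) i)
      = pair (DerivCalc.div2 D l.gi l.Γ l.k) (fun i => l.u * l.ρ * app l.gi (fun a => D a l.f) i)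
      - pair (fun i => D i (DerivCalc.tr l.gi l.k))
        (fun i => l.u * l.ρ * app l.gi (fun a => D a l.f) i) := by
    rw [show DerivCalc.div2 D l.gi l.Γ (fun i j => l.k i j - DerivCalc.tr l.gi l.k * l.g i j) = _
      from funext (S.lc.div2_sub_mul _ _)]
    simp only [pair, Fin.sum_univ_three]; ring
  have hT : pair (fun i => D i (DerivCalc.tr l.gi p - DerivCalc.tr l.gi l.k))
      (fun i => l.u * l.ρ * app l.gi (fun a => D a l.f) i)
      = pair (fun i => D i (DerivCalc.tr l.gi p))
        (fun i => l.u * l.ρ * app l.gi (fun a => D a l.f) i)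
      - pair (fun i => D i (DerivCalc.tr l.gi l.k))
        (fun i => l.u * l.ρ * app l.gi (fun a => D a l.f) i) := by
    simp only [pair, map_sub, Fin.sum_univ_three]; ring
  have key2 : DerivCalc.tr (barInv D l.gi l.η l.f l.u l.ρ l.b)
        (ric D (barΓ D l.g l.gi l.Γ l.η l.f l.u l.ρ l.b))
      - DerivCalc.normSq (barInv D l.gi l.η l.f l.u l.ρ l.b)
        (DerivCalc.kbar D l.g l.η l.f l.u l.ui l.b)
    = (DerivCalc.tr l.gi (ric D l.Γ) + DerivCalc.tr l.gi l.k * DerivCalc.tr l.gi l.k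
        - DerivCalc.normSq l.gi l.k)
      - 2 * pair (DerivCalc.div2 D l.gi l.Γ fun i j =>
          l.k i j - DerivCalc.tr l.gi l.k * l.g i j)
        (fun i => l.u * l.ρ * app l.gi (fun a => D a l.f) i)
      + DerivCalc.normSq l.gi (fun i j => l.k i j - p i j)
      + 2 * l.ui * DerivCalc.div1 D (barInv D l.gi l.η l.f l.u l.ρ l.b)
        (barΓ D l.g l.gi l.Γ l.η l.f l.u l.ρ l.b)
        (fun i => l.u * Qform D l.g l.gi l.Γ l.k l.η l.f l.u l.ui l.r l.ρ l.b i)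
      + DerivCalc.tr l.gi p * DerivCalc.tr l.gi p
      - DerivCalc.tr l.gi l.k * DerivCalc.tr l.gi l.k
      + 2 * pair (fun i => D i (DerivCalc.tr l.gi p - DerivCalc.tr l.gi l.k))
      (fun i => l.u * l.ρ * app l.gi (fun a => D a l.f) i) := by
    rw [hdiff, hdiv, hT, key]; ring
  have hs : ∀ i j, Rep (l.k i j - p i j) fun z => (L.k z - L.sff z) i j :=
    fun i j => (l.rep_k i j).sub (l.rep_sff i j)
  have htk := rep_tr l.rep_gi l.rep_k
  have htp := rep_tr l.rep_gi l.rep_sff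
  have hkt : ∀ i j, Rep (l.k i j - DerivCalc.tr l.gi l.k * l.g i j)
      fun z => (L.k z - Coord.tr L.g L.k z • L.g z) i j :=
    fun i j => (l.rep_k i j).sub (htk.mul (l.rep_g i j))
  have v1 := (rep_scal S.lc_bar l.rep_gbar).val_eq
  have v2 := (rep_normSq l.rep_barInv l.rep_kbar).val_eq
  have v3 := (rep_scal S.lc l.rep_g).val_eq
  have v4 := htk.val_eq
  have v5 := (rep_normSq l.rep_gi l.rep_k).val_eq
  have v6 := (rep_pair (rep_div2 S.lc l.rep_g hkt) l.rep_v).val_eq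
  have v7 := (rep_normSq l.rep_gi hs).val_eq
  have v8 := l.rep_ui.val_eq
  have v9 := (rep_div1 S.lc_bar l.rep_gbar fun i => l.rep_u.mul (l.rep_Q i)).val_eq
  have v10 := htp.val_eq
  have v11 := (rep_pair (fun i => (htp.sub htk).deriv i) l.rep_v).val_eq
  simp only [map_sub] at v11
  have key3 := congrArg (val y) key2
  simp only [map_add, map_sub, map_mul, map_ofNat] at key3
  rw [v1, v2, v3, v4, v5, v6, v7, v8, v9, v10, v11] at key3
  have hμ : 16 * Real.pi * L.μ y
      = Coord.scal L.g y + Coord.tr L.g L.k y ^ 2 - Coord.normSq L.g L.k y := by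
    have := Real.pi_ne_zero
    rw [μ]; field_simp
  have hJ : 16 * Real.pi * ∑ i, L.J y i * L.v y i
      = 2 * ∑ i, Coord.div2 L.g (fun z => L.k z - Coord.tr L.g L.k z • L.g z) y i * L.v y i := by
    have := Real.pi_ne_zero
    simp only [J, Finset.mul_sum]
    refine Finset.sum_congr rfl fun i _ => ?_
    field_simp
    ring
  have e11 : ∑ i, L.v y i * pd i (fun z => Coord.tr L.g L.sff z - Coord.tr L.g L.k z) y
      = ∑ i, pd i (fun z => Coord.tr L.g L.sff z - Coord.tr L.g L.k z) y * L.v y i :=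
    Finset.sum_congr rfl fun i _ => mul_comm _ _
  rw [ScalarCurvatureFormula, mul_sub, hμ, hJ, e11, key3]
  ring

end Lift

end ChartData

/-! ### The spacetime metric along the graph -/

namespace DerivCalc

/-- The second fundamental form as the Lie derivative of the metric along the shift, in terms of
partial derivatives. -/
theorem Axisym.two_lapse_mul_sff {A : Type*} [CommRing A] [Algebra ℝ A]
    {D : Fin 3 → Derivation ℝ A A} {g gi : Fin 3 → Fin 3 → A} {Γ : Fin 3 → Fin 3 → Fin 3 → A}
    {η : Fin 3 → A} {f u ui r ρ b : A} (S : Axisym D g gi Γ η f u ui r ρ b) (i j : Fin 3) :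
    2 * (u * r) * sff D g Γ η f u ui ρ b i j
      = D i (app g (shift D gi η f u b) j) + D j (app g (shift D gi η f u b) i)
        - ∑ l, shift D gi η f u b l * (D i (g l j) + D j (g l i) - D l (g i j)) := by
  rw [← S.covV_shift_symm, ← S.lc.cov1_app, ← S.lc.cov1_app]
  generalize shift D gi η f u b = β
  have e : ∀ l, D i (g l j) + D j (g l i) - D l (g i j) = 2 * ∑ k, Γ k i j * g k l := fun l => by
    have t := S.lc.torsion
    have s := S.lc.symm
    rw [S.lc.compat, S.lc.compat, S.lc.compat]
    simp only [Fin.sum_univ_three, t _ j i, t _ l i, t _ l j, s l 0, s l 1, s l 2, s i 0, s i 1,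
      s i 2]
    ring
  have e2 : ∑ l, Γ l i j * app g β l = ∑ l, β l * ∑ k, Γ k i j * g k l := by
    simp only [app, Fin.sum_univ_three]; ring
  have e3 : ∀ l, Γ l j i = Γ l i j := fun l => S.lc.torsion l j i
  simp only [cov1, e, e3, e2]
  simp only [Fin.sum_univ_three]; ring

end DerivCalc

namespace ChartData

open Coord

variable {L : ChartData} {y : E3}

theorem space_graphPt : space (L.graphPt y) = y := by
  ext i; simp [space, graphPt]

theorem fderiv_comp_space {F : E3 → ℝ} (hF : DifferentiableAt ℝ F y)
    (V : EuclideanSpace ℝ (Fin 3 ⊕ Unit)) :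
    fderiv ℝ (fun z => F (space z)) (L.graphPt y) V = fderiv ℝ F y (space V) := by
  let T : EuclideanSpace ℝ (Fin 3 ⊕ Unit) →ₗ[ℝ] E3 :=
    { toFun := space
      map_add' := fun a b => by ext i; simp [space]
      map_smul' := fun c a => by ext i; simp [space] }
  have hT : ∀ z, LinearMap.toContinuousLinearMap T z = space z := fun z => rfl
  have h1 : HasFDerivAt space (LinearMap.toContinuousLinearMap T) (L.graphPt y) :=
    (LinearMap.toContinuousLinearMap T).hasFDerivAt
  have h2 : HasFDerivAt F (fderiv ℝ F y) (space (L.graphPt y)) := by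
    rw [space_graphPt]; exact hF.hasFDerivAt
  rw [show (fun z => F (space z)) = F ∘ space from rfl, (h2.comp _ h1).fderiv]
  rfl

theorem pd_comp_space_inl {F : E3 → ℝ} (hF : DifferentiableAt ℝ F y) (i : Fin 3) :
    pd (Sum.inl i) (fun z => F (space z)) (L.graphPt y) = pd i F y := by
  rw [pd, pd, fderiv_comp_space hF]
  congr 1
  ext j
  simp [space]

theorem pd_comp_space_inr {F : E3 → ℝ} (hF : DifferentiableAt ℝ F y) :
    pd (Sum.inr ()) (fun z => F (space z)) (L.graphPt y) = 0 := by
  rw [pd, fderiv_comp_space hF]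
  have : space (EuclideanSpace.single (Sum.inr () : Fin 3 ⊕ Unit) (1 : ℝ)) = 0 := by
    ext j
    simp [space]
  rw [this, map_zero]

/-- The spacetime inner product, in terms of the metric `g` that is induced on the graph: the
vector `A` is `c ∂ₜ + Aⁱ Xᵢ` with `c = Aᵗ - df(A)`. -/
theorem stInner_eq (hg : ∀ i j, L.gbar y i j
      = L.g y i j + L.df y i * L.Y y j + L.df y j * L.Y y i + L.φ y * L.df y i * L.df y j)
    (A B : Fin 3 ⊕ Unit → ℝ) : L.stInner y A B
      = ∑ i, ∑ j, L.g y i j * A (Sum.inl i) * B (Sum.inl j)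
      - (A (Sum.inr ()) - ∑ i, L.df y i * A (Sum.inl i))
        * ∑ i, (L.Y y i + L.φ y * L.df y i) * B (Sum.inl i)
      - (B (Sum.inr ()) - ∑ i, L.df y i * B (Sum.inl i))
        * ∑ i, (L.Y y i + L.φ y * L.df y i) * A (Sum.inl i)
      - L.φ y * (A (Sum.inr ()) - ∑ i, L.df y i * A (Sum.inl i))
        * (B (Sum.inr ()) - ∑ i, L.df y i * B (Sum.inl i)) := by
  simp only [stInner, stMetric, space_graphPt, Fintype.sum_sum_type, Matrix.fromBlocks_apply₁₁,
    Matrix.fromBlocks_apply₁₂, Matrix.fromBlocks_apply₂₁, Matrix.fromBlocks_apply₂₂,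
    Matrix.of_apply, hg, Finset.univ_unique, Finset.sum_singleton, Fin.sum_univ_three,
    PUnit.default_eq_unit]
  ring

/-- The inner products of `∇̃_{Xᵢ} Xⱼ`, with the Christoffel symbols of the first kind in place of
the inverse of the spacetime metric. -/
theorem stInner_stCov (hG : (L.stMetric (L.graphPt y)).det ≠ 0)
    (hs : ∀ a b, L.stMetric (L.graphPt y) a b = L.stMetric (L.graphPt y) b a)
    (i j : Fin 3) (B : Fin 3 ⊕ Unit → ℝ) :
    L.stInner y (L.stCov i j y) B
      = ∑ a, ∑ b, L.stMetric (L.graphPt y) a b * pd i (fun z => L.graphTangent j z a) y * B b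
      + 1 / 2 * ∑ b, B b * ∑ c, ∑ d, (pd c (fun z => L.stMetric z b d) (L.graphPt y)
        + pd d (fun z => L.stMetric z b c) (L.graphPt y)
        - pd b (fun z => L.stMetric z c d) (L.graphPt y))
        * L.graphTangent i y c * L.graphTangent j y d := by
  have low : ∀ b c d, ∑ a, L.stMetric (L.graphPt y) a b * christoffel L.stMetric a c d (L.graphPt y)
      = 1 / 2 * (pd c (fun z => L.stMetric z b d) (L.graphPt y)
        + pd d (fun z => L.stMetric z b c) (L.graphPt y)
        - pd b (fun z => L.stMetric z c d) (L.graphPt y)) := by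
    intro b c d
    have h : ∀ m, ∑ a, L.stMetric (L.graphPt y) b a * (L.stMetric (L.graphPt y))⁻¹ a m
        = if b = m then 1 else 0 := fun m => by
      rw [← Matrix.mul_apply, Matrix.mul_nonsing_inv _ (isUnit_iff_ne_zero.2 hG),
        Matrix.one_apply]
    simp only [christoffel, hs _ b, Finset.mul_sum]
    rw [Finset.sum_comm]
    have : ∀ m, ∑ a, L.stMetric (L.graphPt y) b a * (1 / 2 * ((L.stMetric (L.graphPt y))⁻¹ a m *
        (pd c (fun z => L.stMetric z m d) (L.graphPt y)
        + pd d (fun z => L.stMetric z m c) (L.graphPt y)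
        - pd m (fun z => L.stMetric z c d) (L.graphPt y))))
        = (if b = m then 1 else 0) * (1 / 2 * (pd c (fun z => L.stMetric z m d) (L.graphPt y)
        + pd d (fun z => L.stMetric z m c) (L.graphPt y)
        - pd m (fun z => L.stMetric z c d) (L.graphPt y))) := fun m => by
      rw [← h, Finset.sum_mul]
      exact Finset.sum_congr rfl fun a _ => by ring
    simp only [this, ite_mul, one_mul, zero_mul, Finset.sum_ite_eq, Finset.mem_univ, if_true]
  have e : ∀ b c d, 1 / 2 * (B b * ((pd c (fun z => L.stMetric z b d) (L.graphPt y)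
        + pd d (fun z => L.stMetric z b c) (L.graphPt y)
        - pd b (fun z => L.stMetric z c d) (L.graphPt y))
        * L.graphTangent i y c * L.graphTangent j y d))
      = ∑ a, L.stMetric (L.graphPt y) a b * (christoffel L.stMetric a c d (L.graphPt y)
        * L.graphTangent i y c * L.graphTangent j y d) * B b := fun b c d => by
    have := low b c d
    rw [show ∑ a, L.stMetric (L.graphPt y) a b * (christoffel L.stMetric a c d (L.graphPt y)
        * L.graphTangent i y c * L.graphTangent j y d) * B b
      = (∑ a, L.stMetric (L.graphPt y) a b * christoffel L.stMetric a c d (L.graphPt y))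
        * (L.graphTangent i y c * L.graphTangent j y d * B b) by
        rw [Finset.sum_mul]; exact Finset.sum_congr rfl fun a _ => by ring, this]
    ring
  simp only [Finset.mul_sum, e]
  simp only [stInner, stCov, mul_add, add_mul, Finset.sum_add_distrib, Finset.mul_sum,
    Finset.sum_mul]
  congr 1
  rw [Finset.sum_comm]
  refine Finset.sum_congr rfl fun b _ => ?_
  rw [Finset.sum_comm]
  refine Finset.sum_congr rfl fun c _ => ?_
  rw [Finset.sum_comm]

end ChartData

/-! ### The shift of the graph -/

namespace DerivCalc.Axisym

variable {A : Type*} [CommRing A] [Algebra ℝ A]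
    {D : Fin 3 → Derivation ℝ A A} {g gi : Fin 3 → Fin 3 → A} {Γ : Fin 3 → Fin 3 → Fin 3 → A}
    {η : Fin 3 → A} {f u ui r ρ b : A} (S : Axisym D g gi Γ η f u ui r ρ b)
include S

theorem app_shift (i : Fin 3) : app g (shift D gi η f u b) i
    = u * u * D i f + 2 * b * app g η i := by
  rw [← S.lc.app_app' (fun a => D a f) i]
  simp only [shift, app, Fin.sum_univ_three]; ring

/-- The 1-form dual to `β` is `Y + φ df`, the tangential part of `-g̃(∂ₜ, ·)` on the graph. -/
theorem app_shift_eq (i : Fin 3) : app g (shift D gi η f u b) i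
    = 2 * b * app (barMetric D g η f u b) η i
      + (u * u - 4 * b * b * pair (app g η) η) * D i f := by
  rw [S.app_shift, S.app_bar_self]; ring

omit S in
theorem pair_shift (α : Fin 3 → A) : pair α (shift D gi η f u b)
    = u * u * pair α (app gi fun a => D a f) + 2 * b * pair α η := by
  simp only [shift, pair, Fin.sum_univ_three]; ring

theorem one_add_pair_shift : 1 + pair (fun i => D i f) (shift D gi η f u b) = r * r := by
  rw [pair_shift, S.f_inv, S.r_sq]; ring

/-- `|β|² + φ = (u r)²`: the lapse of the foliation by time translates of the graph is `u r`. -/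
theorem normSq_shift : pair (app g (shift D gi η f u b)) (shift D gi η f u b)
    + (u * u - 4 * b * b * pair (app g η) η) = u * u * (r * r) := by
  have h1 : pair (app g η) (app gi fun a => D a f) = 0 := by
    rw [S.lc.pair_lower_raise, S.f_inv]
  have e : pair (fun i => u * u * D i f + 2 * b * app g η i) (shift D gi η f u b)
      = u * u * pair (fun i => D i f) (shift D gi η f u b)
        + 2 * b * pair (app g η) (shift D gi η f u b) := by
    generalize app g η = E
    simp only [pair, Fin.sum_univ_three]; ring
  rw [funext S.app_shift, e, pair_shift (app g η), h1]
  linear_combination u * u * S.one_add_pair_shift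

theorem barMetric_eq' (i j : Fin 3) : barMetric D g η f u b i j
    = g i j + D i f * (2 * b * app (barMetric D g η f u b) η j)
      + D j f * (2 * b * app (barMetric D g η f u b) η i)
      + (u * u - 4 * b * b * pair (app g η) η) * D i f * D j f := by
  rw [S.barMetric_eq, S.app_bar_self, S.app_bar_self]; ring

end DerivCalc.Axisym

namespace ChartData

open Coord

variable {L : ChartData} {y : E3}

theorem sum_graphTangent (i : Fin 3) (V : Fin 3 ⊕ Unit → ℝ) :
    ∑ c, V c * L.graphTangent i y c = V (Sum.inl i) + L.df y i * V (Sum.inr ()) := by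
  simp [graphTangent, Fintype.sum_sum_type, Pi.single_apply, mul_comm]

theorem sum_sum_graphTangent (i j : Fin 3) (K : Fin 3 ⊕ Unit → Fin 3 ⊕ Unit → ℝ) :
    ∑ c, ∑ d, K c d * L.graphTangent i y c * L.graphTangent j y d
      = K (Sum.inl i) (Sum.inl j) + L.df y i * K (Sum.inr ()) (Sum.inl j)
        + L.df y j * (K (Sum.inl i) (Sum.inr ()) + L.df y i * K (Sum.inr ()) (Sum.inr ())) := by
  have h : ∀ c, ∑ d, K c d * L.graphTangent i y c * L.graphTangent j y d
      = (K c (Sum.inl j) + L.df y j * K c (Sum.inr ())) * L.graphTangent i y c := fun c => by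
    rw [← sum_graphTangent (L := L) (y := y) j (K c), Finset.sum_mul]
    exact Finset.sum_congr rfl fun d _ => by ring
  simp only [h, sum_graphTangent]; ring

/-- The derivatives of the spacetime metric at a point of the graph. -/
theorem pd_stMetric (hg : ∀ i j, DifferentiableAt ℝ (fun z => L.gbar z i j) y)
    (hY : ∀ i, DifferentiableAt ℝ (fun z => L.Y z i) y) (hφ : DifferentiableAt ℝ L.φ y) :
    (∀ i a b, pd (Sum.inl i) (fun z => L.stMetric z (Sum.inl a) (Sum.inl b)) (L.graphPt y)
      = pd i (fun z => L.gbar z a b) y)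
    ∧ (∀ i a, pd (Sum.inl i) (fun z => L.stMetric z (Sum.inl a) (Sum.inr ())) (L.graphPt y)
      = -pd i (fun z => L.Y z a) y)
    ∧ (∀ i a, pd (Sum.inl i) (fun z => L.stMetric z (Sum.inr ()) (Sum.inl a)) (L.graphPt y)
      = -pd i (fun z => L.Y z a) y)
    ∧ (∀ i, pd (Sum.inl i) (fun z => L.stMetric z (Sum.inr ()) (Sum.inr ())) (L.graphPt y)
      = -pd i L.φ y)
    ∧ ∀ a b, pd (Sum.inr ()) (fun z => L.stMetric z a b) (L.graphPt y) = 0 := by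
  have neg : ∀ {F : E3 → ℝ} (i : Fin 3), pd i (fun z => -F z) y = -pd i F y := fun i => by
    simp [pd, fderiv_fun_neg]
  refine ⟨fun i a b => pd_comp_space_inl (hg a b) i, fun i a => ?_, fun i a => ?_, fun i => ?_,
    fun a b => ?_⟩
  · rw [← neg]; exact pd_comp_space_inl (F := fun z => -L.Y z a) (hY a).fun_neg i
  · rw [← neg]; exact pd_comp_space_inl (F := fun z => -L.Y z a) (hY a).fun_neg i
  · rw [← neg]; exact pd_comp_space_inl (F := fun z => -L.φ z) hφ.fun_neg i
  · obtain a | a := a <;> obtain b | b := b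
    · exact pd_comp_space_inr (hg a b)
    · exact pd_comp_space_inr (F := fun z => -L.Y z a) (hY a).fun_neg
    · exact pd_comp_space_inr (F := fun z => -L.Y z b) (hY b).fun_neg
    · exact pd_comp_space_inr (F := fun z => -L.φ z) hφ.fun_neg

theorem pd_graphTangent (i j : Fin 3) (a : Fin 3 ⊕ Unit) :
    pd i (fun z => L.graphTangent j z a) y
      = Sum.elim (fun _ => 0) (fun _ => pd i (fun z => L.df z j) y) a := by
  obtain a | a := a
  · simp [pd, graphTangent]
  · rfl

namespace Lift

open SmoothGerm DerivCalc

variable (l : L.Lift y)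

local notation "D" => SmoothGerm.deriv y

/-- The vector field `β = u² ∇f + Ȳ` at `y`. -/
def β (i : Fin 3) : ℝ := val y (shift D l.gi l.η l.f l.u l.b i)

theorem val_app_shift (i : Fin 3) : ∑ j, L.g y i j * l.β j = L.Y y i + L.φ y * L.df y i := by
  have h := congrArg (val y) (l.axisym.app_shift_eq i)
  rw [map_add, map_mul (val y) (_ - _), (l.rep_Y i).val_eq, l.rep_φ.val_eq,
    (l.rep_df i).val_eq] at h
  rw [← h, app, map_sum]
  exact Finset.sum_congr rfl fun j _ => by rw [map_mul, (l.rep_g i j).val_eq]; rfl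

theorem val_one_add : 1 + ∑ i, L.df y i * l.β i = L.root y ^ 2 := by
  have h := congrArg (val y) l.axisym.one_add_pair_shift
  rw [map_add, map_mul, l.rep_r.val_eq, map_one, pair, map_sum] at h
  rw [sq, ← h]
  congr 1
  exact Finset.sum_congr rfl fun j _ => by rw [map_mul, (l.rep_df j).val_eq]; rfl

theorem val_normSq : ∑ i, (L.Y y i + L.φ y * L.df y i) * l.β i + L.φ y
    = L.u y ^ 2 * L.root y ^ 2 := by
  have h := congrArg (val y) l.axisym.normSq_shift
  rw [map_add, l.rep_φ.val_eq, map_mul, map_mul, map_mul, l.rep_r.val_eq, l.rep_u.val_eq, pair,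
    map_sum] at h
  rw [sq, sq, ← h]
  congr 1
  refine Finset.sum_congr rfl fun j _ => ?_
  rw [map_mul, ← l.val_app_shift, app, map_sum]
  congr 1
  exact Finset.sum_congr rfl fun k _ => by rw [map_mul, (l.rep_g j k).val_eq]; rfl

end Lift

end ChartData

/-! ### Covariant derivatives along the graph -/

namespace ChartData

open Coord

variable {L : ChartData} {y : E3}

/-- The vector `∂ₜ`. -/
def timeVec : Fin 3 ⊕ Unit → ℝ := Sum.elim (fun _ => 0) fun _ => 1

theorem sum_timeVec (V : Fin 3 ⊕ Unit → ℝ) : ∑ c, V c * timeVec c = V (Sum.inr ()) := by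
  simp [timeVec, Fintype.sum_sum_type]

/-- The inner products of `∇̃_{Xᵢ} Xⱼ` with the basis `∂ₜ`, `Xₗ` of the spacetime tangent space. -/
theorem stInner_stCov_basis (hG : (L.stMetric (L.graphPt y)).det ≠ 0)
    (hs : ∀ a b, L.stMetric (L.graphPt y) a b = L.stMetric (L.graphPt y) b a)
    (hg : ∀ i j, DifferentiableAt ℝ (fun z => L.gbar z i j) y)
    (hY : ∀ i, DifferentiableAt ℝ (fun z => L.Y z i) y) (hφ : DifferentiableAt ℝ L.φ y)
    (i j : Fin 3) :
    L.stInner y (L.stCov i j y) timeVec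
      = -1 / 2 * (pd i (fun z => L.Y z j) y + pd j (fun z => L.Y z i) y
        + L.df y i * pd j L.φ y + L.df y j * pd i L.φ y
        + 2 * L.φ y * pd i (fun z => L.df z j) y)
    ∧ ∀ l, L.stInner y (L.stCov i j y) (L.graphTangent l y)
      = -(L.Y y l + L.φ y * L.df y l) * pd i (fun z => L.df z j) y
        + 1 / 2 * (pd i (fun z => L.gbar z l j) y + pd j (fun z => L.gbar z l i) y
          - pd l (fun z => L.gbar z i j) y
          + L.df y i * (pd l (fun z => L.Y z j) y - pd j (fun z => L.Y z l) y)
          + L.df y j * (pd l (fun z => L.Y z i) y - pd i (fun z => L.Y z l) y)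
          + L.df y i * L.df y j * pd l L.φ y)
        + 1 / 2 * L.df y l * (-pd i (fun z => L.Y z j) y - pd j (fun z => L.Y z i) y
          - L.df y i * pd j L.φ y - L.df y j * pd i L.φ y) := by
  obtain ⟨p1, p2, p3, p4, p5⟩ := pd_stMetric (L := L) hg hY hφ
  have m1 : ∀ a, L.stMetric (L.graphPt y) (Sum.inr ()) (Sum.inl a) = -L.Y y a := fun a => by
    simp [stMetric, space_graphPt]
  have m2 : L.stMetric (L.graphPt y) (Sum.inr ()) (Sum.inr ()) = -L.φ y := by
    simp [stMetric, space_graphPt]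
  have h := stInner_stCov hG hs i j
  have first : ∀ B : Fin 3 ⊕ Unit → ℝ, ∑ a, ∑ b, L.stMetric (L.graphPt y) a b
      * pd i (fun z => L.graphTangent j z a) y * B b
      = pd i (fun z => L.df z j) y * ∑ b, L.stMetric (L.graphPt y) (Sum.inr ()) b * B b := by
    intro B
    rw [Fintype.sum_sum_type]
    simp only [pd_graphTangent, Sum.elim_inl, Sum.elim_inr, mul_zero, zero_mul,
      Finset.sum_const_zero, Finset.univ_unique, Finset.sum_singleton, zero_add, Finset.mul_sum,
      PUnit.default_eq_unit]
    exact Finset.sum_congr rfl fun b _ => by ring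
  refine ⟨?_, fun l => ?_⟩
  · simp only [h, first, sum_sum_graphTangent]
    simp only [mul_comm (timeVec _), sum_timeVec, p3, p4, p5, m2]
    ring
  · simp only [h, first, sum_sum_graphTangent]
    simp only [mul_comm (L.graphTangent l y _), sum_graphTangent, p1, p2, p3, p4, p5, m1, m2]
    ring

theorem stMetric_symm (hs : ∀ i j, L.gbar y i j = L.gbar y j i) (a b : Fin 3 ⊕ Unit) :
    L.stMetric (L.graphPt y) a b = L.stMetric (L.graphPt y) b a := by
  obtain a | a := a <;> obtain b | b := b
  · simpa [stMetric, space_graphPt] using hs a b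
  all_goals simp [stMetric, space_graphPt]

variable (hg : ∀ i j, L.gbar y i j
    = L.g y i j + L.df y i * L.Y y j + L.df y j * L.Y y i + L.φ y * L.df y i * L.df y j)
include hg

theorem stInner_timeVec (V : Fin 3 ⊕ Unit → ℝ) : L.stInner y V timeVec
    = -∑ i, (L.Y y i + L.φ y * L.df y i) * V (Sum.inl i)
      - L.φ y * (V (Sum.inr ()) - ∑ i, L.df y i * V (Sum.inl i)) := by
  rw [stInner_eq hg]
  simp [timeVec]

theorem stInner_graphTangent (V : Fin 3 ⊕ Unit → ℝ) (l : Fin 3) :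
    L.stInner y V (L.graphTangent l y) = ∑ i, L.g y i l * V (Sum.inl i)
      - (V (Sum.inr ()) - ∑ i, L.df y i * V (Sum.inl i)) * (L.Y y l + L.φ y * L.df y l) := by
  rw [stInner_eq hg]
  simp [graphTangent, Pi.single_apply]

/-- A vector orthogonal to the graph is a multiple of `∂ₜ + βⁱ Xᵢ`; the coefficient is
`(dt - df)(V)`. -/
theorem inl_eq_of_normal (hpos : ∀ X : Fin 3 → ℝ, X ≠ 0 → 0 < ∑ i, ∑ j, L.g y i j * X i * X j)
    (hsym : ∀ i j, L.g y i j = L.g y j i)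
    {β : Fin 3 → ℝ} (hβ : ∀ i, ∑ j, L.g y i j * β j = L.Y y i + L.φ y * L.df y i)
    {V : Fin 3 ⊕ Unit → ℝ} (hV : ∀ l, L.stInner y V (L.graphTangent l y) = 0) (i : Fin 3) :
    V (Sum.inl i) = (V (Sum.inr ()) - ∑ i, L.df y i * V (Sum.inl i)) * β i := by
  set c := V (Sum.inr ()) - ∑ i, L.df y i * V (Sum.inl i) with hc
  by_contra hne
  have h0 : ∀ l, ∑ i, L.g y i l * (V (Sum.inl i) - c * β i) = 0 := fun l => by
    have := hV l
    rw [stInner_graphTangent hg, ← hc, ← hβ l] at this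
    simp only [hsym l] at this
    rw [← this, Finset.mul_sum, ← Finset.sum_sub_distrib]
    exact Finset.sum_congr rfl fun i _ => by ring
  refine (hpos (fun i => V (Sum.inl i) - c * β i)
    fun h => hne (sub_eq_zero.1 (congrFun h i))).ne' ?_
  rw [Finset.sum_comm]
  simp only [← Finset.sum_mul, h0, zero_mul, Finset.sum_const_zero]

end ChartData

/-! ### The unit normal and the second fundamental form -/

namespace ChartData

open Coord SmoothGerm DerivCalc

variable {L : ChartData} {y : E3}

/-- The decomposition `N = (dt - df)(N) ∂ₜ + Nˡ Xₗ`, inserted into the second argument. -/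
theorem stInner_eq_add (hg : ∀ i j, L.gbar y i j
      = L.g y i j + L.df y i * L.Y y j + L.df y j * L.Y y i + L.φ y * L.df y i * L.df y j)
    (V N : Fin 3 ⊕ Unit → ℝ) : L.stInner y V N
      = (N (Sum.inr ()) - ∑ i, L.df y i * N (Sum.inl i)) * L.stInner y V timeVec
        + ∑ l, N (Sum.inl l) * L.stInner y V (L.graphTangent l y) := by
  simp only [stInner_timeVec hg, stInner_graphTangent hg, stInner_eq hg, Fin.sum_univ_three]
  ring

theorem AxisymAt.gbar_formula (H : L.AxisymAt y) (i j : Fin 3) : L.gbar y i j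
    = L.g y i j + L.df y i * L.Y y j + L.df y j * L.Y y i + L.φ y * L.df y i * L.df y j :=
  H.gbar_eq.self_of_nhds i j

theorem AxisymAt.gbar_symm (H : L.AxisymAt y) (i j : Fin 3) : L.gbar y i j = L.gbar y j i := by
  rw [H.gbar_formula, H.gbar_formula, H.g_symm.self_of_nhds i j]; ring

namespace Lift

variable (l : L.Lift y)

local notation "D" => SmoothGerm.deriv y

include l in
theorem root_pos : 0 < L.root y := by
  have h := congrArg (val y) l.axisym.r_inv
  rw [map_mul, l.rep_r.val_eq, map_one] at h
  exact (Real.sqrt_nonneg _).lt_of_ne' (left_ne_zero_of_mul_eq_one h)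

theorem val_deriv {a : smoothGerms y} {F : E3 → ℝ} (h : Rep a F) (i : Fin 3) :
    val y (D i a) = pd i F y := (h.deriv i).val_eq

include l in
theorem pd_df_symm (i j : Fin 3) :
    pd i (fun z => L.df z j) y = pd j (fun z => L.df z i) y := by
  rw [← val_deriv (l.rep_df j), ← val_deriv (l.rep_df i), deriv_comm]

include l in
theorem pd_gbar (k i j : Fin 3) : pd k (fun z => L.gbar z i j) y = pd k (fun z => L.g z i j) y
    + (pd k (fun z => L.df z i) y * L.Y y j + L.df y i * pd k (fun z => L.Y z j) y)
    + (pd k (fun z => L.df z j) y * L.Y y i + L.df y j * pd k (fun z => L.Y z i) y)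
    + ((pd k L.φ y * L.df y i + L.φ y * pd k (fun z => L.df z i) y) * L.df y j
      + L.φ y * L.df y i * pd k (fun z => L.df z j) y) := by
  have h := congrArg (val y) (congrArg (D k) (l.axisym.barMetric_eq' i j))
  have hYi := l.rep_Y i
  have hYj := l.rep_Y j
  have hφ := l.rep_φ
  rw [val_deriv (l.rep_gbar i j)] at h
  rw [h]
  generalize 2 * l.b * app (barMetric D l.g l.η l.f l.u l.b) l.η i = Yi at hYi ⊢
  generalize 2 * l.b * app (barMetric D l.g l.η l.f l.u l.b) l.η j = Yj at hYj ⊢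
  generalize l.u * l.u - 4 * l.b * l.b * pair (app l.g l.η) l.η = Φ at hφ ⊢
  simp only [map_add, map_mul, Derivation.leibniz, smul_eq_mul, val_deriv (l.rep_g i j),
    val_deriv hYi, val_deriv hYj, val_deriv hφ, val_deriv (l.rep_df _), hYi.val_eq, hYj.val_eq,
    hφ.val_eq, (l.rep_df _).val_eq]
  ring

/-- `2 u r π = L_β g` at `y`, in terms of the derivatives of the 1-form `Y + φ df` dual to `β`. -/
theorem two_mul_sff (i j : Fin 3) : 2 * (L.u y * L.root y) * L.sff y i j
    = pd i (fun z => L.Y z j) y + (pd i L.φ y * L.df y j + L.φ y * pd i (fun z => L.df z j) y)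
      + (pd j (fun z => L.Y z i) y + (pd j L.φ y * L.df y i + L.φ y * pd j (fun z => L.df z i) y))
      - ∑ m, l.β m * (pd i (fun z => L.g z m j) y + pd j (fun z => L.g z m i) y
        - pd m (fun z => L.g z i j) y) := by
  have h := congrArg (val y) (l.axisym.two_lapse_mul_sff i j)
  have hYi := l.rep_Y i
  have hYj := l.rep_Y j
  have hφ := l.rep_φ
  rw [l.axisym.app_shift_eq, l.axisym.app_shift_eq] at h
  generalize 2 * l.b * app (barMetric D l.g l.η l.f l.u l.b) l.η i = Yi at hYi h
  generalize 2 * l.b * app (barMetric D l.g l.η l.f l.u l.b) l.η j = Yj at hYj h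
  generalize l.u * l.u - 4 * l.b * l.b * pair (app l.g l.η) l.η = Φ at hφ h
  have hβ : ∀ m, val y (shift D l.gi l.η l.f l.u l.b m) = l.β m := fun m => rfl
  rw [map_mul, (l.rep_sff i j).val_eq, map_mul, map_mul, l.rep_u.val_eq, l.rep_r.val_eq,
    rep_two.val_eq] at h
  rw [h]
  simp only [map_add, map_sub, map_sum, map_mul, Derivation.leibniz, smul_eq_mul, hβ,
    val_deriv (l.rep_g _ _), val_deriv hYi, val_deriv hYj, val_deriv hφ, val_deriv (l.rep_df _),
    hφ.val_eq, (l.rep_df _).val_eq]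
  ring

/-- The graph has the unique future directed unit normal `N = (∂ₜ + βⁱ Xᵢ) / (u r)`, where
`r = √(1 + u² |∇f|²)`; its time component is `(1 + df(β)) / (u r) = r² / (u r)`. -/
theorem isUnitNormal_iff (H : L.AxisymAt y) (N : Fin 3 ⊕ Unit → ℝ) : L.IsUnitNormal y N ↔
    N = Sum.elim (fun i => (L.u y * L.root y)⁻¹ * l.β i)
      fun _ => (L.u y * L.root y)⁻¹ * L.root y ^ 2 := by
  have hg := H.gbar_formula
  have hu := H.u_pos.self_of_nhds
  have hr : 0 < L.root y := l.root_pos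
  have h1 := l.val_one_add
  have h2 := l.val_normSq
  have h3 := l.val_app_shift
  have sumβ : ∀ c, ∑ i, L.df y i * (c * l.β i) = c * (L.root y ^ 2 - 1) := fun c => by
    rw [← h1, add_sub_cancel_left, Finset.mul_sum]
    exact Finset.sum_congr rfl fun i _ => by ring
  have sumY : ∀ c, ∑ i, (L.Y y i + L.φ y * L.df y i) * (c * l.β i)
      = c * (L.u y ^ 2 * L.root y ^ 2 - L.φ y) := fun c => by
    rw [← h2, add_sub_cancel_right, Finset.mul_sum]
    exact Finset.sum_congr rfl fun i _ => by ring
  constructor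
  · rintro ⟨n1, n2, n3⟩
    have hN := inl_eq_of_normal hg H.g_pos.self_of_nhds H.g_symm.self_of_nhds h3 n2
    set c := N (Sum.inr ()) - ∑ i, L.df y i * N (Sum.inl i) with hc
    rw [stInner_eq_add hg] at n1
    simp only [n2, mul_zero, Finset.sum_const_zero, add_zero, ← hc, stInner_timeVec hg] at n1
    simp only [hN, sumY] at n1
    have ht : N (Sum.inr ()) = c * L.root y ^ 2 := by
      have : N (Sum.inr ()) = c + ∑ i, L.df y i * N (Sum.inl i) := by rw [hc]; ring
      rw [this]
      simp only [hN, sumβ]; ring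
    have hcpos : 0 < c := by
      rw [ht] at n3
      exact pos_of_mul_pos_left n3 (by positivity)
    have hc1 : c * (L.u y * L.root y) = 1 := by
      have h4 : (c * (L.u y * L.root y)) ^ 2 = 1 := by linear_combination -n1
      exact (pow_eq_one_iff_of_nonneg (by positivity) two_ne_zero).1 h4
    have hc2 : c = (L.u y * L.root y)⁻¹ := eq_inv_of_mul_eq_one_left hc1
    ext a
    obtain a | a := a
    · rw [hN, hc2]; rfl
    · rw [← hc2]; exact ht
  · rintro rfl
    set c := (L.u y * L.root y)⁻¹ with hc
    have hc1 : c * (L.u y * L.root y) = 1 := inv_mul_cancel₀ (by positivity)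
    have hn : ∀ i, L.stInner y (Sum.elim (fun i => c * l.β i) fun _ => c * L.root y ^ 2)
        (L.graphTangent i y) = 0 := fun i => by
      rw [stInner_graphTangent hg]
      simp only [Sum.elim_inl, Sum.elim_inr, sumβ, ← h3, Finset.mul_sum, ← Finset.sum_sub_distrib]
      refine Finset.sum_eq_zero fun m _ => ?_
      rw [H.g_symm.self_of_nhds m i]; ring
    refine ⟨?_, hn, by simp only [Sum.elim_inr]; positivity⟩
    rw [stInner_eq_add hg]
    simp only [hn, mul_zero, Finset.sum_const_zero, add_zero, stInner_timeVec hg]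
    simp only [Sum.elim_inl, Sum.elim_inr, sumβ, sumY]
    linear_combination -(c * (L.u y * L.root y) + 1) * hc1

include l in
theorem det_stMetric_ne_zero (H : L.AxisymAt y) : (L.stMetric (L.graphPt y)).det ≠ 0 := by
  intro hdet
  obtain ⟨V, hV0, hV⟩ := Matrix.exists_vecMul_eq_zero_iff.2 hdet
  have hg := H.gbar_formula
  have hu := H.u_pos.self_of_nhds
  have hr : 0 < L.root y := l.root_pos
  have hVB : ∀ B, L.stInner y V B = 0 := fun B => by
    rw [stInner, Finset.sum_comm]
    refine Finset.sum_eq_zero fun b _ => ?_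
    have := congrFun hV b
    simp only [Matrix.vecMul, dotProduct, Pi.zero_apply] at this
    rw [← Finset.sum_mul]
    simp only [mul_comm _ (V _), this, zero_mul]
  have hN := inl_eq_of_normal hg H.g_pos.self_of_nhds H.g_symm.self_of_nhds l.val_app_shift
    fun i => hVB _
  have ht := hVB timeVec
  rw [stInner_timeVec hg] at ht
  set c := V (Sum.inr ()) - ∑ i, L.df y i * V (Sum.inl i) with hc
  have hc0 : c = 0 := by
    have h2 := l.val_normSq
    have : ∑ i, (L.Y y i + L.φ y * L.df y i) * V (Sum.inl i)
        = c * ∑ i, (L.Y y i + L.φ y * L.df y i) * l.β i := by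
      rw [Finset.mul_sum]
      exact Finset.sum_congr rfl fun i _ => by rw [hN]; ring
    rw [this] at ht
    have h3 : c * (L.u y ^ 2 * L.root y ^ 2) = 0 := by linear_combination -ht - c * h2
    exact (mul_eq_zero.1 h3).resolve_right (by positivity)
  simp only [hc0, zero_mul] at hN
  refine hV0 (funext fun a => ?_)
  obtain a | a := a
  · exact hN a
  · simpa [hN, hc0] using hc.symm

include l in
/-- `π` is the second fundamental form of the graph: both `2 u r π` and `-2 u r g̃(∇̃_{Xᵢ} Xⱼ, N)`
are the Lie derivative of `g` along `β`. -/
theorem isGraphSecondFundamentalForm (H : L.AxisymAt y) : L.IsGraphSecondFundamentalForm y := by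
  have hu := H.u_pos.self_of_nhds
  have hr : 0 < L.root y := l.root_pos
  refine ⟨⟨_, (l.isUnitNormal_iff H _).2 rfl, fun N hN => (l.isUnitNormal_iff H N).1 hN⟩,
    fun N hN i j => ?_⟩
  have hg := H.gbar_formula
  have hd : ∀ {a : smoothGerms y} {F : E3 → ℝ}, Rep a F → DifferentiableAt ℝ F y := fun h =>
    h.contDiffAt.differentiableAt (by simp)
  obtain ⟨b1, b2⟩ := stInner_stCov_basis (l.det_stMetric_ne_zero H) (stMetric_symm H.gbar_symm)
    (fun i j => hd (l.rep_gbar i j)) (fun i => hd (l.rep_Y i)) (hd l.rep_φ) i j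
  have hs := l.pd_df_symm
  have b3 : ∀ m, L.stInner y (L.stCov i j y) (L.graphTangent m y)
      = 1 / 2 * (pd i (fun z => L.g z m j) y + pd j (fun z => L.g z m i) y
        - pd m (fun z => L.g z i j) y) := fun m => by
    rw [b2, l.pd_gbar, l.pd_gbar, l.pd_gbar, hs j i, hs i m, hs j m]; ring
  have key := l.two_mul_sff i j
  rw [(l.isUnitNormal_iff H N).1 hN, stInner_eq_add hg, b1]
  simp only [b3, Sum.elim_inl, Sum.elim_inr]
  have h1 := l.val_one_add
  have e1 : (L.u y * L.root y)⁻¹ * L.root y ^ 2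
      - ∑ m, L.df y m * ((L.u y * L.root y)⁻¹ * l.β m) = (L.u y * L.root y)⁻¹ := by
    rw [show ∑ m, L.df y m * ((L.u y * L.root y)⁻¹ * l.β m)
      = (L.u y * L.root y)⁻¹ * ∑ m, L.df y m * l.β m by
        rw [Finset.mul_sum]; exact Finset.sum_congr rfl fun m _ => by ring]
    linear_combination -(L.u y * L.root y)⁻¹ * h1
  rw [e1]
  have e2 : ∑ m, (L.u y * L.root y)⁻¹ * l.β m * (1 / 2 * (pd i (fun z => L.g z m j) y
        + pd j (fun z => L.g z m i) y - pd m (fun z => L.g z i j) y))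
      = (L.u y * L.root y)⁻¹ * (1 / 2) * ∑ m, l.β m * (pd i (fun z => L.g z m j) y
        + pd j (fun z => L.g z m i) y - pd m (fun z => L.g z i j) y) := by
    rw [Finset.mul_sum]; exact Finset.sum_congr rfl fun m _ => by ring
  rw [e2]
  have hc1 : (L.u y * L.root y)⁻¹ * (L.u y * L.root y) = 1 := inv_mul_cancel₀ (by positivity)
  rw [hs j i] at key
  linear_combination (L.u y * L.root y)⁻¹ / 2 * key - L.sff y i j * hc1

end Lift

end ChartData

/-! ### Components of fields in a chart -/

section Manifold

variable {M : Type*} [TopologicalSpace M] [ChartedSpace E3 M]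
  {e : OpenPartialHomeomorph M E3} {y : E3}

/-- The tangent map of a smooth map, along a smooth family of tangent vectors. -/
theorem contMDiffAt_tangentMap {E E' F H H' K N N' N'' : Type*}
    [NormedAddCommGroup E] [NormedSpace ℝ E] [TopologicalSpace H] {I : ModelWithCorners ℝ E H}
    [NormedAddCommGroup E'] [NormedSpace ℝ E'] [TopologicalSpace H'] {I' : ModelWithCorners ℝ E' H'}
    [NormedAddCommGroup F] [NormedSpace ℝ F] [TopologicalSpace K] {J : ModelWithCorners ℝ F K}
    [TopologicalSpace N] [ChartedSpace H N] [IsManifold I ∞ N]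
    [TopologicalSpace N'] [ChartedSpace H' N'] [IsManifold I' ∞ N']
    [TopologicalSpace N''] [ChartedSpace K N'']
    {F : N → N'} {s : Set N} (hs : IsOpen s) (hF : ContMDiffOn I I' ∞ F s)
    {V : N'' → TangentBundle I N} {p : N''} (hV : ContMDiffAt J I.tangent ∞ V p)
    (hp : (V p).1 ∈ s) : ContMDiffAt J I'.tangent ∞ (fun q => tangentMap I I' F (V q)) p := by
  have h1 : ContMDiffOn I.tangent I'.tangent ∞ (tangentMapWithin I I' F s)
      (Bundle.TotalSpace.proj ⁻¹' s) :=
    hF.contMDiffOn_tangentMapWithin (by simp) hs.uniqueMDiffOn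
  have ho : IsOpen (Bundle.TotalSpace.proj ⁻¹' s : Set (TangentBundle I N)) :=
    hs.preimage (FiberBundle.continuous_proj E (TangentSpace I))
  have h2 := (h1.contMDiffAt (ho.mem_nhds hp)).comp p hV
  refine h2.congr_of_eventuallyEq ?_
  filter_upwards [hV.continuousAt.preimage_mem_nhds (ho.mem_nhds hp)] with q hq
  exact (tangentMapWithin_eq_tangentMap (hs.uniqueMDiffWithinAt hq)
    ((hF.contMDiffAt (hs.mem_nhds hq)).mdifferentiableAt (by simp))).symm

section

variable (he : e ∈ IsManifold.maximalAtlas (𝓡 3) ∞ M)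
include he

theorem contMDiffAt_coordVec [IsManifold (𝓡 3) ∞ M] (hy : y ∈ e.target) (i : Fin 3) :
    ContMDiffAt (𝓡 3) (𝓡 3).tangent ∞
      (fun z => (⟨e.symm z, coordVec e i z⟩ : TangentBundle (𝓡 3) M)) y := by
  have h : ContMDiffAt (𝓡 3) (𝓡 3).tangent ∞
      (fun z => (⟨z, (EuclideanSpace.single i (1 : ℝ) : E3)⟩ : TangentBundle (𝓡 3) E3)) y :=
    contMDiffAt_vectorSpace_iff_contDiffAt.2 contDiffAt_const
  exact contMDiffAt_tangentMap e.open_target (contMDiffOn_symm_of_mem_maximalAtlas he) h hy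

theorem contMDiffAt_chart_symm (hy : y ∈ e.target) : ContMDiffAt (𝓡 3) (𝓡 3) ∞ e.symm y :=
  contMDiffAt_symm_of_mem_maximalAtlas he hy

theorem contDiffAt_comp_symm {F : M → ℝ} (hF : ContMDiff (𝓡 3) 𝓘(ℝ, ℝ) ∞ F) (hy : y ∈ e.target) :
    ContDiffAt ℝ ∞ (fun z => F (e.symm z)) y :=
  (hF.contMDiffAt.comp y (contMDiffAt_chart_symm he hy)).contDiffAt

theorem contDiffAt_vecComp [IsManifold (𝓡 3) ∞ M] {X : ∀ x : M, TangentSpace (𝓡 3) x}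
    (hX : ContMDiff (𝓡 3) (𝓡 3).tangent ∞ (fun x => (⟨x, X x⟩ : TangentBundle (𝓡 3) M)))
    (hy : y ∈ e.target) (i : Fin 3) : ContDiffAt ℝ ∞ (fun z => vecComp e X z i) y := by
  have h1 := hX.contMDiffAt.comp y (contMDiffAt_chart_symm he hy)
  have h2 := contMDiffAt_tangentMap e.open_source (contMDiffOn_of_mem_maximalAtlas he) h1
    (e.map_target hy)
  have h3 : ContMDiffAt (𝓡 3) 𝓘(ℝ, E3) ∞ _ y :=
    (contMDiff_snd_tangentBundle_modelSpace E3 (𝓡 3)).contMDiffAt.comp y h2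
  have h4 := h3.contDiffAt
  exact (contDiffAt_euclidean.1 h4) i

theorem contDiffAt_tensorComp [IsManifold (𝓡 3) ∞ M]
    {h : ∀ x : M, TangentSpace (𝓡 3) x →L[ℝ] TangentSpace (𝓡 3) x →L[ℝ] ℝ}
    (hh : ContMDiff (𝓡 3) ((𝓡 3).prod 𝓘(ℝ, E3 →L[ℝ] E3 →L[ℝ] ℝ)) ∞
      (fun x => Bundle.TotalSpace.mk' (E3 →L[ℝ] E3 →L[ℝ] ℝ) x (h x)))
    (hy : y ∈ e.target) (i j : Fin 3) :
    ContDiffAt ℝ ∞ (fun z => tensorComp e (fun x X Z => h x X Z) z i j) y := by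
  have h1 := hh.contMDiffAt.comp y (contMDiffAt_chart_symm he hy)
  have h2 := h1.clm_bundle_apply₂ (F₁ := E3) (F₂ := E3) (F₃ := ℝ) (b := e.symm)
    (E₃ := fun _ : M => ℝ)
    (contMDiffAt_coordVec he hy i) (contMDiffAt_coordVec he hy j)
  exact (Bundle.contMDiffAt_totalSpace.1 h2).2.contDiffAt

theorem contDiffAt_covecComp [IsManifold (𝓡 3) ∞ M] {α : ∀ x : M, TangentSpace (𝓡 3) x →L[ℝ] ℝ}
    (hα : ContMDiff (𝓡 3) ((𝓡 3).prod 𝓘(ℝ, E3 →L[ℝ] ℝ)) ∞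
      (fun x => Bundle.TotalSpace.mk' (E3 →L[ℝ] ℝ) x (α x)))
    (hy : y ∈ e.target) (i : Fin 3) :
    ContDiffAt ℝ ∞ (fun z => α (e.symm z) (coordVec e i z)) y := by
  have h1 := hα.contMDiffAt.comp y (contMDiffAt_chart_symm he hy)
  have h2 := h1.clm_bundle_apply (F₁ := E3) (F₂ := ℝ) (b := e.symm) (E₂ := fun _ : M => ℝ)
    (contMDiffAt_coordVec he hy i)
  exact (Bundle.contMDiffAt_totalSpace.1 h2).2.contDiffAt

theorem chart_mdifferentiable : e.MDifferentiable (𝓡 3) (𝓡 3) :=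
  ⟨(contMDiffOn_of_mem_maximalAtlas he).mdifferentiableOn (by simp),
    (contMDiffOn_symm_of_mem_maximalAtlas he).mdifferentiableOn (by simp)⟩

omit he in
theorem sum_smul_coordVec (V : E3) :
    ∑ i, V i • coordVec e i y = mfderiv (𝓡 3) (𝓡 3) e.symm y V := by
  have hV : V = ∑ i, V i • (EuclideanSpace.single i (1 : ℝ) : E3) := by
    ext j; simp [Pi.single_apply]
  conv_rhs => rw [hV]
  exact ((map_sum (mfderiv (𝓡 3) (𝓡 3) e.symm y) _ _).trans
    (Finset.sum_congr rfl fun i _ => map_smul _ _ _)).symm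

/-- A vector field is `∑ Xⁱ ∂ᵢ`. -/
theorem vector_eq_sum (hy : y ∈ e.target) (X : ∀ x : M, TangentSpace (𝓡 3) x) :
    X (e.symm y) = ∑ i, vecComp e X y i • coordVec e i y := by
  have h := (chart_mdifferentiable he).symm_comp_deriv (e.map_target hy)
  rw [e.right_inv hy] at h
  have h2 := sum_smul_coordVec (e := e) (y := y) (mfderiv (𝓡 3) (𝓡 3) e (e.symm y) (X (e.symm y)))
  have h3 := DFunLike.congr_fun h (X (e.symm y))
  exact h3.symm.trans h2.symm

theorem sum_smul_coordVec_ne_zero (hy : y ∈ e.target) {c : Fin 3 → ℝ} (hc : c ≠ 0) :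
    ∑ i, c i • coordVec e i y ≠ 0 := by
  intro h0
  have h2 := sum_smul_coordVec (e := e) (y := y) (WithLp.toLp 2 c)
  have h := (chart_mdifferentiable he).comp_symm_deriv hy
  have h3 := DFunLike.congr_fun h (WithLp.toLp 2 c : E3)
  have h4 : mfderiv (𝓡 3) (𝓡 3) e.symm y (WithLp.toLp 2 c : E3) = 0 := h2.symm.trans h0
  have h5 : (WithLp.toLp 2 c : E3) = 0 := by
    refine h3.symm.trans ?_
    show mfderiv (𝓡 3) (𝓡 3) e (e.symm y) (mfderiv (𝓡 3) (𝓡 3) e.symm y (WithLp.toLp 2 c : E3)) = 0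
    rw [h4]
    exact map_zero _
  exact hc (funext fun i => congrArg (fun V : E3 => V i) h5)

theorem pd_comp_symm {F : M → ℝ} (hF : ContMDiff (𝓡 3) 𝓘(ℝ, ℝ) ∞ F) (hy : y ∈ e.target)
    (i : Fin 3) : Coord.pd i (fun z => F (e.symm z)) y
      = (mfderiv (𝓡 3) 𝓘(ℝ, ℝ) F (e.symm y) (coordVec e i y) : ℝ) := by
  have h := mfderiv_comp y (hF.mdifferentiableAt (by simp))
    ((contMDiffAt_chart_symm he hy).mdifferentiableAt (by simp))
  have h2 := DFunLike.congr_fun h (EuclideanSpace.single i (1 : ℝ) : E3)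
  rw [Coord.pd, ← mfderiv_eq_fderiv]
  exact h2

end

end Manifold

/-! ### The deformation on a manifold -/

section Manifold

variable {M : Type*} [TopologicalSpace M] [ChartedSpace E3 M] [IsManifold (𝓡 3) ∞ M]
  {D : Deformation M} {η : ∀ x : M, TangentSpace (𝓡 3) x} {Yφ : M → ℝ}
  {e : OpenPartialHomeomorph M E3} {y : E3}

theorem GraphData.gbar_sum (D : GraphData M) {x : M} {ι : Type*} (s : Finset ι) (c : ι → ℝ)
    (V : ι → TangentSpace (𝓡 3) x) (Z : TangentSpace (𝓡 3) x) :
    D.gbar x (∑ i ∈ s, c i • V i) Z = ∑ i ∈ s, c i * D.gbar x (V i) Z := by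
  have h1 : D.g.inner x (∑ i ∈ s, c i • V i) Z = ∑ i ∈ s, c i * D.g.inner x (V i) Z := by
    simp [map_sum]
  have h2 : D.Y x (∑ i ∈ s, c i • V i) = ∑ i ∈ s, c i * D.Y x (V i) := by
    simp [map_sum]
  have h3 : D.df x (∑ i ∈ s, c i • V i) = ∑ i ∈ s, c i * D.df x (V i) := by
    unfold GraphData.df
    exact (map_sum (mfderiv (𝓡 3) 𝓘(ℝ, ℝ) D.f x) _ _).trans
      (Finset.sum_congr rfl fun i _ => map_smul _ _ _)
  simp only [GraphData.gbar, h1, h2, h3, Finset.sum_mul, Finset.mul_sum, ← Finset.sum_add_distrib]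
  exact Finset.sum_congr rfl fun i _ => by ring

theorem GraphData.gbar_symm (D : GraphData M) (x : M) (X Z : TangentSpace (𝓡 3) x) :
    D.gbar x X Z = D.gbar x Z X := by
  simp only [GraphData.gbar, D.g.symm x X Z]; ring

/-- In a chart the hypotheses of the axially symmetric case hold near every point. -/
theorem Deformation.axisymAt (H : D.IsAxisymmetric η Yφ)
    (he : e ∈ IsManifold.maximalAtlas (𝓡 3) ∞ M) (hy : y ∈ e.target) :
    (D.inChart η Yφ e).AxisymAt y := by
  have ht : ∀ᶠ z in 𝓝 y, z ∈ e.target := e.open_target.mem_nhds hy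
  have hdf : ∀ z ∈ e.target, ∀ i, (D.inChart η Yφ e).df z i = D.df (e.symm z) (coordVec e i z) :=
    fun z hz i => pd_comp_symm he D.f_smooth hz i
  refine
    { g_smooth := contDiffAt_tensorComp he D.g.contMDiff hy
      k_smooth := contDiffAt_tensorComp he D.k_smooth hy
      Y_smooth := contDiffAt_covecComp he D.Y_smooth hy
      η_smooth := contDiffAt_vecComp he H.η_smooth hy
      f_smooth := contDiffAt_comp_symm he D.f_smooth hy
      φ_smooth := contDiffAt_comp_symm he D.φ_smooth hy
      u_smooth := contDiffAt_comp_symm he D.u_smooth hy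
      Yφ_smooth := contDiffAt_comp_symm he H.Yφ_smooth hy
      g_symm := .of_forall fun z i j => D.g.symm _ _ _
      k_symm := .of_forall fun z i j => D.k_symm _ _ _
      g_pos := ?_, gbar_eq := ?_, Y_eq := ?_
      u_pos := .of_forall fun z => D.u_pos _
      u_sq := ?_, shift := ?_
      lie_g := ht.mono fun z hz => H.lie_g e he z hz
      lie_k := ht.mono fun z hz => H.lie_k e he z hz
      div_k := ht.mono fun z hz => H.div_k e he z hz
      lie_f := ht.mono fun z hz => H.lie_f e he z hz
      lie_φ := ht.mono fun z hz => H.lie_φ e he z hz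
      lie_Y := ht.mono fun z hz => H.lie_Y e he z hz
      div_kbar := ht.mono fun z hz => H.div_kbar e he z hz }
  · filter_upwards [ht] with z hz X hX
    have hp := sum_smul_coordVec_ne_zero he hz hX
    refine (D.g.pos _ _ hp).trans_eq ?_
    simp only [map_sum, map_smul, sum_apply, smul_apply,
      smul_eq_mul, Finset.mul_sum]
    exact Finset.sum_congr rfl fun i _ => Finset.sum_congr rfl fun j _ => by
      rw [D.g.symm]; show _ = D.g.inner _ _ _ * _ * _; ring
  · filter_upwards [ht] with z hz i j
    simp only [hdf z hz]
    rfl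
  · filter_upwards [ht] with z hz i
    show D.Y (e.symm z) (coordVec e i z) = ∑ j, D.gbar _ _ _ * vecComp e D.Ybar z j
    rw [D.Ybar_dual, vector_eq_sum he hz D.Ybar, D.gbar_sum]
    exact Finset.sum_congr rfl fun j _ => by rw [D.gbar_symm, mul_comm]
  · filter_upwards [ht] with z hz
    show D.u (e.symm z) ^ 2 = D.φ (e.symm z)
      + ∑ i, D.Y (e.symm z) (coordVec e i z) * vecComp e D.Ybar z i
    rw [D.u_sq]
    congr 1
    conv_lhs => rw [vector_eq_sum he hz D.Ybar]
    rw [map_sum]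
    exact Finset.sum_congr rfl fun j _ => by rw [map_smul, smul_eq_mul, mul_comm]
  · filter_upwards [ht] with z hz i
    show vecComp e D.Ybar z i = Yφ (e.symm z) * vecComp e η z i
    unfold vecComp
    rw [H.shift, map_smul]
    rfl

/-- `ḡ(X, X) = g(X + df(X) Ȳ, X + df(X) Ȳ) + u² df(X)²` if `df(Ȳ) = 0`. -/
theorem Deformation.gbar_self (x : M) (h : D.df x (D.Ybar x) = 0) (X : TangentSpace (𝓡 3) x) :
    D.gbar x X X = D.g.inner x (X + D.df x X • D.Ybar x) (X + D.df x X • D.Ybar x)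
      + D.u x ^ 2 * D.df x X ^ 2 := by
  have hX := D.Ybar_dual x X
  have hZ := D.Ybar_dual x (D.Ybar x)
  have hu := D.u_sq x
  simp only [GraphData.gbar, h] at hX hZ
  have hs := D.g.symm x X (D.Ybar x)
  have he : D.g.inner x (X + D.df x X • D.Ybar x) (X + D.df x X • D.Ybar x)
      = D.g.inner x X X + D.df x X * D.g.inner x X (D.Ybar x)
        + D.df x X * (D.g.inner x (D.Ybar x) X + D.df x X * D.g.inner x (D.Ybar x) (D.Ybar x)) := by
    have add : ∀ W, D.g.inner x (X + D.df x X • D.Ybar x) W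
        = D.g.inner x X W + D.df x X * D.g.inner x (D.Ybar x) W := fun W => by
      rw [map_add, map_smul, add_apply, smul_apply, smul_eq_mul]
    rw [add, D.g.symm x X, D.g.symm x (D.Ybar x), add, add, hs]
  rw [he, GraphData.gbar]
  linear_combination 2 * D.df x X * hX - D.df x X ^ 2 * hu + D.df x X ^ 2 * hZ - D.df x X * hs

theorem Deformation.gbar_pos (h : ∀ x, D.df x (D.Ybar x) = 0) (x : M) (X : TangentSpace (𝓡 3) x)
    (hX : X ≠ 0) : 0 < D.gbar x X X := by
  rw [D.gbar_self x (h x)]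
  have hu := D.u_pos x
  by_cases hp : D.df x X = 0
  · simpa [hp] using D.g.pos x X hX
  · have h1 : 0 ≤ D.g.inner x (X + D.df x X • D.Ybar x) (X + D.df x X • D.Ybar x) := by
      by_cases hW : X + D.df x X • D.Ybar x = 0
      · simp [hW]
      · exact (D.g.pos x _ hW).le
    have h2 : 0 < D.df x X ^ 2 := by positivity
    positivity

theorem Deformation.IsAxisymmetric.df_Ybar (H : D.IsAxisymmetric η Yφ) (x : M) :
    D.df x (D.Ybar x) = 0 := by
  have key : ∀ e ∈ IsManifold.maximalAtlas (𝓡 3) ∞ M, ∀ y ∈ e.target,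
      D.df (e.symm y) (D.Ybar (e.symm y)) = 0 := by
    intro e he y hy
    have h1 : D.df (e.symm y) (η (e.symm y)) = 0 := by
      rw [← H.lie_f e he y hy, Coord.lie0]
      conv_lhs => rw [vector_eq_sum he hy η]
      unfold GraphData.df
      refine (map_sum (mfderiv (𝓡 3) 𝓘(ℝ, ℝ) D.f (e.symm y)) _ _).trans
        (Finset.sum_congr rfl fun i _ => ?_)
      rw [map_smul]
      exact congrArg (vecComp e η y i * ·) (pd_comp_symm he D.f_smooth hy i).symm
    rw [H.shift]
    unfold GraphData.df at h1 ⊢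
    rw [map_smul, h1]
    exact mul_zero (Yφ (e.symm y))
  have h := key (chartAt E3 x) (IsManifold.chart_mem_maximalAtlas x) _ (mem_chart_target E3 x)
  rwa [(chartAt E3 x).left_inv (mem_chart_source E3 x)] at h

theorem Deformation.IsAxisymmetric.conclusion (H : D.IsAxisymmetric η Yφ) : D.Conclusion η Yφ where
  gbar_pos := D.gbar_pos H.df_Ybar
  formula e he y hy := by
    obtain ⟨l⟩ := (D.axisymAt H he hy).nonempty_lift
    exact l.formula (D.axisymAt H he hy)
  sff_eq e he y hy := by
    obtain ⟨l⟩ := (D.axisymAt H he hy).nonempty_lift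
    exact l.isGraphSecondFundamentalForm (D.axisymAt H he hy)

/-- If `Y = 0`, then `φ = u²`, and `ḡ(Ȳ, Ȳ) = Y(Ȳ) = 0` reads `g(Ȳ, Ȳ) + u² df(Ȳ)² = 0`. -/
theorem Deformation.Ybar_eq_zero (hY : ∀ x, D.Y x = 0) (x : M) : D.Ybar x = 0 := by
  by_contra h0
  have h1 := D.Ybar_dual x (D.Ybar x)
  have h2 := D.u_sq x
  simp only [GraphData.gbar, hY, zero_apply, mul_zero, add_zero] at h1 h2
  have h3 := D.g.pos x _ h0
  rw [← h2] at h1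
  nlinarith [sq_nonneg (D.u x * D.df x (D.Ybar x))]

/-- If `Y = 0`, the hypotheses of the axially symmetric case hold for the vector field `η = 0`. -/
theorem Deformation.isAxisymmetric_zero (hY : ∀ x, D.Y x = 0) :
    D.IsAxisymmetric (fun _ => 0) (fun _ => 0) := by
  have hη : ∀ e : OpenPartialHomeomorph M E3,
      (D.inChart (fun _ => 0) (fun _ => 0) e).η = fun _ _ => 0 := fun e => by
    funext y i
    show vecComp e (fun _ => 0) y i = 0
    unfold vecComp
    rw [map_zero]
    rfl
  have hpd : ∀ i y, Coord.pd i (fun _ : E3 => (0 : ℝ)) y = 0 := fun i y => by simp [Coord.pd]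
  refine
    { η_smooth := Bundle.contMDiff_zeroSection ℝ (TangentSpace (𝓡 3) : M → Type _)
      Yφ_smooth := contMDiff_const
      lie_g := ?_, lie_k := ?_, div_k := ?_, lie_f := ?_, lie_φ := ?_, lie_Y := ?_
      shift := fun x => by rw [D.Ybar_eq_zero hY, smul_zero]
      div_kbar := ?_ } <;>
  · intro e he y hy
    simp [hη, hpd, Coord.lie0, Coord.lie1, Coord.lie2]

end Manifold

end

theorem theorem1 {M : Type*} [TopologicalSpace M] [ChartedSpace E3 M] [IsManifold (𝓡 3) ∞ M]
    (D : Deformation M) :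
    (∀ (η : ∀ x : M, TangentSpace (𝓡 3) x) (Yφ : M → ℝ),
      D.IsAxisymmetric η Yφ → D.Conclusion η Yφ) ∧
    ((∀ x, D.Y x = 0) → D.Conclusion (fun _ => 0) (fun _ => 0)) :=
  ⟨fun _ _ H => H.conclusion, fun hY => (D.isAxisymmetric_zero hY).conclusion⟩
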